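/- Fix two Grothendieck universes $\mathcal U_1\in\mathcal U_2$; "small" and "large" mean belonging to $\mathcal U_1$ and $\mathcal U_2$ respectively. Let $\mathbf{VDBL}$ be the $2$-category of large virtual double categories, virtual double functors and vertical transformations (a virtual double category has a category of objects and vertical morphisms, horizontal morphisms between objects, and multicells whose top boundary is a finite, possibly empty, sequence of horizontal morphisms, whose sides are vertical morphisms and whose bottom boundary is one horizontal morphism, with associative and unital composition). Let $1$ be its terminal object. For a category $\mathcal C$ let $\mathcal C_{\mathrm{hc}}$ be the virtual double category with vertical category $\mathcal C$, with exactly one horizontal morphism between any two objects, and with exactly one multicell for each boundary. Let $P\colon \mathbf{Set}_*\to\mathbf{Set}$ be the forgetful functor from small pointed sets to small sets, and $P_{\mathrm{hc}}\colon(\mathbf{Set}_*)_{\mathrm{hc}}\to\mathbf{Set}_{\mathrm{hc}}$ the induced virtual double functor. For a large virtual double category $\mathbb A$ let $\mathbb{M}\mathrm{at}(\mathbb A)$ be the following virtual double category. An object is a pair $(I,(A_i)_{i\in I})$ of a small set and a family of objects of $\mathbb A$. A vertical morphism $(I,A)\to(I',A')$ is a function $v\colon I\to I'$ with vertical morphisms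 $f_i\colon A_i\to A'_{v(i)}$ of $\mathbb A$ for all $i\in I$. A horizontal morphism from $(I,A)$ to $(I',A')$ is a matrix $(\Gamma_{i,i'})_{i\in I,i'\in I'}$ of horizontal morphisms $\Gamma_{i,i'}$ of $\mathbb A$ from $A_i$ to $A'_{i'}$. A multicell with top boundary $\Gamma_1,\dots,\Gamma_n$ (where $\Gamma_k$ goes from $(I_{k-1},A_{k-1})$ to $(I_k,A_k)$), sides $(v,f)$ and $(v',f')$, and bottom boundary $\Gamma$ is a family, indexed by $(i_0,\dots,i_n)\in I_0\times\dots\times I_n$, of multicells of $\mathbb A$ with top boundary $\Gamma_{1,i_0,i_1},\dots,\Gamma_{n,i_{n-1},i_n}$, sides $f_{i_0}$ and $f'_{i_n}$, and bottom boundary $\Gamma_{v(i_0),v'(i_n)}$. Identities and composition are formed entrywise. Virtual double functors and vertical transformations act entrywise, and this gives a $2$-functor $\mathbb{M}\mathrm{at}\colon\mathbf{VDBL}\to\mathbf{VDBL}$. Then the following hold. 1. $P_{\mathrm{hc}}$ is a discrete opfibration of virtual double categories: each vertical morphism $P_{\mathrm{hc}}X\to Y$ lifts uniquely to a vertical morphism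 with domain $X$, and, for each finite (possibly empty) composable sequence $\Phi_1,\dots,\Phi_n$ of horizontal morphisms of $(\mathbf{Set}_*)_{\mathrm{hc}}$, each multicell with top boundary $P_{\mathrm{hc}}\Phi_1,\dots,P_{\mathrm{hc}}\Phi_n$ lifts uniquely to a multicell with top boundary $\Phi_1,\dots,\Phi_n$. 2. $\mathbb{M}\mathrm{at}$ is the polynomial $2$-functor induced by $P_{\mathrm{hc}}$: the $2$-functor $(\mathbf{Set}_*)_{\mathrm{hc}}\times(-)\colon\mathbf{VDBL}\to\mathbf{VDBL}/(\mathbf{Set}_*)_{\mathrm{hc}}$ (pullback along $(\mathbf{Set}_*)_{\mathrm{hc}}\to1$) and the pullback $2$-functor $P_{\mathrm{hc}}^*\colon\mathbf{VDBL}/\mathbf{Set}_{\mathrm{hc}}\to\mathbf{VDBL}/(\mathbf{Set}_*)_{\mathrm{hc}}$ between strict slice $2$-categories exist, $P_{\mathrm{hc}}^*$ has a right $2$-adjoint $\prod_{P_{\mathrm{hc}}}$, and, for any choice of these, the composite $$\mathbf{VDBL}\xrightarrow{(\mathbf{Set}_*)_{\mathrm{hc}}\times(-)}\mathbf{VDBL}/(\mathbf{Set}_*)_{\mathrm{hc}}\xrightarrow{\prod_{P_{\mathrm{hc}}}}\mathbf{VDBL}/\mathbf{Set}_{\mathrm{hc}}\xrightarrow{\text{forgetful}}\mathbf{VDBL}$$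 is $2$-naturally isomorphic to $\mathbb{M}\mathrm{at}$. In this sense the composite sends $\mathbb A$ to the virtual double category of matrices in $\mathbb A$. 3. $\mathbb{M}\mathrm{at}$ is familial. That is, the $2$-functor $\mathbb{M}\mathrm{at}_1\colon\mathbf{VDBL}\to\mathbf{VDBL}/\mathbb{M}\mathrm{at}(1)$ sending $\mathbb A$ to $\mathbb{M}\mathrm{at}(\mathbb A\to1)$ has a left $2$-adjoint, and it factorizes through the forgetful $2$-functor $\mathrm{Spl}(\mathbb{M}\mathrm{at}(1))\to\mathbf{VDBL}/\mathbb{M}\mathrm{at}(1)$. Here, for an object $B$ of a $2$-category $\mathcal K$, the objects of the $2$-category $\mathrm{Spl}(B)$ are the split fibrations over $B$ (morphisms $p\colon E\to B$ with a split fibration structure on each functor $\mathcal K(X,p)$, such that each functor $\mathcal K(f,E)$ preserves chosen cartesian lifts), its $1$-cells are the $1$-cells of $\mathcal K/B$ preserving chosen cartesian lifts, and its $2$-cells are those of $\mathcal K/B$. -/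

import Mathlib

open CategoryTheory
universe w u v

/-- Finite (possibly empty) composable sequences of edges of a graph. -/
inductive HPath {O : Type u} (H : O → O → Type v) : O → O → Type (max u v)
  | nil {a : O} : HPath H a a
  | snoc {a b c : O} (p : HPath H a b) (e : H b c) : HPath H a c

namespace HPath

variable {O : Type u} {H : O → O → Type v}

/-- The sequence with one entry. -/
abbrev single {a b : O} (e : H a b) : HPath H a b := snoc nil e

/-- Concatenation. -/
def append {a b : O} (p : HPath H a b) : {c : O} → HPath H b c → HPath H a c
  | _, nil => p
  | _, snoc q e => snoc (append p q) e

theorem append_assoc {a b c d : O} (p : HPath H a b) (q : HPath H b c) (r : HPath H c d) :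
    (p.append q).append r = p.append (q.append r) := by
  induction r with
  | nil => rfl
  | snoc r e ih => simp only [append, ih]

theorem nil_append {a b : O} (p : HPath H a b) : (nil : HPath H a a).append p = p := by
  induction p with
  | nil => rfl
  | snoc p e ih => simp only [append, ih]

variable {O' : Type u} {H' : O' → O' → Type v}

/-- The image of a sequence under a morphism of graphs. -/
def map (f : O → O') (g : ∀ a b : O, H a b → H' (f a) (f b))
    {a : O} : {b : O} → HPath H a b → HPath H' (f a) (f b)
  | _, nil => nil
  | _, snoc p e => snoc (map f g p) (g _ _ e)

theorem map_append (f : O → O') (g : ∀ a b : O, H a b → H' (f a) (f b)) {a b c : O}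
    (p : HPath H a b) (q : HPath H b c) :
    (p.append q).map f g = (p.map f g).append (q.map f g) := by
  induction q with
  | nil => rfl
  | snoc q e ih => simp only [append, map, ih]

theorem map_id {a b : O} (p : HPath H a b) : p.map (fun x => x) (fun _ _ e => e) = p := by
  induction p with
  | nil => rfl
  | snoc p e ih => simp only [map, ih]

theorem map_map {O'' : Type u} {H'' : O'' → O'' → Type v}
    (f : O → O') (g : ∀ a b : O, H a b → H' (f a) (f b))
    (f' : O' → O'') (g' : ∀ a b : O', H' a b → H'' (f' a) (f' b)) {a b : O} (p : HPath H a b) :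
    (p.map f g).map f' g' = p.map (fun x => f' (f x)) (fun _ _ e => g' _ _ (g _ _ e)) := by
  induction p with
  | nil => rfl
  | snoc p e ih => simp only [map, ih]

end HPath

/-- The data underlying a virtual double category: a vertical category, horizontal morphisms, and
multicells, a multicell having as boundary a sequence of horizontal morphisms (top), two vertical
morphisms (sides) and a horizontal morphism (bottom). -/
structure VDGraph : Type (w + 1) where
  Obj : Type w
  [cat : Category.{w} Obj]
  HHom : Obj → Obj → Type w
  Cell : ∀ {A B C D : Obj}, HPath HHom A B → (A ⟶ C) → (B ⟶ D) → HHom C D → Type w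

attribute [instance] VDGraph.cat

namespace VDGraph

variable (G : VDGraph.{w})

/-- `G.Row Γ u u' Δ` : horizontally composable sequences `(θ₁, …, θₘ)` of multicells whose bottom
boundaries form the sequence `Δ`, whose top boundaries concatenate to `Γ`, and whose outer sides are
`u` and `u'`. For `m = 0` it is a single vertical morphism `u`. -/
inductive Row : ∀ {A B C D : G.Obj}, HPath G.HHom A B → (A ⟶ C) → (B ⟶ D) →
    HPath G.HHom C D → Type w
  | nil {A C : G.Obj} (u : A ⟶ C) : Row HPath.nil u u HPath.nil
  | snoc {A B B' C D D' : G.Obj} {Γ : HPath G.HHom A B} {Γ' : HPath G.HHom B B'}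
      {Γ'' : HPath G.HHom A B'} {u : A ⟶ C} {u' : B ⟶ D} {u'' : B' ⟶ D'}
      {Δ : HPath G.HHom C D} {δ : G.HHom D D'}
      (Θ : Row Γ u u' Δ) (θ : G.Cell Γ' u' u'' δ) (h : Γ.append Γ' = Γ'') :
      Row Γ'' u u'' (Δ.snoc δ)

variable {G}

/-- The row consisting of one multicell. -/
def Row.single {A B C D : G.Obj} {Γ : HPath G.HHom A B} {u : A ⟶ C} {u' : B ⟶ D}
    {δ : G.HHom C D} (θ : G.Cell Γ u u' δ) : G.Row Γ u u' (HPath.single δ) :=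
  .snoc (.nil u) θ Γ.nil_append

/-- Horizontal juxtaposition of rows. -/
def Row.append {A B C D : G.Obj} {Γ : HPath G.HHom A B} {u : A ⟶ C} {u' : B ⟶ D}
    {Δ : HPath G.HHom C D} (Θ : G.Row Γ u u' Δ) :
    {B' D' : G.Obj} → {Γ' : HPath G.HHom B B'} → {u'' : B' ⟶ D'} → {Δ' : HPath G.HHom D D'} →
    G.Row Γ' u' u'' Δ' → G.Row (Γ.append Γ') u u'' (Δ.append Δ')
  | _, _, _, _, _, .nil _ => Θ
  | _, _, _, _, _, .snoc Ξ θ h => .snoc (Row.append Θ Ξ) θ (by rw [← h, HPath.append_assoc])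

theorem Row.snoc_heq {A B B' C D D' : G.Obj} {Γ₁ Γ₂ : HPath G.HHom A B}
    {Γ₁' Γ₂' : HPath G.HHom B B'} {Γ₁'' Γ₂'' : HPath G.HHom A B'}
    {u : A ⟶ C} {u' : B ⟶ D} {u'' : B' ⟶ D'} {Δ₁ Δ₂ : HPath G.HHom C D} {δ : G.HHom D D'}
    {Θ₁ : G.Row Γ₁ u u' Δ₁} {Θ₂ : G.Row Γ₂ u u' Δ₂}
    {θ₁ : G.Cell Γ₁' u' u'' δ} {θ₂ : G.Cell Γ₂' u' u'' δ}
    (h₁ : Γ₁.append Γ₁' = Γ₁'') (h₂ : Γ₂.append Γ₂' = Γ₂'')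
    (hΓ : Γ₁ = Γ₂) (hΓ' : Γ₁' = Γ₂') (hΔ : Δ₁ = Δ₂) (hΘ : HEq Θ₁ Θ₂) (hθ : HEq θ₁ θ₂) :
    HEq (Row.snoc Θ₁ θ₁ h₁) (Row.snoc Θ₂ θ₂ h₂) := by
  subst hΓ hΓ' hΔ h₁ h₂
  cases hΘ
  cases hθ
  rfl

/-- Transport of a multicell along an equality of top boundaries. -/
def castTop {A B C D : G.Obj} {Γ Γ' : HPath G.HHom A B} {u : A ⟶ C} {u' : B ⟶ D}
    {δ : G.HHom C D} (h : Γ = Γ') (θ : G.Cell Γ u u' δ) : G.Cell Γ' u u' δ := h ▸ θ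

theorem castTop_heq {A B C D : G.Obj} {Γ Γ' : HPath G.HHom A B} {u : A ⟶ C} {u' : B ⟶ D}
    {δ : G.HHom C D} (h : Γ = Γ') (θ : G.Cell Γ u u' δ) : HEq (castTop h θ) θ := by
  subst h
  rfl

/-- Transport of a multicell along equalities of sides. -/
def castSides {A B C D : G.Obj} {Γ : HPath G.HHom A B} {u v : A ⟶ C} {u' v' : B ⟶ D}
    {δ : G.HHom C D} (h : u = v) (h' : u' = v') (θ : G.Cell Γ u u' δ) : G.Cell Γ v v' δ :=
  h ▸ h' ▸ θ

theorem castSides_heq {A B C D : G.Obj} {Γ : HPath G.HHom A B} {u v : A ⟶ C} {u' v' : B ⟶ D}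
    {δ : G.HHom C D} (h : u = v) (h' : u' = v') (θ : G.Cell Γ u u' δ) :
    HEq (castSides h h' θ) θ := by
  subst h h'
  rfl

variable (G)

/-- Two-storey arrangements: a row of multicells `θᵢ` (with top `Δ`, bottom `Λ`), and for each `i` a
row `Ξᵢ` on top of `θᵢ`; the `Ξᵢ` together have top `Γ`. -/
inductive Tower : ∀ {A B C D E F : G.Obj}, HPath G.HHom A B → (A ⟶ C) → (B ⟶ D) →
    HPath G.HHom C D → (C ⟶ E) → (D ⟶ F) → HPath G.HHom E F → Type w
  | nil {A C E : G.Obj} (a : A ⟶ C) (b : C ⟶ E) : Tower HPath.nil a a HPath.nil b b HPath.nil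
  | snoc {A B B' C D D' E F F' : G.Obj} {Γ : HPath G.HHom A B} {Γ₁ : HPath G.HHom B B'}
      {Γ' : HPath G.HHom A B'} {a : A ⟶ C} {a' : B ⟶ D} {a'' : B' ⟶ D'}
      {Δ : HPath G.HHom C D} {Δ₁ : HPath G.HHom D D'} {Δ' : HPath G.HHom C D'}
      {b : C ⟶ E} {b' : D ⟶ F} {b'' : D' ⟶ F'} {Λ : HPath G.HHom E F} {l : G.HHom F F'}
      (T : Tower Γ a a' Δ b b' Λ) (Ξ : G.Row Γ₁ a' a'' Δ₁) (θ : G.Cell Δ₁ b' b'' l)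
      (hΓ : Γ.append Γ₁ = Γ') (hΔ : Δ.append Δ₁ = Δ') :
      Tower Γ' a a'' Δ' b b'' (Λ.snoc l)

variable {G}

/-- The upper storey: all the `Ξᵢ` juxtaposed. -/
def Tower.upper {A B C D E F : G.Obj} {Γ : HPath G.HHom A B} {a : A ⟶ C} {a' : B ⟶ D}
    {Δ : HPath G.HHom C D} {b : C ⟶ E} {b' : D ⟶ F} {Λ : HPath G.HHom E F} :
    G.Tower Γ a a' Δ b b' Λ → G.Row Γ a a' Δ
  | .nil a _ => .nil a
  | .snoc T Ξ _ rfl rfl => T.upper.append Ξ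

/-- The lower storey: the row of the `θᵢ`. -/
def Tower.lower {A B C D E F : G.Obj} {Γ : HPath G.HHom A B} {a : A ⟶ C} {a' : B ⟶ D}
    {Δ : HPath G.HHom C D} {b : C ⟶ E} {b' : D ⟶ F} {Λ : HPath G.HHom E F} :
    G.Tower Γ a a' Δ b b' Λ → G.Row Δ b b' Λ
  | .nil _ b => .nil b
  | .snoc T _ θ _ hΔ => .snoc T.lower θ hΔ

theorem Tower.upper_snoc_heq {A B B' C D D' E F F' : G.Obj} {Γ : HPath G.HHom A B}
    {Γ₁ : HPath G.HHom B B'} {Γ' : HPath G.HHom A B'} {a : A ⟶ C} {a' : B ⟶ D} {a'' : B' ⟶ D'}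
    {Δ : HPath G.HHom C D} {Δ₁ : HPath G.HHom D D'} {Δ' : HPath G.HHom C D'}
    {b : C ⟶ E} {b' : D ⟶ F} {b'' : D' ⟶ F'} {Λ : HPath G.HHom E F} {l : G.HHom F F'}
    (T : G.Tower Γ a a' Δ b b' Λ) (Ξ : G.Row Γ₁ a' a'' Δ₁) (θ : G.Cell Δ₁ b' b'' l)
    (hΓ : Γ.append Γ₁ = Γ') (hΔ : Δ.append Δ₁ = Δ') :
    HEq (Tower.snoc T Ξ θ hΓ hΔ).upper (T.upper.append Ξ) := by
  subst hΓ hΔ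
  rfl

theorem Row.nil_append_heq {A B C D : G.Obj} {Γ : HPath G.HHom A B} {u : A ⟶ C} {u' : B ⟶ D}
    {Δ : HPath G.HHom C D} (Θ : G.Row Γ u u' Δ) : HEq ((Row.nil u).append Θ) Θ := by
  induction Θ with
  | nil => rfl
  | snoc Θ θ h ih =>
    exact Row.snoc_heq _ _ (HPath.nil_append _) rfl (HPath.nil_append _) ih HEq.rfl

end VDGraph

/-- The identity cells and the composition of multicells, before the axioms. The composite
`κ ∘ (θ₁, …, θₘ)` has sides `u ≫ v` and `u' ≫ v'`; `comp` takes names `w`, `w'` for these, with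
proofs, so that the axioms compare multicells with syntactically equal boundaries. -/
structure VDOps : Type (w + 1) extends VDGraph.{w} where
  idc : ∀ {A B : Obj} (Γ : HHom A B), Cell (HPath.single Γ) (𝟙 A) (𝟙 B) Γ
  comp : ∀ {A B C D E F : Obj} {Γ : HPath HHom A B} {u : A ⟶ C} {u' : B ⟶ D}
    {Δ : HPath HHom C D} {v : C ⟶ E} {v' : D ⟶ F} {Λ : HHom E F}
    (_κ : Cell Δ v v' Λ) (_Θ : toVDGraph.Row Γ u u' Δ) {w : A ⟶ E} {w' : B ⟶ F}
    (_hw : u ≫ v = w) (_hw' : u' ≫ v' = w'), Cell Γ w w' Λ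

namespace VDOps

variable (G : VDOps.{w})

theorem castSides_comp {A B C D E F : G.Obj} {Γ : HPath G.HHom A B} {u : A ⟶ C} {u' : B ⟶ D}
    {Δ : HPath G.HHom C D} {v : C ⟶ E} {v' : D ⟶ F} {Λ : G.HHom E F}
    (κ : G.Cell Δ v v' Λ) (Θ : G.Row Γ u u' Δ) {w x : A ⟶ E} {w' x' : B ⟶ F}
    (hw : u ≫ v = w) (hw' : u' ≫ v' = w') (h : w = x) (h' : w' = x') :
    G.castSides h h' (G.comp κ Θ hw hw') = G.comp κ Θ (hw.trans h) (hw'.trans h') := by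
  subst h h'
  rfl

theorem comp_castSides {A B C D E F : G.Obj} {Γ : HPath G.HHom A B} {u : A ⟶ C} {u' : B ⟶ D}
    {Δ : HPath G.HHom C D} {v x : C ⟶ E} {v' x' : D ⟶ F} {Λ : G.HHom E F}
    (κ : G.Cell Δ v v' Λ) (Θ : G.Row Γ u u' Δ) {w : A ⟶ E} {w' : B ⟶ F}
    (h : v = x) (h' : v' = x') (hw : u ≫ x = w) (hw' : u' ≫ x' = w') :
    G.comp (G.castSides h h' κ) Θ hw hw' = G.comp κ Θ (h ▸ hw) (h' ▸ hw') := by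
  subst h h'
  rfl

theorem comp_heq {A B C D E F : G.Obj} {Γ₁ Γ₂ : HPath G.HHom A B} {u : A ⟶ C} {u' : B ⟶ D}
    {Δ₁ Δ₂ : HPath G.HHom C D} {v : C ⟶ E} {v' : D ⟶ F} {Λ : G.HHom E F}
    {κ₁ : G.Cell Δ₁ v v' Λ} {κ₂ : G.Cell Δ₂ v v' Λ} {Θ₁ : G.Row Γ₁ u u' Δ₁}
    {Θ₂ : G.Row Γ₂ u u' Δ₂} {w : A ⟶ E} {w' : B ⟶ F}
    (hw : u ≫ v = w) (hw' : u' ≫ v' = w')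
    (hΓ : Γ₁ = Γ₂) (hΔ : Δ₁ = Δ₂) (hκ : HEq κ₁ κ₂) (hΘ : HEq Θ₁ Θ₂) :
    HEq (G.comp κ₁ Θ₁ hw hw') (G.comp κ₂ Θ₂ hw hw') := by
  subst hΓ hΔ
  cases hκ
  cases hΘ
  rfl

/-- The row of identity cells on a sequence of horizontal morphisms. -/
def idRow {A : G.Obj} : {B : G.Obj} → (Δ : HPath G.HHom A B) → G.Row Δ (𝟙 A) (𝟙 B) Δ
  | _, .nil => .nil _
  | _, .snoc Δ δ => .snoc (idRow Δ) (G.idc δ) rfl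

/-- The row of the composites `θᵢ ∘ Ξᵢ` of a two-storey arrangement. -/
def compRow {A B C D E F : G.Obj} {Γ : HPath G.HHom A B} {a : A ⟶ C} {a' : B ⟶ D}
    {Δ : HPath G.HHom C D} {b : C ⟶ E} {b' : D ⟶ F} {Λ : HPath G.HHom E F} :
    G.Tower Γ a a' Δ b b' Λ → G.Row Γ (a ≫ b) (a' ≫ b') Λ
  | .nil a b => .nil (a ≫ b)
  | .snoc T Ξ θ hΓ _ => .snoc (compRow T) (G.comp θ Ξ rfl rfl) hΓ

end VDOps

/-- Virtual double categories. All of objects, vertical morphisms, horizontal morphisms and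
multicells form sets in the universe `w`. -/
structure VDC : Type (w + 1) extends VDOps.{w} where
  id_comp : ∀ {A B C D : Obj} {Γ : HPath HHom A B} {u : A ⟶ C} {u' : B ⟶ D} {δ : HHom C D}
    (θ : Cell Γ u u' δ),
    comp (idc δ) (.single θ) (Category.comp_id u) (Category.comp_id u') = θ
  comp_id : ∀ {A B C D : Obj} {Δ : HPath HHom A B} {v : A ⟶ C} {v' : B ⟶ D} {Λ : HHom C D}
    (κ : Cell Δ v v' Λ),
    comp κ (toVDOps.idRow Δ) (Category.id_comp v) (Category.id_comp v') = κ
  assoc : ∀ {A B C D E F X Y : Obj} {Γ : HPath HHom A B} {a : A ⟶ C} {a' : B ⟶ D}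
    {Δ : HPath HHom C D} {b : C ⟶ E} {b' : D ⟶ F} {Λ : HPath HHom E F}
    {c : E ⟶ X} {c' : F ⟶ Y} {l : HHom X Y}
    (κ : Cell Λ c c' l) (T : toVDGraph.Tower Γ a a' Δ b b' Λ),
    comp (comp κ T.lower rfl rfl) T.upper rfl rfl =
      comp κ (toVDOps.compRow T) (Category.assoc a b c) (Category.assoc a' b' c')

namespace VDC

variable (G : VDC.{w})

theorem id_comp_of_eq {A B C D : G.Obj} {Γ : HPath G.HHom A B} {u : A ⟶ C} {u' : B ⟶ D}
    {δ : G.HHom C D} (θ : G.Cell Γ u u' δ) {w : A ⟶ C} {w' : B ⟶ D}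
    (hw : u ≫ 𝟙 C = w) (hw' : u' ≫ 𝟙 D = w') :
    G.comp (G.idc δ) (.single θ) hw hw' =
      G.castSides ((Category.comp_id u).symm.trans hw) ((Category.comp_id u').symm.trans hw') θ := by
  conv_rhs => rw [← G.id_comp θ, VDOps.castSides_comp]

theorem comp_id_of_eq {A B C D : G.Obj} {Δ : HPath G.HHom A B} {v : A ⟶ C} {v' : B ⟶ D}
    {l : G.HHom C D} (κ : G.Cell Δ v v' l) {w : A ⟶ C} {w' : B ⟶ D}
    (hw : 𝟙 A ≫ v = w) (hw' : 𝟙 B ≫ v' = w') :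
    G.comp κ (G.idRow Δ) hw hw' =
      G.castSides ((Category.id_comp v).symm.trans hw) ((Category.id_comp v').symm.trans hw') κ := by
  conv_rhs => rw [← G.comp_id κ, VDOps.castSides_comp]

theorem assoc_of_eq {A B C D E F X Y : G.Obj} {Γ : HPath G.HHom A B} {a : A ⟶ C} {a' : B ⟶ D}
    {Δ : HPath G.HHom C D} {b : C ⟶ E} {b' : D ⟶ F} {Λ : HPath G.HHom E F}
    {c : E ⟶ X} {c' : F ⟶ Y} {l : G.HHom X Y}
    (κ : G.Cell Λ c c' l) (T : G.Tower Γ a a' Δ b b' Λ) {x : C ⟶ X} {x' : D ⟶ Y}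
    {y : A ⟶ X} {y' : B ⟶ Y} (hx : b ≫ c = x) (hx' : b' ≫ c' = x')
    (hy : a ≫ x = y) (hy' : a' ≫ x' = y') :
    G.comp (G.comp κ T.lower hx hx') T.upper hy hy' =
      G.comp κ (G.compRow T) (by rw [← hy, ← hx, Category.assoc])
        (by rw [← hy', ← hx', Category.assoc]) := by
  subst hx hx' hy hy'
  exact G.assoc κ T

theorem assoc_single {A B C D E F X Y : G.Obj} {Γ : HPath G.HHom A B} {a : A ⟶ C} {a' : B ⟶ D}
    {Δ : HPath G.HHom C D} {b : C ⟶ E} {b' : D ⟶ F} {e : G.HHom E F}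
    {c : E ⟶ X} {c' : F ⟶ Y} {l : G.HHom X Y}
    (κ : G.Cell (HPath.single e) c c' l) (θ : G.Cell Δ b b' e) (Ξ : G.Row Γ a a' Δ)
    {x : C ⟶ X} {x' : D ⟶ Y} {y : A ⟶ X} {y' : B ⟶ Y} (hx : b ≫ c = x) (hx' : b' ≫ c' = x')
    (hy : a ≫ x = y) (hy' : a' ≫ x' = y') {z : A ⟶ E} {z' : B ⟶ F} (hz : a ≫ b = z)
    (hz' : a' ≫ b' = z') :
    G.comp (G.comp κ (.single θ) hx hx') Ξ hy hy' =
      G.comp κ (.single (G.comp θ Ξ hz hz')) (by rw [← hy, ← hx, ← hz, Category.assoc])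
        (by rw [← hy', ← hx', ← hz', Category.assoc]) := by
  subst hz hz'
  have h := G.assoc_of_eq κ (.snoc (.nil a b) Ξ θ Γ.nil_append Δ.nil_append) hx hx' hy hy'
  refine Eq.trans ?_ h
  refine eq_of_heq (G.comp_heq _ _ rfl rfl HEq.rfl ?_)
  exact ((VDGraph.Tower.upper_snoc_heq (.nil a b) Ξ θ _ _).trans
    (VDGraph.Row.nil_append_heq Ξ)).symm

end VDC

/-- Maps of the data underlying virtual double categories. -/
structure VDMap (A B : VDGraph.{w}) : Type w where
  vert : A.Obj ⥤ B.Obj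
  mapH : ∀ {X Y : A.Obj}, A.HHom X Y → B.HHom (vert.obj X) (vert.obj Y)
  mapCell : ∀ {X Y Z W : A.Obj} {Γ : HPath A.HHom X Y} {u : X ⟶ Z} {u' : Y ⟶ W}
    {Δ : A.HHom Z W}, A.Cell Γ u u' Δ →
      B.Cell (Γ.map vert.obj (fun _ _ => mapH)) (vert.map u) (vert.map u') (mapH Δ)

namespace VDMap

variable {A B C : VDGraph.{w}}

/-- The action on sequences of horizontal morphisms. -/
abbrev mapPath (F : VDMap A B) {X Y : A.Obj} (Γ : HPath A.HHom X Y) :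
    HPath B.HHom (F.vert.obj X) (F.vert.obj Y) := Γ.map F.vert.obj (fun _ _ => F.mapH)

theorem mapPath_append (F : VDMap A B) {X Y Z : A.Obj} (Γ : HPath A.HHom X Y)
    (Δ : HPath A.HHom Y Z) : F.mapPath (Γ.append Δ) = (F.mapPath Γ).append (F.mapPath Δ) :=
  HPath.map_append ..

/-- The action on rows of multicells. -/
def mapRow (F : VDMap A B) {X Y Z W : A.Obj} {Γ : HPath A.HHom X Y} {u : X ⟶ Z} {u' : Y ⟶ W}
    {Δ : HPath A.HHom Z W} :
    A.Row Γ u u' Δ → B.Row (F.mapPath Γ) (F.vert.map u) (F.vert.map u') (F.mapPath Δ)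
  | .nil u => .nil (F.vert.map u)
  | .snoc Θ θ h => .snoc (mapRow F Θ) (F.mapCell θ)
      ((F.mapPath_append _ _).symm.trans (congrArg F.mapPath h))

/-- The identity map. -/
def id (A : VDGraph.{w}) : VDMap A A where
  vert := 𝟭 A.Obj
  mapH Γ := Γ
  mapCell θ := A.castTop (HPath.map_id _).symm θ

/-- Composition of maps. -/
def comp (F : VDMap A B) (G : VDMap B C) : VDMap A C where
  vert := F.vert ⋙ G.vert
  mapH Γ := G.mapH (F.mapH Γ)
  mapCell θ := C.castTop (HPath.map_map ..) (G.mapCell (F.mapCell θ))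

theorem id_mapPath {X Y : A.Obj} (Γ : HPath A.HHom X Y) : (id A).mapPath Γ = Γ :=
  HPath.map_id Γ

theorem comp_mapPath (F : VDMap A B) (G : VDMap B C) {X Y : A.Obj} (Γ : HPath A.HHom X Y) :
    (F.comp G).mapPath Γ = G.mapPath (F.mapPath Γ) :=
  (HPath.map_map F.vert.obj (fun _ _ => F.mapH) G.vert.obj (fun _ _ => G.mapH) Γ).symm

theorem id_mapCell_heq {X Y Z W : A.Obj} {Γ : HPath A.HHom X Y} {u : X ⟶ Z} {u' : Y ⟶ W}
    {Δ : A.HHom Z W} (θ : A.Cell Γ u u' Δ) : HEq ((id A).mapCell θ) θ :=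
  VDGraph.castTop_heq _ _

theorem comp_mapCell_heq (F : VDMap A B) (G : VDMap B C) {X Y Z W : A.Obj}
    {Γ : HPath A.HHom X Y} {u : X ⟶ Z} {u' : Y ⟶ W} {Δ : A.HHom Z W} (θ : A.Cell Γ u u' Δ) :
    HEq ((F.comp G).mapCell θ) (G.mapCell (F.mapCell θ)) :=
  VDGraph.castTop_heq _ _

theorem id_mapRow_heq {X Y Z W : A.Obj} {Γ : HPath A.HHom X Y} {u : X ⟶ Z} {u' : Y ⟶ W}
    {Δ : HPath A.HHom Z W} (Θ : A.Row Γ u u' Δ) : HEq ((id A).mapRow Θ) Θ := by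
  induction Θ with
  | nil u => rfl
  | snoc Θ θ h ih =>
    exact VDGraph.Row.snoc_heq _ _ (id_mapPath _) (id_mapPath _) (id_mapPath _) ih
      (VDGraph.castTop_heq _ _)

theorem mapCell_heq (F : VDMap A B) {X Y Z W : A.Obj} {Γ Γ' : HPath A.HHom X Y} {u : X ⟶ Z}
    {u' : Y ⟶ W} {Δ : A.HHom Z W} {θ : A.Cell Γ u u' Δ} {θ' : A.Cell Γ' u u' Δ}
    (hΓ : Γ = Γ') (h : HEq θ θ') : HEq (F.mapCell θ) (F.mapCell θ') := by
  subst hΓ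
  cases h
  rfl

theorem mapCell_heq_sides (F : VDMap A B) {X Y Z W : A.Obj} {Γ : HPath A.HHom X Y} {u v : X ⟶ Z}
    {u' v' : Y ⟶ W} {Δ : A.HHom Z W} {θ : A.Cell Γ u u' Δ} {θ' : A.Cell Γ v v' Δ}
    (hu : u = v) (hu' : u' = v') (h : HEq θ θ') : HEq (F.mapCell θ) (F.mapCell θ') := by
  subst hu hu'
  cases h
  rfl

theorem comp_mapRow_heq (F : VDMap A B) (G : VDMap B C) {X Y Z W : A.Obj}
    {Γ : HPath A.HHom X Y} {u : X ⟶ Z} {u' : Y ⟶ W}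
    {Δ : HPath A.HHom Z W} (Θ : A.Row Γ u u' Δ) :
    HEq ((F.comp G).mapRow Θ) (G.mapRow (F.mapRow Θ)) := by
  induction Θ with
  | nil u => rfl
  | snoc Θ θ h ih =>
    exact VDGraph.Row.snoc_heq _ _ (comp_mapPath F G _) (comp_mapPath F G _)
      (comp_mapPath F G _) ih (VDGraph.castTop_heq _ _)

end VDMap

/-- Virtual double functors. -/
structure VDFunctor (A B : VDC.{w}) : Type w extends VDMap A.toVDGraph B.toVDGraph where
  map_idc : ∀ {X Y : A.Obj} (Γ : A.HHom X Y),
    B.castSides (vert.map_id X) (vert.map_id Y) (mapCell (A.idc Γ)) = B.idc (mapH Γ)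
  map_comp : ∀ {X Y Z W U V : A.Obj} {Γ : HPath A.HHom X Y} {u : X ⟶ Z} {u' : Y ⟶ W}
    {Δ : HPath A.HHom Z W} {v : Z ⟶ U} {v' : W ⟶ V} {Λ : A.HHom U V}
    (κ : A.Cell Δ v v' Λ) (Θ : A.Row Γ u u' Δ),
    mapCell (A.comp κ Θ rfl rfl) =
      B.comp (mapCell κ) (toVDMap.mapRow Θ) (vert.map_comp u v).symm (vert.map_comp u' v').symm

namespace VDFunctor

variable {A B C D : VDC.{w}}

theorem map_comp_of_eq (F : VDFunctor A B) {X Y Z W U V : A.Obj} {Γ : HPath A.HHom X Y}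
    {u : X ⟶ Z} {u' : Y ⟶ W} {Δ : HPath A.HHom Z W} {v : Z ⟶ U} {v' : W ⟶ V} {Λ : A.HHom U V}
    (κ : A.Cell Δ v v' Λ) (Θ : A.Row Γ u u' Δ) {w : X ⟶ U} {w' : Y ⟶ V}
    (hw : u ≫ v = w) (hw' : u' ≫ v' = w') :
    F.mapCell (A.comp κ Θ hw hw') = B.comp (F.mapCell κ) (F.mapRow Θ)
      (by rw [← hw, F.vert.map_comp]) (by rw [← hw', F.vert.map_comp]) := by
  subst hw hw'
  exact F.map_comp κ Θ

/-- Two virtual double functors that agree on objects, vertical and horizontal morphisms by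
definition are equal as soon as they agree on multicells. -/
theorem ext_cell {F : VDMap A.toVDGraph B.toVDGraph} {m : ∀ {X Y Z W : A.Obj}
    {Γ : HPath A.HHom X Y} {u : X ⟶ Z} {u' : Y ⟶ W} {Δ : A.HHom Z W}, A.Cell Γ u u' Δ →
      B.Cell (F.mapPath Γ) (F.vert.map u) (F.vert.map u') (F.mapH Δ)} {h₁ h₂ h₃ h₄}
    (h : ∀ {X Y Z W : A.Obj} {Γ : HPath A.HHom X Y} {u : X ⟶ Z} {u' : Y ⟶ W} {Δ : A.HHom Z W}
      (θ : A.Cell Γ u u' Δ), F.mapCell θ = m θ) :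
    (⟨F, h₁, h₂⟩ : VDFunctor A B) = ⟨⟨F.vert, F.mapH, m⟩, h₃, h₄⟩ := by
  have : @F.mapCell = @m := by
    funext X Y Z W Γ u u' Δ θ
    exact h θ
  subst this
  rfl

/-- The identity virtual double functor. -/
def id (A : VDC.{w}) : VDFunctor A A where
  toVDMap := VDMap.id A.toVDGraph
  map_idc _ := rfl
  map_comp _ Θ := eq_of_heq <| (VDGraph.castTop_heq _ _).trans <|
    A.comp_heq _ _ (VDMap.id_mapPath _).symm (VDMap.id_mapPath _).symm
      (VDGraph.castTop_heq _ _).symm (VDMap.id_mapRow_heq Θ).symm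

/-- Composition of virtual double functors. -/
def comp (F : VDFunctor A B) (G : VDFunctor B C) : VDFunctor A C where
  toVDMap := F.toVDMap.comp G.toVDMap
  map_idc {X Y} Γ := by
    apply eq_of_heq
    refine (VDGraph.castSides_heq _ _ _).trans ((VDMap.comp_mapCell_heq _ _ _).trans ?_)
    change HEq _ (C.idc (G.mapH (F.mapH Γ)))
    rw [← G.map_idc, ← F.map_idc]
    refine HEq.trans ?_ (VDGraph.castSides_heq _ _ _).symm
    exact G.mapCell_heq_sides (F.vert.map_id X) (F.vert.map_id Y)
      (VDGraph.castSides_heq _ _ _).symm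
  map_comp _ Θ := eq_of_heq <| (VDGraph.castTop_heq _ _).trans <| by
    rw [F.map_comp, G.map_comp_of_eq]
    exact C.comp_heq _ _ (VDMap.comp_mapPath ..).symm (VDMap.comp_mapPath ..).symm
      (VDGraph.castTop_heq _ _).symm (VDMap.comp_mapRow_heq _ _ Θ).symm

theorem id_comp (F : VDFunctor A B) : (id A).comp F = F :=
  ext_cell fun _ => eq_of_heq <| (VDGraph.castTop_heq _ _).trans <|
    F.mapCell_heq (VDMap.id_mapPath _) (VDGraph.castTop_heq _ _)

theorem comp_id (F : VDFunctor A B) : F.comp (id B) = F :=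
  ext_cell fun _ => eq_of_heq <| (VDGraph.castTop_heq _ _).trans (VDGraph.castTop_heq _ _)

theorem comp_assoc (F : VDFunctor A B) (G : VDFunctor B C) (H : VDFunctor C D) :
    (F.comp G).comp H = F.comp (G.comp H) :=
  ext_cell fun _ => eq_of_heq <| (VDGraph.castTop_heq _ _).trans <|
    (H.mapCell_heq (VDMap.comp_mapPath ..) (VDGraph.castTop_heq _ _)).trans <|
    (VDGraph.castTop_heq _ _).symm.trans (VDGraph.castTop_heq _ _).symm

end VDFunctor

/-- The row of cells of a (not yet natural) transformation on a sequence of horizontal morphisms. -/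
def VDMap.transRow {A B : VDGraph.{w}} {F G : VDMap A B} (α : F.vert ⟶ G.vert)
    (c : ∀ X Y : A.Obj, ∀ Γ : A.HHom X Y,
      B.Cell (HPath.single (F.mapH Γ)) (α.app X) (α.app Y) (G.mapH Γ)) {X : A.Obj} :
    {Y : A.Obj} → (Γ : HPath A.HHom X Y) →
      B.Row (F.mapPath Γ) (α.app X) (α.app Y) (G.mapPath Γ)
  | _, .nil => .nil _
  | _, .snoc Γ e => .snoc (transRow α c Γ) (c _ _ e) rfl

/-- Vertical transformations. -/
structure VertTrans {A B : VDC.{w}} (F G : VDFunctor A B) : Type w where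
  vert : F.vert ⟶ G.vert
  cell : ∀ {X Y : A.Obj} (Γ : A.HHom X Y),
    B.Cell (HPath.single (F.mapH Γ)) (vert.app X) (vert.app Y) (G.mapH Γ)
  naturality : ∀ {X Y Z W : A.Obj} {Γ : HPath A.HHom X Y} {u : X ⟶ Z} {u' : Y ⟶ W}
    {Δ : A.HHom Z W} (θ : A.Cell Γ u u' Δ),
    B.comp (cell Δ) (.single (F.mapCell θ)) rfl rfl =
      B.comp (G.mapCell θ) (VDMap.transRow vert (fun _ _ e => cell e) Γ)
        (vert.naturality u).symm (vert.naturality u').symm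

namespace VertTrans

variable {A B C : VDC.{w}} {F G H : VDFunctor A B}

theorem ext' {α β : VertTrans F G} (h : α.vert = β.vert)
    (h' : ∀ {X Y : A.Obj} (Γ : A.HHom X Y), B.castSides (congrArg (fun t => t.app X) h)
      (congrArg (fun t => t.app Y) h) (α.cell Γ) = β.cell Γ) : α = β := by
  obtain ⟨a, c, _⟩ := α
  obtain ⟨b, d, _⟩ := β
  obtain rfl : a = b := h
  obtain rfl : @c = @d := by
    funext X Y Γ
    exact h' Γ
  rfl

/-- The cells of a vertical transformation on a sequence of horizontal morphisms. -/
abbrev row (α : VertTrans F G) {X Y : A.Obj} (Γ : HPath A.HHom X Y) :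
    B.Row (F.mapPath Γ) (α.vert.app X) (α.vert.app Y) (G.mapPath Γ) :=
  VDMap.transRow α.vert (fun _ _ e => α.cell e) Γ

theorem naturality_of_eq (α : VertTrans F G) {X Y Z W : A.Obj} {Γ : HPath A.HHom X Y}
    {u : X ⟶ Z} {u' : Y ⟶ W} {Δ : A.HHom Z W} (θ : A.Cell Γ u u' Δ)
    {w : F.vert.obj X ⟶ G.vert.obj Z} {w' : F.vert.obj Y ⟶ G.vert.obj W}
    (hw : F.vert.map u ≫ α.vert.app Z = w) (hw' : F.vert.map u' ≫ α.vert.app W = w') :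
    B.comp (α.cell Δ) (.single (F.mapCell θ)) hw hw' =
      B.comp (G.mapCell θ) (α.row Γ)
        ((α.vert.naturality u).symm.trans hw) ((α.vert.naturality u').symm.trans hw') := by
  subst hw hw'
  exact α.naturality θ

/-- The identity vertical transformation. -/
def id (F : VDFunctor A B) : VertTrans F F where
  vert := 𝟙 F.vert
  cell Γ := B.idc (F.mapH Γ)
  naturality {X Y Z W Γ u u' Δ} θ := by
    have h : ∀ {X Y : A.Obj} (Γ : HPath A.HHom X Y),
        VDMap.transRow (𝟙 F.vert) (fun _ _ e => B.idc (F.mapH e)) Γ = B.idRow (F.mapPath Γ) := by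
      intro X Y Γ
      induction Γ with
      | nil => rfl
      | snoc Γ e ih => simp only [VDMap.transRow, ih]; rfl
    rw [h]
    exact (B.id_comp_of_eq (F.mapCell θ) _ _).trans (B.comp_id_of_eq (F.mapCell θ) _ _).symm

/-- The row of a transformation on top of that of another. -/
def tower (α : VertTrans F G) (β : VertTrans G H) {X : A.Obj} :
    {Y : A.Obj} → (Γ : HPath A.HHom X Y) →
      B.Tower (F.mapPath Γ) (α.vert.app X) (α.vert.app Y) (G.mapPath Γ)
        (β.vert.app X) (β.vert.app Y) (H.mapPath Γ)
  | _, .nil => .nil _ _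
  | _, .snoc Γ e => .snoc (tower α β Γ) (.single (α.cell e)) (β.cell e) rfl rfl

theorem tower_upper (α : VertTrans F G) (β : VertTrans G H) {X Y : A.Obj}
    (Γ : HPath A.HHom X Y) : (tower α β Γ).upper = α.row Γ := by
  induction Γ with
  | nil => rfl
  | snoc Γ e ih =>
    change VDGraph.Row.snoc (tower α β Γ).upper _ _ = _
    rw [ih]
    rfl

theorem tower_lower (α : VertTrans F G) (β : VertTrans G H) {X Y : A.Obj}
    (Γ : HPath A.HHom X Y) : (tower α β Γ).lower = β.row Γ := by
  induction Γ with
  | nil => rfl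
  | snoc Γ e ih =>
    change VDGraph.Row.snoc (tower α β Γ).lower _ _ = _
    rw [ih]
    rfl

theorem compRow_tower (α : VertTrans F G) (β : VertTrans G H) {X Y : A.Obj}
    (Γ : HPath A.HHom X Y) : B.compRow (tower α β Γ) =
      VDMap.transRow (F := F.toVDMap) (G := H.toVDMap) (α.vert ≫ β.vert)
        (fun _ _ e => B.comp (β.cell e) (.single (α.cell e)) rfl rfl) Γ := by
  induction Γ with
  | nil => rfl
  | snoc Γ e ih =>
    change VDGraph.Row.snoc (B.compRow (tower α β Γ)) _ _ = _
    rw [ih]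
    rfl

/-- Composition of vertical transformations. -/
def comp (α : VertTrans F G) (β : VertTrans G H) : VertTrans F H where
  vert := α.vert ≫ β.vert
  cell Γ := B.comp (β.cell Γ) (.single (α.cell Γ)) rfl rfl
  naturality {X Y Z W Γ u u' Δ} θ := by
    rw [← compRow_tower]
    refine (B.assoc_single (β.cell Δ) (α.cell Δ) (.single (F.mapCell θ))
      rfl rfl rfl rfl rfl rfl).trans ?_
    rw [α.naturality θ]
    refine (B.assoc_single (β.cell Δ) (G.mapCell θ) (α.row Γ) rfl rfl
      (by simp) (by simp) _ _).symm.trans ?_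
    rw [β.naturality θ]
    have h := B.assoc_of_eq (H.mapCell θ) (tower α β Γ) (β.vert.naturality u).symm
      (β.vert.naturality u').symm (y := F.vert.map u ≫ α.vert.app Z ≫ β.vert.app Z)
      (y' := F.vert.map u' ≫ α.vert.app W ≫ β.vert.app W) (by simp) (by simp)
    rw [tower_lower, tower_upper] at h
    exact h

theorem comp_cell (α : VertTrans F G) (β : VertTrans G H) {X Y : A.Obj} (Γ : A.HHom X Y) :
    (α.comp β).cell Γ = B.comp (β.cell Γ) (.single (α.cell Γ)) rfl rfl := rfl

instance category (A B : VDC.{w}) : Category (VDFunctor A B) where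
  Hom F G := VertTrans F G
  id F := id F
  comp α β := comp α β
  id_comp {F G} α := ext' (Category.id_comp α.vert) fun Γ => by
    refine (VDOps.castSides_comp _ _ _ _ _ _ _).trans ?_
    exact (B.comp_id_of_eq (Δ := HPath.single (F.mapH Γ)) (α.cell Γ) (Category.id_comp _)
      (Category.id_comp _))
  comp_id {F G} α := ext' (Category.comp_id α.vert) fun Γ => by
    refine (VDOps.castSides_comp _ _ _ _ _ _ _).trans ?_
    exact B.id_comp (α.cell Γ)
  assoc α β γ := ext' (Category.assoc α.vert β.vert γ.vert) fun Γ => by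
    refine (VDOps.castSides_comp _ _ _ _ _ _ _).trans ?_
    exact (B.assoc_single (γ.cell Γ) (β.cell Γ) (.single (α.cell Γ)) rfl rfl _ _ rfl rfl).symm

/-- `F ◁ α`. -/
def whiskerLeft (F : VDFunctor A B) {G H : VDFunctor B C} (α : VertTrans G H) :
    VertTrans (F.comp G) (F.comp H) where
  vert := Functor.whiskerLeft F.vert α.vert
  cell Γ := α.cell (F.mapH Γ)
  naturality {X Y Z W Γ u u' Δ} θ := by
    have hrow : ∀ {X Y : A.Obj} (Γ : HPath A.HHom X Y),
        HEq (VDMap.transRow (F := (F.comp G).toVDMap) (G := (F.comp H).toVDMap)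
          (Functor.whiskerLeft F.vert α.vert) (fun _ _ e => α.cell (F.mapH e)) Γ)
          (α.row (F.mapPath Γ)) := by
      intro X Y Γ
      induction Γ with
      | nil => rfl
      | snoc Γ e ih =>
        exact VDGraph.Row.snoc_heq _ _ (VDMap.comp_mapPath ..) rfl (VDMap.comp_mapPath ..) ih HEq.rfl
    refine eq_of_heq ((C.comp_heq _ _ (VDMap.comp_mapPath ..) rfl HEq.rfl ?_).trans
      ((heq_of_eq (α.naturality (F.mapCell θ))).trans
      (C.comp_heq _ _ (VDMap.comp_mapPath ..).symm (VDMap.comp_mapPath ..).symm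
        (VDMap.comp_mapCell_heq _ _ θ).symm (hrow Γ).symm)))
    exact VDGraph.Row.snoc_heq _ _ rfl (VDMap.comp_mapPath ..) rfl HEq.rfl
      (VDMap.comp_mapCell_heq _ _ θ)

/-- `α ▷ H`. -/
def whiskerRight {F G : VDFunctor A B} (α : VertTrans F G) (H : VDFunctor B C) :
    VertTrans (F.comp H) (G.comp H) where
  vert := Functor.whiskerRight α.vert H.vert
  cell Γ := H.mapCell (α.cell Γ)
  naturality {X Y Z W Γ u u' Δ} θ := by
    have hrow : ∀ {X Y : A.Obj} (Γ : HPath A.HHom X Y),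
        HEq (VDMap.transRow (F := (F.comp H).toVDMap) (G := (G.comp H).toVDMap)
          (Functor.whiskerRight α.vert H.vert) (fun _ _ e => H.mapCell (α.cell e)) Γ)
          (H.mapRow (α.row Γ)) := by
      intro X Y Γ
      induction Γ with
      | nil => rfl
      | snoc Γ e ih =>
        exact VDGraph.Row.snoc_heq _ _ (VDMap.comp_mapPath ..) rfl (VDMap.comp_mapPath ..) ih HEq.rfl
    have h := congrArg H.mapCell (α.naturality θ)
    rw [H.map_comp, H.map_comp_of_eq] at h
    have h' := congrArg (C.castSides (H.vert.map_comp (F.vert.map u) (α.vert.app Z))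
      (H.vert.map_comp (F.vert.map u') (α.vert.app W))) h
    rw [VDOps.castSides_comp, VDOps.castSides_comp] at h'
    refine eq_of_heq ((C.comp_heq _ _ (VDMap.comp_mapPath ..) rfl HEq.rfl ?_).trans
      ((heq_of_eq h').trans
      (C.comp_heq _ _ (VDMap.comp_mapPath ..).symm (VDMap.comp_mapPath ..).symm
        (VDMap.comp_mapCell_heq _ _ θ).symm (hrow Γ).symm)))
    exact VDGraph.Row.snoc_heq _ _ rfl (VDMap.comp_mapPath ..) rfl HEq.rfl
      (VDMap.comp_mapCell_heq _ _ θ)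

end VertTrans

namespace VertTrans

variable {A B C D : VDC.{w}}

theorem ext_heq {F G : VDFunctor A B} {α β : VertTrans F G}
    (h : ∀ X, α.vert.app X = β.vert.app X)
    (h' : ∀ {X Y : A.Obj} (Γ : A.HHom X Y), HEq (α.cell Γ) (β.cell Γ)) : α = β :=
  ext' (NatTrans.ext (funext h)) fun Γ =>
    eq_of_heq ((VDGraph.castSides_heq _ _ _).trans (h' Γ))

/-- The vertical transformation with identity components between two equal virtual double functors
that agree on objects, vertical and horizontal morphisms by definition. -/
def ofEq {F : VDMap A.toVDGraph B.toVDGraph} {m : ∀ {X Y Z W : A.Obj}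
    {Γ : HPath A.HHom X Y} {u : X ⟶ Z} {u' : Y ⟶ W} {Δ : A.HHom Z W}, A.Cell Γ u u' Δ →
      B.Cell (F.mapPath Γ) (F.vert.map u) (F.vert.map u') (F.mapH Δ)} {h₁ h₂ h₃ h₄}
    (h : (⟨F, h₁, h₂⟩ : VDFunctor A B) = ⟨⟨F.vert, F.mapH, m⟩, h₃, h₄⟩) :
    VertTrans (⟨F, h₁, h₂⟩ : VDFunctor A B) ⟨⟨F.vert, F.mapH, m⟩, h₃, h₄⟩ where
  vert := 𝟙 F.vert
  cell Γ := B.idc (F.mapH Γ)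
  naturality := by
    obtain ⟨v, k, c⟩ := F
    obtain rfl : @c = @m := by
      simpa using h
    exact (VertTrans.id ⟨⟨v, k, c⟩, h₁, h₂⟩).naturality

theorem ofEq_eq {F : VDMap A.toVDGraph B.toVDGraph} {m : ∀ {X Y Z W : A.Obj}
    {Γ : HPath A.HHom X Y} {u : X ⟶ Z} {u' : Y ⟶ W} {Δ : A.HHom Z W}, A.Cell Γ u u' Δ →
      B.Cell (F.mapPath Γ) (F.vert.map u) (F.vert.map u') (F.mapH Δ)} {h₁ h₂ h₃ h₄}
    (h : (⟨F, h₁, h₂⟩ : VDFunctor A B) = ⟨⟨F.vert, F.mapH, m⟩, h₃, h₄⟩) :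
    ofEq h = eqToHom h := by
  obtain ⟨v, k, c⟩ := F
  obtain rfl : @c = @m := by
    simpa using h
  rfl

/-- `ofEq` as an isomorphism. -/
def isoOfEq {F : VDMap A.toVDGraph B.toVDGraph} {m : ∀ {X Y Z W : A.Obj}
    {Γ : HPath A.HHom X Y} {u : X ⟶ Z} {u' : Y ⟶ W} {Δ : A.HHom Z W}, A.Cell Γ u u' Δ →
      B.Cell (F.mapPath Γ) (F.vert.map u) (F.vert.map u') (F.mapH Δ)} {h₁ h₂ h₃ h₄}
    (h : (⟨F, h₁, h₂⟩ : VDFunctor A B) = ⟨⟨F.vert, F.mapH, m⟩, h₃, h₄⟩) :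
    (⟨F, h₁, h₂⟩ : VDFunctor A B) ≅ ⟨⟨F.vert, F.mapH, m⟩, h₃, h₄⟩ where
  hom := ofEq h
  inv := ofEq (F := ⟨F.vert, F.mapH, m⟩) h.symm
  hom_inv_id := by
    rw [ofEq_eq h, ofEq_eq (F := ⟨F.vert, F.mapH, m⟩) h.symm]
    exact eqToHom_trans _ _
  inv_hom_id := by
    rw [ofEq_eq h, ofEq_eq (F := ⟨F.vert, F.mapH, m⟩) h.symm]
    exact eqToHom_trans _ _

theorem isoOfEq_eq {F : VDMap A.toVDGraph B.toVDGraph} {m : ∀ {X Y Z W : A.Obj}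
    {Γ : HPath A.HHom X Y} {u : X ⟶ Z} {u' : Y ⟶ W} {Δ : A.HHom Z W}, A.Cell Γ u u' Δ →
      B.Cell (F.mapPath Γ) (F.vert.map u) (F.vert.map u') (F.mapH Δ)} {h₁ h₂ h₃ h₄}
    (h : (⟨F, h₁, h₂⟩ : VDFunctor A B) = ⟨⟨F.vert, F.mapH, m⟩, h₃, h₄⟩) :
    isoOfEq h = eqToIso h :=
  Iso.ext (ofEq_eq h)

theorem id_comp_heq {X Y Z W : B.Obj} {Γ : HPath B.HHom X Y} {u : X ⟶ Z} {u' : Y ⟶ W}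
    {δ : B.HHom Z W} (θ : B.Cell Γ u u' δ) {w : X ⟶ Z} {w' : Y ⟶ W}
    (hw : u ≫ 𝟙 Z = w) (hw' : u' ≫ 𝟙 W = w') :
    HEq (B.comp (B.idc δ) (.single θ) hw hw') θ := by
  rw [B.id_comp_of_eq]
  exact VDGraph.castSides_heq _ _ _

theorem comp_id_heq {X Y Z W : B.Obj} {e : B.HHom X Y} {u : X ⟶ Z} {u' : Y ⟶ W}
    {δ : B.HHom Z W} (θ : B.Cell (HPath.single e) u u' δ) {w : X ⟶ Z} {w' : Y ⟶ W}
    (hw : 𝟙 X ≫ u = w) (hw' : 𝟙 Y ≫ u' = w') :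
    HEq (B.comp θ (.single (B.idc e)) hw hw') θ := by
  have := B.comp_id_of_eq θ hw hw'
  exact (heq_of_eq this).trans (VDGraph.castSides_heq _ _ _)

theorem comp_id_heq' {X Y Z W : B.Obj} {e : B.HHom X Y} {u : X ⟶ Z} {u' : Y ⟶ W}
    {δ : B.HHom Z W} (θ : B.Cell (HPath.single e) u u' δ) {a : X ⟶ X} {a' : Y ⟶ Y}
    (p : B.Cell (HPath.single e) a a' e) (ha : a = 𝟙 X) (ha' : a' = 𝟙 Y) (hp : HEq p (B.idc e))
    {w : X ⟶ Z} {w' : Y ⟶ W} (hw : a ≫ u = w) (hw' : a' ≫ u' = w') :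
    HEq (B.comp θ (.single p) hw hw') θ := by
  subst ha ha'
  cases hp
  exact comp_id_heq θ hw hw'

theorem map_idc_heq (F : VDFunctor A B) {X Y : A.Obj} (Γ : A.HHom X Y) :
    HEq (F.mapCell (A.idc Γ)) (B.idc (F.mapH Γ)) := by
  rw [← F.map_idc]
  exact (VDGraph.castSides_heq _ _ _).symm

end VertTrans

/-- The 2-category of virtual double categories, virtual double functors and vertical
transformations. -/
instance VDC.bicategory : Bicategory VDC.{w} where
  Hom A B := VDFunctor A B
  id A := VDFunctor.id A
  comp F G := F.comp G
  homCategory A B := VertTrans.category A B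
  whiskerLeft F _ _ α := VertTrans.whiskerLeft F α
  whiskerRight α H := VertTrans.whiskerRight α H
  associator F G H := VertTrans.isoOfEq (VDFunctor.comp_assoc F G H)
  leftUnitor F := VertTrans.isoOfEq (VDFunctor.id_comp F)
  rightUnitor F := VertTrans.isoOfEq (VDFunctor.comp_id F)
  whiskerLeft_id _ _ := rfl
  whiskerLeft_comp _ _ _ _ _ _ := rfl
  id_whiskerLeft η := VertTrans.ext_heq
    (fun _ => ((Category.id_comp _).trans (Category.comp_id _)).symm)
    (fun Γ => ((VertTrans.comp_id_heq _ _ _).trans (VertTrans.id_comp_heq (η.cell Γ) _ _)).symm)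
  comp_whiskerLeft F G _ _ η := VertTrans.ext_heq
    (fun _ => ((Category.id_comp _).trans (Category.comp_id _)).symm)
    (fun Γ => ((VertTrans.comp_id_heq _ _ _).trans
      (VertTrans.id_comp_heq (η.cell (G.mapH (F.mapH Γ))) _ _)).symm)
  id_whiskerRight F H := VertTrans.ext_heq (fun _ => H.vert.map_id _)
    (fun Γ => VertTrans.map_idc_heq H (F.mapH Γ))
  comp_whiskerRight α β H := VertTrans.ext_heq (fun _ => H.vert.map_comp _ _)
    (fun Γ => by
      refine (heq_of_eq (H.map_comp (β.cell Γ) (.single (α.cell Γ)))).trans ?_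
      refine (VDGraph.castSides_heq (H.vert.map_comp _ _) (H.vert.map_comp _ _) _).symm.trans ?_
      exact heq_of_eq (VDOps.castSides_comp _ _ _ _ _ _ _))
  whiskerRight_id η := VertTrans.ext_heq
    (fun _ => ((Category.id_comp _).trans (Category.comp_id _)).symm)
    (fun Γ => (VDMap.id_mapCell_heq (η.cell Γ)).trans
      ((VertTrans.comp_id_heq _ _ _).trans (VertTrans.id_comp_heq (η.cell Γ) _ _)).symm)
  whiskerRight_comp η G H := VertTrans.ext_heq
    (fun _ => ((Category.id_comp _).trans (Category.comp_id _)).symm)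
    (fun Γ => (VDMap.comp_mapCell_heq G.toVDMap H.toVDMap (η.cell Γ)).trans
      ((VertTrans.comp_id_heq _ _ _).trans
        (VertTrans.id_comp_heq (H.mapCell (G.mapCell (η.cell Γ))) _ _)).symm)
  whisker_assoc F _ _ η H := VertTrans.ext_heq
    (fun _ => ((Category.id_comp _).trans (Category.comp_id _)).symm)
    (fun Γ => ((VertTrans.comp_id_heq _ _ _).trans
      (VertTrans.id_comp_heq (H.mapCell (η.cell (F.mapH Γ))) _ _)).symm)
  whisker_exchange α β := VertTrans.ext_heq (fun _ => (β.vert.naturality _).symm)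
    (fun Γ => (VDGraph.castSides_heq (β.vert.naturality _).symm (β.vert.naturality _).symm _).symm.trans
      (heq_of_eq ((VDOps.castSides_comp _ _ _ _ _ _ _).trans
      (β.naturality_of_eq (α.cell Γ) _ _).symm)))
  pentagon F G H I := VertTrans.ext_heq
    (fun _ => (congrArg (· ≫ _) (I.vert.map_id _)).trans (Category.id_comp _))
    (fun Γ => VertTrans.comp_id_heq' _ _ (I.vert.map_id _) (I.vert.map_id _)
      (VertTrans.map_idc_heq I (H.mapH (G.mapH (F.mapH Γ)))) _ _)
  triangle F G := VertTrans.ext_heq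
    (fun _ => (Category.comp_id _).trans (G.vert.map_id _).symm)
    (fun Γ => (VertTrans.comp_id_heq _ _ _).trans
      (VertTrans.map_idc_heq G (F.mapH Γ)).symm)

instance VDC.strict : Bicategory.Strict VDC.{w} where
  id_comp F := VDFunctor.id_comp F
  comp_id F := VDFunctor.comp_id F
  assoc F G H := VDFunctor.comp_assoc F G H
  leftUnitor_eqToIso F := VertTrans.isoOfEq_eq (VDFunctor.id_comp F)
  rightUnitor_eqToIso F := VertTrans.isoOfEq_eq (VDFunctor.comp_id F)
  associator_eqToIso F G H := VertTrans.isoOfEq_eq (VDFunctor.comp_assoc F G H)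

/-! ### 2-categories -/

namespace TwoCat

open Bicategory

universe w₁ v₁ u₁ w₂ v₂ u₂

/-- A terminal object of a 2-category: each hom-category into it is the terminal category. -/
structure Terminal {K : Type u₁} [Bicategory.{w₁, v₁} K] (T : K) where
  toHom : ∀ X : K, X ⟶ T
  one_uniq : ∀ {X : K} (f g : X ⟶ T), f = g
  two_uniq : ∀ {X : K} {f g : X ⟶ T} (α β : f ⟶ g), α = β

section TwoNat

variable {K : Type u₁} [Bicategory.{w₁, v₁} K] {L : Type u₂} [Bicategory.{w₂, v₂} L]

/-- (Strict) 2-natural transformations between 2-functors. -/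
structure TwoNatTrans (F G : StrictPseudofunctor K L) where
  app : ∀ X : K, F.obj X ⟶ G.obj X
  naturality : ∀ {X Y : K} (f : X ⟶ Y), F.map f ≫ app Y = app X ≫ G.map f
  naturality₂ : ∀ {X Y : K} {f g : X ⟶ Y} (η : f ⟶ g),
    F.map₂ η ▷ app Y =
      eqToHom (naturality f) ≫ app X ◁ G.map₂ η ≫ eqToHom (naturality g).symm

/-- 2-natural isomorphisms. -/
structure TwoNatIso (F G : StrictPseudofunctor K L) where
  hom : TwoNatTrans F G
  inv : TwoNatTrans G F
  hom_inv_id : ∀ X : K, hom.app X ≫ inv.app X = 𝟙 (F.obj X)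
  inv_hom_id : ∀ X : K, inv.app X ≫ hom.app X = 𝟙 (G.obj X)

/-- 2-adjunctions, presented by a 2-natural unit and counit satisfying the triangle identities. -/
structure TwoAdjunction (F : StrictPseudofunctor K L) (G : StrictPseudofunctor L K) where
  unit : TwoNatTrans (StrictPseudofunctor.id K) (F.comp G)
  counit : TwoNatTrans (G.comp F) (StrictPseudofunctor.id L)
  left_triangle : ∀ X : K, F.map (unit.app X) ≫ counit.app (F.obj X) = 𝟙 (F.obj X)
  right_triangle : ∀ Y : L, unit.app (G.obj Y) ≫ G.map (counit.app Y) = 𝟙 (G.obj Y)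

/-- Being a right 2-adjoint. -/
def IsRightTwoAdjoint (G : StrictPseudofunctor L K) : Prop :=
  ∃ F : StrictPseudofunctor K L, Nonempty (TwoAdjunction F G)

end TwoNat

section Slice

variable {K : Type u₁} [Bicategory.{w₁, v₁} K]

/-- Objects of the strict slice 2-category `K / X`. -/
structure Slice (X : K) where
  left : K
  hom : left ⟶ X

namespace Slice

variable {X : K}

/-- 1-cells of the slice: strictly commuting triangles. -/
@[ext]
structure Hom (a b : Slice X) where
  left : a.left ⟶ b.left
  w : left ≫ b.hom = a.hom

/-- 2-cells of the slice: 2-cells whose whiskering with the projection is an identity. -/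
@[ext]
structure Hom₂ {a b : Slice X} (f g : Hom a b) where
  left : f.left ⟶ g.left
  w : left ▷ b.hom = eqToHom (f.w.trans g.w.symm)

instance homCategory (a b : Slice X) : Category (Hom a b) where
  Hom f g := Hom₂ f g
  id f := ⟨𝟙 f.left, by simp⟩
  comp α β := ⟨α.left ≫ β.left, by simp [α.w, β.w]⟩
  id_comp _ := Hom₂.ext (Category.id_comp _)
  comp_id _ := Hom₂.ext (Category.comp_id _)
  assoc _ _ _ := Hom₂.ext (Category.assoc _ _ _)

variable [Bicategory.Strict K]

/-- Invertible 2-cells of the slice. -/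
def isoMk {a b : Slice X} {f g : Hom a b} (e : f.left ≅ g.left)
    (h : e.hom ▷ b.hom = eqToHom (f.w.trans g.w.symm)) : f ≅ g where
  hom := ⟨e.hom, h⟩
  inv := ⟨e.inv, by
    have h' : e.hom ▷ b.hom ≫ e.inv ▷ b.hom = 𝟙 _ := by
      rw [← comp_whiskerRight, e.hom_inv_id, id_whiskerRight]
    rw [h] at h'
    rw [← cancel_epi (eqToHom (f.w.trans g.w.symm)), h', eqToHom_trans, eqToHom_refl]⟩
  hom_inv_id := Hom₂.ext e.hom_inv_id
  inv_hom_id := Hom₂.ext e.inv_hom_id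

instance categoryStruct (X : K) : CategoryStruct (Slice X) where
  Hom a b := Hom a b
  id a := ⟨𝟙 a.left, Strict.id_comp _⟩
  comp f g := ⟨f.left ≫ g.left, by rw [Strict.assoc, g.w, f.w]⟩

instance bicategory (X : K) : Bicategory (Slice X) where
  toCategoryStruct := categoryStruct X
  homCategory a b := homCategory a b
  whiskerLeft {a b c} f g h η := ⟨f.left ◁ η.left, by
    rw [whisker_assoc, η.w]
    simp [Strict.associator_eqToIso]⟩
  whiskerRight {a b c f g} η h := ⟨η.left ▷ h.left, by
    have e : (η.left ▷ h.left) ▷ c.hom =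
        (α_ _ _ _).hom ≫ η.left ▷ (h.left ≫ c.hom) ≫ (α_ _ _ _).inv := by simp
    rw [e, whiskerRight_congr h.w, η.w]
    simp [Strict.associator_eqToIso]⟩
  associator f g h := isoMk (α_ f.left g.left h.left) (by
    simp [Strict.associator_eqToIso])
  leftUnitor f := isoMk (λ_ f.left) (by simp [Strict.leftUnitor_eqToIso])
  rightUnitor f := isoMk (ρ_ f.left) (by simp [Strict.rightUnitor_eqToIso])
  whiskerLeft_id _ _ := Hom₂.ext (whiskerLeft_id _ _)
  whiskerLeft_comp _ _ _ _ _ _ := Hom₂.ext (whiskerLeft_comp _ _ _)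
  id_whiskerLeft _ := Hom₂.ext (id_whiskerLeft _)
  comp_whiskerLeft _ _ _ _ _ := Hom₂.ext (comp_whiskerLeft _ _ _)
  id_whiskerRight _ _ := Hom₂.ext (id_whiskerRight _ _)
  comp_whiskerRight _ _ _ := Hom₂.ext (comp_whiskerRight _ _ _)
  whiskerRight_id _ := Hom₂.ext (whiskerRight_id _)
  whiskerRight_comp _ _ _ := Hom₂.ext (whiskerRight_comp _ _ _)
  whisker_assoc _ _ _ _ _ := Hom₂.ext (whisker_assoc _ _ _)
  whisker_exchange _ _ := Hom₂.ext (whisker_exchange _ _)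
  pentagon _ _ _ _ := Hom₂.ext (pentagon _ _ _ _)
  triangle _ _ := Hom₂.ext (triangle _ _)

theorem eqToHom_left {a b : Slice X} {f g : a ⟶ b} (h : f = g) :
    Hom₂.left (eqToHom h) = eqToHom (congrArg Hom.left h) := by
  subst h
  rfl

theorem iso_eq {a b : Slice X} {f g : a ⟶ b} (e : f ≅ g) (h : f = g)
    (he : Hom₂.left e.hom = eqToHom (congrArg Hom.left h)) : e = eqToIso h :=
  Iso.ext (Hom₂.ext (he.trans (eqToHom_left h).symm))

theorem eqToHom_comp_comp_left {a b : Slice X} {f f' g g' : a ⟶ b} (h : f = f') (α : f' ⟶ g)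
    (h' : g = g') : Hom₂.left (eqToHom h ≫ α ≫ eqToHom h') =
      eqToHom (congrArg Hom.left h) ≫ Hom₂.left α ≫ eqToHom (congrArg Hom.left h') := by
  subst h h'
  simp

instance strict (X : K) : Bicategory.Strict (Slice X) where
  id_comp f := Hom.ext (Strict.id_comp f.left)
  comp_id f := Hom.ext (Strict.comp_id f.left)
  assoc f g h := Hom.ext (Strict.assoc f.left g.left h.left)
  leftUnitor_eqToIso f := iso_eq _ _ (congrArg Iso.hom (Strict.leftUnitor_eqToIso f.left))
  rightUnitor_eqToIso f := iso_eq _ _ (congrArg Iso.hom (Strict.rightUnitor_eqToIso f.left))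
  associator_eqToIso f g h :=
    iso_eq _ _ (congrArg Iso.hom (Strict.associator_eqToIso f.left g.left h.left))

/-- The forgetful 2-functor `K / X → K`. -/
def forget (X : K) : StrictPseudofunctor (Slice X) K := .mk''
  { obj a := a.left
    map f := f.left
    map₂ α := α.left
    map_id _ := rfl
    map_comp _ _ := rfl
    map₂_id _ := rfl
    map₂_comp _ _ := rfl
    map₂_whisker_left f _ _ η := by simp; rfl
    map₂_whisker_right η f := by simp; rfl }

/-- The 2-functor `∑ₜ : K / X → K / Y` given by composition with `t : X ⟶ Y`. -/
def sigma {X Y : K} (t : X ⟶ Y) : StrictPseudofunctor (Slice X) (Slice Y) := .mk''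
  { obj a := ⟨a.left, a.hom ≫ t⟩
    map f := ⟨f.left, by rw [← Strict.assoc, f.w]⟩
    map₂ {a b f g} α := ⟨α.left, by
      have e : α.left ▷ (b.hom ≫ t) = (α_ _ _ _).inv ≫ (α.left ▷ b.hom) ▷ t ≫ (α_ _ _ _).hom := by
        simp
      rw [e, α.w]
      simp [Strict.associator_eqToIso]⟩
    map_id _ := rfl
    map_comp _ _ := rfl
    map₂_id _ := rfl
    map₂_comp _ _ := rfl
    map₂_whisker_left f _ _ η := by simp; rfl
    map₂_whisker_right η f := by simp; rfl }

end Slice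

variable [Bicategory.Strict K] {L : Type u₂} [Bicategory.{w₂, v₂} L] [Bicategory.Strict L]

/-- For a 2-functor `R : K → L` and a terminal object `T` of `K`, the 2-functor
`R₁ : K → L / R T` sending `A` to `R A ⟶ R T`. -/
def overTerminal (R : StrictPseudofunctor K L) {T : K} (hT : Terminal T) :
    StrictPseudofunctor K (Slice (R.obj T)) := .mk''
  { obj A := ⟨R.obj A, R.map (hT.toHom A)⟩
    map f := ⟨R.map f, by rw [← R.map_comp, hT.one_uniq (f ≫ hT.toHom _) (hT.toHom _)]⟩
    map₂ {A B f g} α := ⟨R.map₂ α, by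
      have h : α ▷ hT.toHom B = eqToHom (hT.one_uniq _ _) := hT.two_uniq _ _
      have := R.map₂_whisker_right α (hT.toHom B)
      rw [h, R.mapComp_eq_eqToIso, R.mapComp_eq_eqToIso, PrelaxFunctor.map₂_eqToHom] at this
      simp only [eqToIso.hom, eqToIso.inv] at this
      rw [← cancel_epi (eqToHom (R.map_comp f (hT.toHom B))),
        ← cancel_mono (eqToHom (R.map_comp g (hT.toHom B)).symm)]
      simpa using this.symm⟩
    map_id _ := Slice.Hom.ext (R.map_id _)
    map_comp f g := Slice.Hom.ext (R.map_comp f g)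
    map₂_id _ := Slice.Hom₂.ext (R.map₂_id _)
    map₂_comp _ _ := Slice.Hom₂.ext (R.map₂_comp _ _)
    map₂_whisker_left f g h η := Slice.Hom₂.ext <| by
      have := R.map₂_whisker_left f η
      rw [R.mapComp_eq_eqToIso, R.mapComp_eq_eqToIso] at this
      rw [Slice.eqToHom_comp_comp_left]
      exact this
    map₂_whisker_right η f := Slice.Hom₂.ext <| by
      have := R.map₂_whisker_right η f
      rw [R.mapComp_eq_eqToIso, R.mapComp_eq_eqToIso] at this
      rw [Slice.eqToHom_comp_comp_left]
      exact this }

end Slice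

end TwoCat

namespace TwoCat

open Bicategory

universe w₁ v₁ u₁ w₂ v₂ u₂

section Polynomial

variable {K : Type u₁} [Bicategory.{w₁, v₁} K] [Bicategory.Strict K]

/-- 2-pullback squares, by their one- and two-dimensional universal properties. -/
structure IsTwoPullback {P A X Y : K} (fst : P ⟶ A) (snd : P ⟶ X) (g : A ⟶ Y) (p : X ⟶ Y) :
    Prop where
  w : fst ≫ g = snd ≫ p
  existsUnique_lift : ∀ {Z : K} (a : Z ⟶ A) (x : Z ⟶ X), a ≫ g = x ≫ p →
    ∃! l : Z ⟶ P, l ≫ fst = a ∧ l ≫ snd = x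
  existsUnique_lift₂ : ∀ {Z : K} (l l' : Z ⟶ P) (α : l ≫ fst ⟶ l' ≫ fst)
    (ξ : l ≫ snd ⟶ l' ≫ snd),
    α ▷ g ≫ eqToHom (by rw [Strict.assoc, w, Strict.assoc] : (l' ≫ fst) ≫ g = (l' ≫ snd) ≫ p) =
      eqToHom (by rw [Strict.assoc, w, Strict.assoc]) ≫ ξ ▷ p →
    ∃! χ : l ⟶ l', χ ▷ fst = α ∧ χ ▷ snd = ξ

/-- The pullback 2-functor `p^* : K / Y → K / X` along `p : X ⟶ Y`: a 2-functor whose value at each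
`b` is a 2-pullback of `b` along `p`, the projections to the domain of `b` being 2-natural. (By the
universal property this determines the action of the 2-functor on 1-cells and 2-cells.) -/
structure PullbackFunctor {X Y : K} (p : X ⟶ Y) where
  functor : StrictPseudofunctor (Slice Y) (Slice X)
  proj : TwoNatTrans (functor.comp (Slice.forget X)) (Slice.forget Y)
  isTwoPullback : ∀ b : Slice Y, IsTwoPullback (P := (functor.obj b).left) (A := b.left)
    (proj.app b) (functor.obj b).hom b.hom p

/-- For a diagram `I ← E → B` with maps `s` and `p`: the pullback 2-functors `s^*` and `p^*` and a
right 2-adjoint `∏ₚ` of `p^*`. Given such data `p` is powerful. -/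
structure PolynomialData {I E B : K} (s : E ⟶ I) (p : E ⟶ B) where
  sStar : PullbackFunctor s
  pStar : PullbackFunctor p
  pi : StrictPseudofunctor (Slice E) (Slice B)
  adj : TwoAdjunction pStar.functor pi

/-- The polynomial 2-functor `∑ₜ ∏ₚ s^* : K / I → K / J` of `I ← E → B → J`. -/
def PolynomialData.functor {I E B J : K} {s : E ⟶ I} {p : E ⟶ B} (D : PolynomialData s p)
    (t : B ⟶ J) : StrictPseudofunctor (Slice I) (Slice J) :=
  (D.sStar.functor.comp D.pi).comp (Slice.sigma t)

/-- The polynomial 2-functor `K → K` of a morphism `p : E ⟶ B`: the case `I = J = 1`, where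
`K / 1` is identified with `K` through `A ↦ (A ⟶ 1)` and the forgetful 2-functor. -/
def PolynomialData.endofunctor {T E B : K} {hT : Terminal T} {p : E ⟶ B}
    (D : PolynomialData (hT.toHom E) p) : StrictPseudofunctor K K :=
  ((overTerminal (StrictPseudofunctor.id K) hT).comp (D.functor (hT.toHom B))).comp
    (Slice.forget T)

/-- `R` is the polynomial 2-functor induced by `p`: the pullback 2-functors and the right 2-adjoint
`∏ₚ` exist (in particular `p` is powerful), and `R` is 2-naturally isomorphic to the resulting
composite, however they are chosen. -/
def IsPolynomialOf (R : StrictPseudofunctor K K) {T E B : K} (hT : Terminal T) (p : E ⟶ B) :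
    Prop :=
  Nonempty (PolynomialData (hT.toHom E) p) ∧
    ∀ D : PolynomialData (hT.toHom E) p, Nonempty (TwoNatIso D.endofunctor R)

end Polynomial

section Familial

/-- The structure of a split fibration on a functor `p`, given as the class of chosen cartesian
lifts: each of them is cartesian, each morphism `b ⟶ p e` has exactly one chosen lift with codomain
`e`, and the chosen lifts contain the identities and are closed under composition. -/
structure SplitFibration {𝒳 : Type u₁} [Category.{v₁} 𝒳] {𝒮 : Type u₂} [Category.{v₂} 𝒮]
    (p : 𝒳 ⥤ 𝒮) where
  chosen : MorphismProperty 𝒳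
  cartesian : ∀ {e' e : 𝒳} (φ : e' ⟶ e), chosen φ → p.IsStronglyCartesian (p.map φ) φ
  existsUnique_lift : ∀ (e : 𝒳) {b : 𝒮} (β : b ⟶ p.obj e),
    ∃! φ : Σ e' : 𝒳, e' ⟶ e, chosen φ.2 ∧ p.IsHomLift β φ.2
  id_chosen : ∀ e : 𝒳, chosen (𝟙 e)
  comp_chosen : ∀ {e'' e' e : 𝒳} (ψ : e'' ⟶ e') (φ : e' ⟶ e),
    chosen ψ → chosen φ → chosen (ψ ≫ φ)

variable {K : Type u₁} [Bicategory.{w₁, v₁} K]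

/-- Split fibrations in a 2-category: each functor `K(X, p)` is a split fibration, and
precomposition with any `f : Y ⟶ X` preserves chosen cartesian lifts. -/
structure SplitFib {E B : K} (p : E ⟶ B) where
  fib : ∀ X : K, SplitFibration (postcomp X p)
  whisker : ∀ {X Y : K} (f : Y ⟶ X) {e' e : X ⟶ E} (φ : e' ⟶ e),
    (fib X).chosen φ → (fib Y).chosen (f ◁ φ)

variable [Bicategory.Strict K]

/-- Objects of the 2-category `Spl(B)`: split fibrations over `B`. -/
structure Spl (B : K) where
  obj : Slice B
  split : SplitFib obj.hom

namespace Spl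

variable {B : K}

/-- 1-cells of `Spl(B)`: 1-cells of `K / B` preserving chosen cartesian lifts. -/
@[ext]
structure Hom (a b : Spl B) where
  hom : a.obj ⟶ b.obj
  preserves : ∀ {X : K} {e' e : X ⟶ a.obj.left} (φ : e' ⟶ e),
    (a.split.fib X).chosen φ → (b.split.fib X).chosen (φ ▷ hom.left)

/-- 2-cells of `Spl(B)`: all 2-cells of `K / B`. -/
@[ext]
structure Hom₂ {a b : Spl B} (f g : Hom a b) where
  hom : f.hom ⟶ g.hom

instance homCategory (a b : Spl B) : Category (Hom a b) where
  Hom f g := Hom₂ f g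
  id f := ⟨𝟙 f.hom⟩
  comp α β := ⟨α.hom ≫ β.hom⟩
  id_comp _ := Hom₂.ext (Category.id_comp _)
  comp_id _ := Hom₂.ext (Category.comp_id _)
  assoc _ _ _ := Hom₂.ext (Category.assoc _ _ _)

/-- Invertible 2-cells of `Spl(B)`. -/
def isoMk {a b : Spl B} {f g : Hom a b} (e : f.hom ≅ g.hom) : f ≅ g where
  hom := ⟨e.hom⟩
  inv := ⟨e.inv⟩
  hom_inv_id := Hom₂.ext e.hom_inv_id
  inv_hom_id := Hom₂.ext e.inv_hom_id

/-- A 2-cell equal to a chosen lift, up to equality of boundaries, is a chosen lift. -/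
theorem chosen_of_eq {𝒳 : Type u₁} [Category.{v₁} 𝒳] (W : MorphismProperty 𝒳) {a b a' b' : 𝒳}
    {φ : a ⟶ b} {ψ : a' ⟶ b'} (ha : a = a') (hb : b = b') (h : ψ = eqToHom ha.symm ≫ φ ≫ eqToHom hb)
    (hφ : W φ) : W ψ := by
  subst ha hb h
  simpa using hφ

instance bicategory (B : K) : Bicategory (Spl B) where
  Hom a b := Hom a b
  id a := ⟨𝟙 a.obj, fun {X e' e} φ hφ => by
    refine chosen_of_eq _ (Strict.comp_id e').symm (Strict.comp_id e).symm ?_ hφ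
    refine (whiskerRight_id φ).trans ?_
    simp [Strict.rightUnitor_eqToIso]⟩
  comp {a b c} f g := ⟨f.hom ≫ g.hom, fun {X e' e} φ hφ => by
    refine chosen_of_eq _ (Strict.assoc _ _ _) (Strict.assoc _ _ _) ?_
      (g.preserves _ (f.preserves φ hφ))
    refine (whiskerRight_comp φ f.hom.left g.hom.left).trans ?_
    simp [Strict.associator_eqToIso]⟩
  homCategory a b := homCategory a b
  whiskerLeft f _ _ η := ⟨f.hom ◁ η.hom⟩
  whiskerRight η h := ⟨η.hom ▷ h.hom⟩
  associator f g h := isoMk (α_ f.hom g.hom h.hom)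
  leftUnitor f := isoMk (λ_ f.hom)
  rightUnitor f := isoMk (ρ_ f.hom)
  whiskerLeft_id _ _ := Hom₂.ext (whiskerLeft_id _ _)
  whiskerLeft_comp _ _ _ _ _ _ := Hom₂.ext (whiskerLeft_comp _ _ _)
  id_whiskerLeft _ := Hom₂.ext (id_whiskerLeft _)
  comp_whiskerLeft _ _ _ _ _ := Hom₂.ext (comp_whiskerLeft _ _ _)
  id_whiskerRight _ _ := Hom₂.ext (id_whiskerRight _ _)
  comp_whiskerRight _ _ _ := Hom₂.ext (comp_whiskerRight _ _ _)
  whiskerRight_id _ := Hom₂.ext (whiskerRight_id _)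
  whiskerRight_comp _ _ _ := Hom₂.ext (whiskerRight_comp _ _ _)
  whisker_assoc _ _ _ _ _ := Hom₂.ext (whisker_assoc _ _ _)
  whisker_exchange _ _ := Hom₂.ext (whisker_exchange _ _)
  pentagon _ _ _ _ := Hom₂.ext (pentagon _ _ _ _)
  triangle _ _ := Hom₂.ext (triangle _ _)

theorem eqToHom_hom {a b : Spl B} {f g : a ⟶ b} (h : f = g) :
    Hom₂.hom (eqToHom h) = eqToHom (congrArg Hom.hom h) := by
  subst h
  rfl

theorem iso_eq {a b : Spl B} {f g : a ⟶ b} (e : f ≅ g) (h : f = g)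
    (he : Hom₂.hom e.hom = eqToHom (congrArg Hom.hom h)) : e = eqToIso h :=
  Iso.ext (Hom₂.ext (he.trans (eqToHom_hom h).symm))

instance strict (B : K) : Bicategory.Strict (Spl B) where
  id_comp f := Hom.ext (Strict.id_comp f.hom)
  comp_id f := Hom.ext (Strict.comp_id f.hom)
  assoc f g h := Hom.ext (Strict.assoc f.hom g.hom h.hom)
  leftUnitor_eqToIso f := iso_eq _ _ (congrArg Iso.hom (Strict.leftUnitor_eqToIso f.hom))
  rightUnitor_eqToIso f := iso_eq _ _ (congrArg Iso.hom (Strict.rightUnitor_eqToIso f.hom))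
  associator_eqToIso f g h :=
    iso_eq _ _ (congrArg Iso.hom (Strict.associator_eqToIso f.hom g.hom h.hom))

/-- The forgetful 2-functor `U : Spl(B) → K / B`. -/
def forget (B : K) : StrictPseudofunctor (Spl B) (Slice B) := .mk''
  { obj a := a.obj
    map f := f.hom
    map₂ α := α.hom
    map_id _ := rfl
    map_comp _ _ := rfl
    map₂_id _ := rfl
    map₂_comp _ _ := rfl
    map₂_whisker_left f _ _ η := by simp; rfl
    map₂_whisker_right η f := by simp; rfl }

end Spl

variable {L : Type u₂} [Bicategory.{w₂, v₂} L] [Bicategory.Strict L]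

/-- Parametric right 2-adjoints: `R₁ : K → L / R1` is a right 2-adjoint. -/
def IsParametricRightTwoAdjoint (R : StrictPseudofunctor K L) {T : K} (hT : Terminal T) : Prop :=
  IsRightTwoAdjoint (overTerminal R hT)

/-- Familial 2-functors: parametric right 2-adjoints `R` for which `R₁` factorizes through the
forgetful 2-functor `Spl(R1) → L / R1`. -/
def IsFamilial (R : StrictPseudofunctor K L) {T : K} (hT : Terminal T) : Prop :=
  IsParametricRightTwoAdjoint R hT ∧
    ∃ R' : StrictPseudofunctor K (Spl (R.obj T)), R'.comp (Spl.forget (R.obj T)) = overTerminal R hT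

end Familial

end TwoCat

/-! ### Horizontally chaotic virtual double categories and discrete opfibrations -/

namespace VDC

/-- The horizontally chaotic virtual double category `C_hc` on a category `C`: it has exactly one
horizontal morphism between any two objects, and exactly one multicell with any given boundary. -/
def hc (C : Type w) [Category.{w} C] : VDC.{w} where
  Obj := C
  HHom _ _ := PUnit
  Cell _ _ _ _ := PUnit
  idc _ := ⟨⟩
  comp _ _ _ _ _ _ := ⟨⟩
  id_comp _ := rfl
  comp_id _ := rfl
  assoc _ _ := rfl

/-- The terminal virtual double category. -/
def one : VDC.{w} := hc (Discrete PUnit.{w + 1})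

end VDC

/-- The virtual double functor `F_hc : C_hc → D_hc` induced by a functor `F`. -/
def VDFunctor.hc {C D : Type w} [Category.{w} C] [Category.{w} D] (F : C ⥤ D) :
    VDFunctor (VDC.hc C) (VDC.hc D) where
  vert := F
  mapH _ := ⟨⟩
  mapCell _ := ⟨⟩
  map_idc _ := rfl
  map_comp _ _ := rfl

theorem VDFunctor.ext_of {A B : VDC.{w}} {F G : VDFunctor A B} (h : F.vert = G.vert)
    (h₁ : ∀ {X Y : A.Obj} (Γ : A.HHom X Y), HEq (F.mapH Γ) (G.mapH Γ))
    (h₂ : ∀ {X Y Z W : A.Obj} {Γ : HPath A.HHom X Y} {u : X ⟶ Z} {u' : Y ⟶ W} {Δ : A.HHom Z W}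
      (θ : A.Cell Γ u u' Δ), HEq (F.mapCell θ) (G.mapCell θ)) : F = G := by
  obtain ⟨⟨v, k, c⟩, _, _⟩ := F
  obtain ⟨⟨v', k', c'⟩, _, _⟩ := G
  obtain rfl : v = v' := h
  obtain rfl : @k = @k' := by
    funext X Y Γ
    exact eq_of_heq (h₁ Γ)
  obtain rfl : @c = @c' := by
    funext X Y Z W Γ u u' Δ θ
    exact eq_of_heq (h₂ θ)
  rfl

/-- `VDC.one` is a terminal object of the 2-category of virtual double categories. -/
def VDC.oneTerminal : TwoCat.Terminal VDC.one.{w} where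
  toHom A :=
    { vert := (Functor.const A.Obj).obj ⟨⟨⟩⟩
      mapH _ := ⟨⟩
      mapCell _ := ⟨⟩
      map_idc _ := rfl
      map_comp _ _ := rfl }
  one_uniq f g := VDFunctor.ext_of (CategoryTheory.Functor.ext
      (fun X => Subsingleton.elim (α := Discrete PUnit) (f.vert.obj X) (g.vert.obj X))
      (fun _ _ _ => Subsingleton.elim (α := (_ : Discrete PUnit) ⟶ _) _ _))
    (fun _ => HEq.rfl) (fun _ => HEq.rfl)
  two_uniq _ _ := VertTrans.ext_heq (fun _ => Subsingleton.elim (α := (_ : Discrete PUnit) ⟶ _) _ _)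
    (fun _ => HEq.rfl)

/-- Discrete opfibrations of virtual double categories. -/
structure VDFunctor.IsDiscreteOpfibration {X Y : VDC.{w}} (P : VDFunctor X Y) : Prop where
  /-- each vertical morphism `P x ⟶ y` lifts uniquely to a vertical morphism out of `x` -/
  vert : ∀ x : X.Obj, Function.Bijective
    (fun f : (Σ x' : X.Obj, x ⟶ x') =>
      (⟨P.vert.obj f.1, P.vert.map f.2⟩ : Σ y : Y.Obj, P.vert.obj x ⟶ y))
  /-- each multicell with top boundary `P Φ₁, …, P Φₙ` lifts uniquely to a multicell with top
  boundary `Φ₁, …, Φₙ` -/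
  cell : ∀ {x₀ x₁ : X.Obj} (Φ : HPath X.HHom x₀ x₁), Function.Bijective
    (fun θ : (Σ (z : X.Obj) (z' : X.Obj) (v : x₀ ⟶ z) (v' : x₁ ⟶ z') (Ψ : X.HHom z z'),
        X.Cell Φ v v' Ψ) =>
      (⟨P.vert.obj θ.1, P.vert.obj θ.2.1, P.vert.map θ.2.2.1, P.vert.map θ.2.2.2.1,
        P.mapH θ.2.2.2.2.1, P.mapCell θ.2.2.2.2.2⟩ :
        Σ (y : Y.Obj) (y' : Y.Obj) (v : P.vert.obj x₀ ⟶ y) (v' : P.vert.obj x₁ ⟶ y')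
          (Ψ : Y.HHom y y'), Y.Cell (P.mapPath Φ) v v' Ψ))

namespace VDC

/-- `Set_hc` for the category `Set` of small sets (sets in the universe `u`), viewed as a category
in the universe `u + 1`. -/
def SetHc : VDC.{u + 1} := hc (ULiftHom.{u + 1} (Type u))

/-- `(Set_*)_hc` for the category `Set_*` of small pointed sets. -/
def PointedHc : VDC.{u + 1} := hc (ULiftHom.{u + 1} Pointed.{u})

/-- The virtual double functor `P_hc : (Set_*)_hc → Set_hc` induced by the forgetful functor
`P : Set_* → Set`. -/
def Phc : PointedHc.{u} ⟶ SetHc.{u} :=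
  VDFunctor.hc (ULiftHom.down ⋙ forget Pointed.{u} ⋙ ULiftHom.up)

end VDC

/-! ### Matrices -/

namespace VDMat

variable (A : VDC.{u + 1})

/-- Objects: small families of objects of `A`. -/
structure Obj : Type (u + 1) where
  I : Type u
  fam : I → A.Obj

variable {A}

/-- Vertical morphisms: morphisms of families. -/
@[ext]
structure VHom (X Y : Obj A) : Type (u + 1) where
  idx : X.I → Y.I
  map : ∀ i, X.fam i ⟶ Y.fam (idx i)

instance category : Category.{u + 1} (Obj A) where
  Hom X Y := VHom X Y
  id X := ⟨fun i => i, fun i => 𝟙 (X.fam i)⟩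
  comp f g := ⟨fun i => g.idx (f.idx i), fun i => f.map i ≫ g.map (f.idx i)⟩
  id_comp f := congrArg (VHom.mk f.idx) (funext fun i => Category.id_comp (f.map i))
  comp_id f := congrArg (VHom.mk f.idx) (funext fun i => Category.comp_id (f.map i))
  assoc f g h := congrArg (VHom.mk fun i => h.idx (g.idx (f.idx i)))
    (funext fun i => Category.assoc (f.map i) (g.map _) (h.map _))

/-- Horizontal morphisms: matrices of horizontal morphisms of `A`. -/
abbrev HHom (X Y : Obj A) : Type (u + 1) := ∀ (i : X.I) (j : Y.I), A.HHom (X.fam i) (Y.fam j)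

/-- For a sequence `Γ₁, …, Γₙ` of matrices, the sequences of indices `(i₀, …, iₙ)`; the first and
the last index are displayed in the type. -/
inductive Ix : ∀ {X Y : Obj A}, HPath (HHom (A := A)) X Y → X.I → Y.I → Type (u + 1)
  | nil {X : Obj A} (i : X.I) : Ix (HPath.nil (a := X)) i i
  | snoc {X Y Z : Obj A} {Γ : HPath HHom X Y} {g : HHom Y Z} {i : X.I} {j : Y.I}
      (s : Ix Γ i j) (k : Z.I) : Ix (Γ.snoc g) i k

/-- The sequence `Γ_{1,i₀,i₁}, …, Γ_{n,iₙ₋₁,iₙ}` of horizontal morphisms of `A`. -/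
def Ix.eval {X Y : Obj A} {Γ : HPath (HHom (A := A)) X Y} {i : X.I} {j : Y.I} :
    Ix Γ i j → HPath A.HHom (X.fam i) (Y.fam j)
  | .nil _ => .nil
  | .snoc (g := g) (j := j) s k => .snoc s.eval (g j k)

/-- Forgetting the last index. -/
def Ix.unsnoc {X Y Z : Obj A} {Γ : HPath (HHom (A := A)) X Y} {g : HHom Y Z} {i : X.I} {k : Z.I} :
    Ix (Γ.snoc g) i k → Σ j : Y.I, Ix Γ i j
  | .snoc (j := j) s _ => ⟨j, s⟩

/-- Splitting a sequence of indices along a concatenation. -/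
def Ix.split {X Y : Obj A} {Γ : HPath (HHom (A := A)) X Y} {i : X.I} :
    {Z : Obj A} → (Γ' : HPath (HHom (A := A)) Y Z) → {k : Z.I} → Ix (Γ.append Γ') i k →
      Σ j : Y.I, Ix Γ i j × Ix Γ' j k
  | _, .nil, k, s => ⟨k, s, .nil k⟩
  | _, .snoc Γ' _, k, s =>
    let r := split Γ' (unsnoc (Γ := Γ.append Γ') s).2
    ⟨r.1, r.2.1, .snoc r.2.2 k⟩

theorem Ix.eval_split {X Y Z : Obj A} {Γ : HPath (HHom (A := A)) X Y} {i : X.I}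
    (Γ' : HPath (HHom (A := A)) Y Z) {k : Z.I} (s : Ix (Γ.append Γ') i k) :
    (split Γ' s).2.1.eval.append (split Γ' s).2.2.eval = s.eval := by
  induction Γ' with
  | nil => rfl
  | snoc Γ' g ih =>
    cases s with
    | snoc s k =>
      exact congrArg (fun p => HPath.snoc p _) (ih s)

/-- Concatenation of sequences of indices. -/
def Ix.join {X Y : Obj A} {Γ : HPath (HHom (A := A)) X Y} {i : X.I} {j : Y.I} (s : Ix Γ i j)
    {Z : Obj A} {Γ' : HPath (HHom (A := A)) Y Z} {k : Z.I} (t : Ix Γ' j k) :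
    Ix (Γ.append Γ') i k :=
  match t, s with
  | .nil _, s => s
  | .snoc t k, s => .snoc (join s t) k

theorem Ix.eval_join {X Y Z : Obj A} {Γ : HPath (HHom (A := A)) X Y} {i : X.I} {j : Y.I}
    (s : Ix Γ i j) {Γ' : HPath (HHom (A := A)) Y Z} {k : Z.I} (t : Ix Γ' j k) :
    (s.join t).eval = s.eval.append t.eval := by
  induction t with
  | nil => rfl
  | snoc t k ih => exact congrArg (fun p => HPath.snoc p _) (ih s)

theorem Ix.split_join {X Y Z : Obj A} {Γ : HPath (HHom (A := A)) X Y} {i : X.I} {j : Y.I}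
    (s : Ix Γ i j) {Γ' : HPath (HHom (A := A)) Y Z} {k : Z.I} (t : Ix Γ' j k) :
    split Γ' (s.join t) = ⟨j, s, t⟩ := by
  induction t with
  | nil => rfl
  | snoc t k ih =>
    exact congrArg (fun r : (Σ j, Ix Γ i j × Ix _ j _) => (⟨r.1, r.2.1, .snoc r.2.2 k⟩ :
      Σ j, Ix Γ i j × Ix _ j _)) (ih s)

theorem Ix.join_split {X Y Z : Obj A} {Γ : HPath (HHom (A := A)) X Y} {i : X.I}
    (Γ' : HPath (HHom (A := A)) Y Z) {k : Z.I} (s : Ix (Γ.append Γ') i k) :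
    (split Γ' s).2.1.join (split Γ' s).2.2 = s := by
  induction Γ' with
  | nil => rfl
  | snoc Γ' g ih =>
    cases s with
    | snoc s k => exact congrArg (fun p => Ix.snoc p k) (ih s)

theorem Ix.exists_join {X Y Z : Obj A} {Γ : HPath (HHom (A := A)) X Y} {i : X.I}
    (Γ' : HPath (HHom (A := A)) Y Z) {k : Z.I} (s : Ix (Γ.append Γ') i k) :
    ∃ (j : Y.I) (s₁ : Ix Γ i j) (s₂ : Ix Γ' j k), s₁.join s₂ = s :=
  ⟨_, _, _, join_split Γ' s⟩

theorem Ix.snoc_heq {X Y Z : Obj A} {Γ Γ' : HPath (HHom (A := A)) X Y} {g : HHom Y Z} {i : X.I}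
    {j : Y.I} {s : Ix Γ i j} {s' : Ix Γ' i j} (h : Γ = Γ') (hs : HEq s s') (k : Z.I) :
    HEq (Ix.snoc (g := g) s k) (Ix.snoc (g := g) s' k) := by
  subst h
  cases hs
  rfl

theorem Ix.nil_join_heq {X Y : Obj A} {Γ : HPath (HHom (A := A)) X Y} {i : X.I} {j : Y.I}
    (s : Ix Γ i j) : HEq ((Ix.nil i).join s) s := by
  induction s with
  | nil => rfl
  | snoc s k ih => exact snoc_heq (HPath.nil_append _) ih k

theorem Ix.join_assoc_heq {X Y Z W : Obj A} {Γ : HPath (HHom (A := A)) X Y} {i : X.I} {j : Y.I}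
    (s : Ix Γ i j) {Γ' : HPath (HHom (A := A)) Y Z} {k : Z.I} (t : Ix Γ' j k)
    {Γ'' : HPath (HHom (A := A)) Z W} {l : W.I} (r : Ix Γ'' k l) :
    HEq ((s.join t).join r) (s.join (t.join r)) := by
  induction r with
  | nil => rfl
  | snoc r k ih => exact snoc_heq (HPath.append_assoc _ _ _) (ih t) k

theorem Ix.eval_eq_of_heq {X Y : Obj A} {Γ Γ' : HPath (HHom (A := A)) X Y} {i : X.I} {j : Y.I}
    {s : Ix Γ i j} {s' : Ix Γ' i j} (h : Γ = Γ') (hs : HEq s s') : s.eval = s'.eval := by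
  subst h
  cases hs
  rfl

/-- The data of the virtual double category of matrices. A multicell is a family of multicells of
`A` indexed by the sequences of indices of its top boundary. -/
abbrev graph (A : VDC.{u + 1}) : VDGraph.{u + 1} where
  Obj := Obj A
  HHom := HHom
  Cell {X Y _ _} Γ f f' Δ := ∀ (i : X.I) (j : Y.I) (s : Ix Γ i j),
    A.Cell s.eval (VHom.map f i) (VHom.map f' j) (Δ (VHom.idx f i) (VHom.idx f' j))

/-- The bottom sequence of indices and the row of multicells of `A` that a row of matrices of
multicells has at a given sequence of indices. -/
def rowAt {X Y Z W : Obj A} {Γ : HPath HHom X Y} {f : X ⟶ Z} {f' : Y ⟶ W} {Δ : HPath HHom Z W}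
    (Θ : (graph A).Row Γ f f' Δ) {i : X.I} {k : Y.I} (s : Ix Γ i k) :
    Σ t : Ix Δ (VHom.idx f i) (VHom.idx f' k),
      A.Row s.eval (VHom.map f i) (VHom.map f' k) t.eval :=
  match Θ, s with
  | .nil f, .nil i => ⟨.nil _, .nil _⟩
  | .snoc Θ θ rfl, s =>
    ⟨.snoc (rowAt Θ (Ix.split _ s).2.1).1 _,
      .snoc (rowAt Θ (Ix.split _ s).2.1).2 (θ _ _ (Ix.split _ s).2.2) (Ix.eval_split _ s)⟩


theorem rowAt_snoc {X Y Y' Z W W' : Obj A} {Γ : HPath HHom X Y} {Γ' : HPath HHom Y Y'}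
    {Γ'' : HPath HHom X Y'} {f : X ⟶ Z} {f' : Y ⟶ W} {f'' : Y' ⟶ W'} {Δ : HPath HHom Z W}
    {δ : HHom W W'} (Θ : (graph A).Row Γ f f' Δ) (θ : (graph A).Cell Γ' f' f'' δ)
    (h : Γ.append Γ' = Γ'') {i : X.I} {j : Y.I} {k : Y'.I} (s₁ : Ix Γ i j) (s₂ : Ix Γ' j k)
    (s : Ix Γ'' i k) (hs : HEq (s₁.join s₂) s) :
    rowAt (.snoc Θ θ h) s = ⟨.snoc (rowAt Θ s₁).1 _, .snoc (rowAt Θ s₁).2 (θ _ _ s₂)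
      ((s₁.eval_join s₂).symm.trans (Ix.eval_eq_of_heq h hs))⟩ := by
  subst h
  cases hs
  have e := s₁.split_join s₂
  have key : ∀ (r : Σ j, Ix Γ i j × Ix Γ' j k) (hr : r.2.1.eval.append r.2.2.eval =
      (s₁.join s₂).eval) (_ : r = ⟨j, s₁, s₂⟩),
      (⟨.snoc (rowAt Θ r.2.1).1 _, .snoc (rowAt Θ r.2.1).2 (θ _ _ r.2.2) hr⟩ :
        Σ t : Ix (Δ.snoc δ) (VHom.idx f i) (VHom.idx f'' k),
          A.Row (s₁.join s₂).eval (VHom.map f i) (VHom.map f'' k) t.eval) =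
      ⟨.snoc (rowAt Θ s₁).1 _, .snoc (rowAt Θ s₁).2 (θ _ _ s₂) (s₁.eval_join s₂).symm⟩ := by
    rintro r hr rfl
    rfl
  exact key _ (Ix.eval_split _ _) e

theorem rowAt_single {X Y Z W : Obj A} {Γ : HPath HHom X Y} {f : X ⟶ Z} {f' : Y ⟶ W}
    {δ : HHom Z W} (θ : (graph A).Cell Γ f f' δ) {i : X.I} {k : Y.I} (s : Ix Γ i k) :
    rowAt (VDGraph.Row.single θ) s = ⟨.snoc (.nil _) _, .single (θ i k s)⟩ :=
  rowAt_snoc (Γ := .nil) (Δ := .nil) (VDGraph.Row.nil (G := graph A) f) θ Γ.nil_append (.nil i) s s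
    s.nil_join_heq

theorem rowAt_append {X Y Z W : (graph A).Obj} {Γ : HPath (graph A).HHom X Y}
    {f : X ⟶ Z} {f' : Y ⟶ W} {Δ : HPath (graph A).HHom Z W} (Θ : (graph A).Row Γ f f' Δ) :
    ∀ {Y' W' : (graph A).Obj} {Γ' : HPath (graph A).HHom Y Y'} {f'' : Y' ⟶ W'}
    {Δ' : HPath (graph A).HHom W W'} (Ξ : (graph A).Row Γ' f' f'' Δ') {i : Obj.I X} {j : Obj.I Y}
    {k : Obj.I Y'} (s₁ : Ix Γ i j) (s₂ : Ix Γ' j k),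
    (rowAt (Θ.append Ξ) (s₁.join s₂)).1 = (rowAt Θ s₁).1.join (rowAt Ξ s₂).1 ∧
    HEq (rowAt (Θ.append Ξ) (s₁.join s₂)).2 ((rowAt Θ s₁).2.append (rowAt Ξ s₂).2)
  | _, _, _, _, _, .nil _, _, _, _, s₁, .nil _ => ⟨rfl, HEq.rfl⟩
  | _, _, _, _, _, .snoc Ξ θ rfl, _, _, _, s₁, s₂ => by
    obtain ⟨l, t₁, t₂, rfl⟩ := Ix.exists_join _ s₂
    obtain ⟨e₁, e₂⟩ := rowAt_append Θ Ξ s₁ t₁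
    have h₁ := rowAt_snoc (Θ.append Ξ) θ (HPath.append_assoc _ _ _) (s₁.join t₁) t₂
      (s₁.join (t₁.join t₂)) (Ix.join_assoc_heq _ _ _)
    have h₂ := rowAt_snoc Ξ θ rfl t₁ t₂ _ HEq.rfl
    have h₁' : rowAt (Θ.append (Ξ.snoc θ rfl)) (s₁.join (t₁.join t₂)) = _ := h₁
    rw [h₁', h₂]
    refine ⟨congrArg (fun t => Ix.snoc t _) e₁, ?_⟩
    exact VDGraph.Row.snoc_heq _ _ (Ix.eval_join _ _) rfl
      ((congrArg Ix.eval e₁).trans (Ix.eval_join _ _)) e₂ HEq.rfl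

theorem castSides_at {X Y Z W : (graph A).Obj} {Γ : HPath (graph A).HHom X Y} {u : X ⟶ Z}
    {u' : Y ⟶ W} {δ : (graph A).HHom Z W} (θ : (graph A).Cell Γ u u' δ)
    {m : ∀ i, X.fam i ⟶ Z.fam (VHom.idx u i)} {m' : ∀ i, Y.fam i ⟶ W.fam (VHom.idx u' i)}
    (h : u = VHom.mk (VHom.idx u) m) (h' : u' = VHom.mk (VHom.idx u') m')
    {i : X.I} {k : Y.I} (s : Ix Γ i k) :
    (graph A).castSides (v := VHom.mk (VHom.idx u) m) (v' := VHom.mk (VHom.idx u') m') h h' θ i k s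
      = A.castSides (congrFun (eq_of_heq (VHom.mk.inj h).2) i)
          (congrFun (eq_of_heq (VHom.mk.inj h').2) k) (θ i k s) := by
  obtain ⟨x, y⟩ := u
  obtain ⟨x', y'⟩ := u'
  obtain rfl : y = m := eq_of_heq (VHom.mk.inj h).2
  obtain rfl : y' = m' := eq_of_heq (VHom.mk.inj h').2
  rfl

/-- Identity cells and composition of matrices of multicells are formed entrywise. -/
abbrev ops (A : VDC.{u + 1}) : VDOps.{u + 1} where
  toVDGraph := graph A
  idc Γ := fun _ _ s => match s with
    | .snoc (.nil i) k => A.idc (Γ i k)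
  comp {_ _ _ _ _ _ Γ u u' _ v v' Λ} κ Θ _ _ hw hw' :=
    (graph A).castSides hw hw' (fun i k (s : Ix Γ i k) =>
      (A.comp (κ _ _ (rowAt Θ s).1) (rowAt Θ s).2 rfl rfl :
        A.Cell s.eval (VHom.map (u ≫ v) i) (VHom.map (u' ≫ v') k)
          (Λ (VHom.idx (u ≫ v) i) (VHom.idx (u' ≫ v') k))))

theorem comp_at {X Y Z W E F : (graph A).Obj} {Γ : HPath (graph A).HHom X Y} {u : X ⟶ Z}
    {u' : Y ⟶ W} {Δ : HPath (graph A).HHom Z W} {v : Z ⟶ E} {v' : W ⟶ F} {Λ : (graph A).HHom E F}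
    (κ : (graph A).Cell Δ v v' Λ) (Θ : (graph A).Row Γ u u' Δ)
    {m : ∀ i, X.fam i ⟶ E.fam (VHom.idx (u ≫ v) i)}
    {m' : ∀ i, Y.fam i ⟶ F.fam (VHom.idx (u' ≫ v') i)}
    (h : u ≫ v = VHom.mk (VHom.idx (u ≫ v)) m) (h' : u' ≫ v' = VHom.mk (VHom.idx (u' ≫ v')) m')
    {i : X.I} {k : Y.I} (s : Ix Γ i k) :
    (ops A).comp κ Θ (w := VHom.mk (VHom.idx (u ≫ v)) m) (w' := VHom.mk (VHom.idx (u' ≫ v')) m')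
        h h' i k s
      = A.comp (κ _ _ (rowAt Θ s).1) (rowAt Θ s).2 (congrFun (eq_of_heq (VHom.mk.inj h).2) i)
          (congrFun (eq_of_heq (VHom.mk.inj h').2) k) := by
  refine (castSides_at _ h h' s).trans ?_
  exact A.castSides_comp _ _ _ _ _ _

theorem rowAt_idRow : ∀ {X Y : (graph A).Obj} {Δ : HPath (graph A).HHom X Y} {i : X.I} {k : Y.I}
    (s : Ix Δ i k), rowAt ((ops A).idRow Δ) s = ⟨s, A.idRow s.eval⟩
  | _, _, _, _, _, .nil _ => rfl
  | _, _, _, _, _, .snoc (g := g) (j := j) s k => by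
    have h := rowAt_snoc ((ops A).idRow _) ((ops A).idc g) rfl s (.snoc (.nil j) k) (.snoc s k)
      HEq.rfl
    rw [rowAt_idRow s] at h
    exact h

theorem tower_at : ∀ {X Y Z W E F : (graph A).Obj} {Γ : HPath (graph A).HHom X Y} {a : X ⟶ Z}
    {a' : Y ⟶ W} {Δ : HPath (graph A).HHom Z W} {b : Z ⟶ E} {b' : W ⟶ F}
    {Λ : HPath (graph A).HHom E F} (T : (graph A).Tower Γ a a' Δ b b' Λ) {i : X.I} {k : Y.I}
    (s : Ix Γ i k), ∃ (t : Ix Δ (VHom.idx a i) (VHom.idx a' k))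
      (r : Ix Λ (VHom.idx b (VHom.idx a i)) (VHom.idx b' (VHom.idx a' k)))
      (T' : A.Tower s.eval (VHom.map a i) (VHom.map a' k) t.eval (VHom.map b _) (VHom.map b' _)
        r.eval),
      rowAt T.upper s = ⟨t, T'.upper⟩ ∧ rowAt T.lower t = ⟨r, T'.lower⟩ ∧
        rowAt ((ops A).compRow T) s = ⟨r, A.compRow T'⟩
  | _, _, _, _, _, _, _, _, _, _, _, _, _, .nil a b, _, _, .nil i =>
    ⟨.nil _, .nil _, .nil _ _, rfl, rfl, rfl⟩
  | _, _, _, _, _, _, _, _, _, _, _, _, _, .snoc T Ξ θ rfl rfl, _, _, s => by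
    obtain ⟨l, s₁, s₂, rfl⟩ := Ix.exists_join _ s
    obtain ⟨t, r, T', e₁, e₂, e₃⟩ := tower_at T s₁
    refine ⟨t.join (rowAt Ξ s₂).1, .snoc r _, .snoc T' (rowAt Ξ s₂).2 (θ _ _ (rowAt Ξ s₂).1)
      (Ix.eval_join _ _).symm (Ix.eval_join _ _).symm, ?_, ?_, ?_⟩
    · obtain ⟨h₁, h₂⟩ := rowAt_append T.upper Ξ s₁ s₂
      rw [e₁] at h₁ h₂
      exact Sigma.ext h₁ (h₂.trans (VDGraph.Tower.upper_snoc_heq _ _ _ _ _).symm)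
    · have h := rowAt_snoc T.lower θ rfl t (rowAt Ξ s₂).1 _ HEq.rfl
      rw [e₂] at h
      exact h
    · have h := rowAt_snoc ((ops A).compRow T) ((ops A).comp θ Ξ rfl rfl) rfl s₁ s₂ _ HEq.rfl
      rw [e₃] at h
      exact h

end VDMat

/-- The virtual double category of matrices in `A`. -/
def VDC.matrices (A : VDC.{u + 1}) : VDC.{u + 1} where
  toVDOps := VDMat.ops A
  id_comp {X Y Z W Γ u u' δ} θ := by
    funext i k s
    refine (VDMat.comp_at _ _ (Category.comp_id u) (Category.comp_id u') s).trans ?_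
    rw [VDMat.rowAt_single]
    exact A.id_comp (θ i k s)
  comp_id {X Y Z W Δ v v' Λ} κ := by
    funext i k s
    refine (VDMat.comp_at _ _ (Category.id_comp v) (Category.id_comp v') s).trans ?_
    rw [VDMat.rowAt_idRow]
    exact A.comp_id (κ i k s)
  assoc {_ _ _ _ _ _ _ _ Γ a a' Δ b b' Λ c c' l} κ T := by
    funext i k s
    refine Eq.trans ?_ (VDMat.comp_at κ _ (Category.assoc a b c) (Category.assoc a' b' c') s).symm
    obtain ⟨t, r, T', e₁, e₂, e₃⟩ := VDMat.tower_at T s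
    rw [e₃]
    change A.comp (A.comp (κ _ _ (VDMat.rowAt T.lower (VDMat.rowAt T.upper s).1).1) _ rfl rfl) _ rfl rfl = _
    rw [e₁, e₂]
    exact A.assoc _ T'

namespace VDMat

variable {A B C : VDC.{u + 1}}

theorem Ix.eq_of_nil {X : Obj A} {i j : X.I} (s : Ix (HPath.nil (a := X)) i j) : i = j := by
  cases s
  rfl

theorem Ix.nil_eq {X : Obj A} {i : X.I} (s : Ix (HPath.nil (a := X)) i i) : s = .nil i := by
  cases s
  rfl

theorem Ix.single_eq {X Y : Obj A} {g : HHom X Y} {i : X.I} {j : Y.I}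
    (s : Ix (HPath.single g) i j) : s = .snoc (.nil i) j := by
  match s with
  | .snoc (.nil i) j => rfl

theorem Ix.snoc_unsnoc {X Y Z : Obj A} {Γ : HPath (HHom (A := A)) X Y} {g : HHom Y Z} {i : X.I}
    {k : Z.I} (s : Ix (Γ.snoc g) i k) : Ix.snoc s.unsnoc.2 k = s := by
  cases s
  rfl

/-- The action of `Mat` on vertical categories. -/
abbrev mapVert (F : VDFunctor A B) : Obj A ⥤ Obj B where
  obj X := ⟨X.I, fun i => F.vert.obj (X.fam i)⟩
  map f := ⟨f.idx, fun i => F.vert.map (f.map i)⟩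
  map_id _ := congrArg (VHom.mk _) (funext fun _ => F.vert.map_id _)
  map_comp _ _ := congrArg (VHom.mk _) (funext fun _ => F.vert.map_comp _ _)

/-- The action of `Mat` on horizontal morphisms. -/
abbrev mapHor (F : VDFunctor A B) (X Y : Obj A) (Γ : HHom X Y) :
    HHom ((mapVert F).obj X) ((mapVert F).obj Y) := fun i j => F.mapH (Γ i j)

/-- The action of `Mat` on sequences of matrices. -/
abbrev mapPath (F : VDFunctor A B) {X Y : Obj A} (Γ : HPath HHom X Y) :
    HPath HHom ((mapVert F).obj X) ((mapVert F).obj Y) := Γ.map (mapVert F).obj (mapHor F)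

/-- A sequence of indices for `Γ₁, …, Γₙ` is the same thing as one for `F Γ₁, …, F Γₙ`. -/
def mapIx (F : VDFunctor A B) {X Y : Obj A} {Γ : HPath (HHom (A := A)) X Y} {i : X.I} {j : Y.I} :
    Ix Γ i j → Ix (mapPath F Γ) (X := (mapVert F).obj X) (Y := (mapVert F).obj Y) i j
  | .nil i => .nil (X := (mapVert F).obj _) i
  | .snoc s k => .snoc (Z := (mapVert F).obj _) (mapIx F s) k

/-- The inverse of `mapIx`. -/
def unmapIx (F : VDFunctor A B) {X : Obj A} : ∀ {Y : Obj A} (Γ : HPath (HHom (A := A)) X Y) {i : X.I}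
    {j : Y.I}, Ix (mapPath F Γ) (X := (mapVert F).obj X) (Y := (mapVert F).obj Y) i j → Ix Γ i j
  | _, .nil, i, _, s => Ix.eq_of_nil (X := (mapVert F).obj X) s ▸ .nil i
  | _, .snoc Γ _, _, k, s => .snoc (unmapIx F Γ (Ix.unsnoc (Γ := mapPath F Γ) s).2) k

theorem unmapIx_mapIx (F : VDFunctor A B) {X Y : Obj A} {Γ : HPath (HHom (A := A)) X Y} {i : X.I}
    {j : Y.I} (s : Ix Γ i j) : unmapIx F Γ (mapIx F s) = s := by
  induction s with
  | nil => rfl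
  | snoc s k ih => exact congrArg (fun t => Ix.snoc t k) ih

theorem mapIx_unmapIx (F : VDFunctor A B) {X : Obj A} : ∀ {Y : Obj A} (Γ : HPath (HHom (A := A)) X Y)
    {i : X.I} {j : Y.I} (s : Ix (mapPath F Γ) (X := (mapVert F).obj X) (Y := (mapVert F).obj Y) i j),
    mapIx F (unmapIx F Γ s) = s
  | _, .nil, i, j, s => by
    obtain rfl : i = j := Ix.eq_of_nil (X := (mapVert F).obj X) s
    exact (Ix.nil_eq (X := (mapVert F).obj X) s).symm
  | _, .snoc (c := Z) Γ _, _, k, s =>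
    (congrArg (fun t => Ix.snoc (Z := (mapVert F).obj Z) t k) (mapIx_unmapIx F Γ _)).trans
      (Ix.snoc_unsnoc (Γ := mapPath F Γ) (Z := (mapVert F).obj Z) s)

theorem eval_mapIx (F : VDFunctor A B) {X Y : Obj A} {Γ : HPath (HHom (A := A)) X Y} {i : X.I}
    {j : Y.I} (s : Ix Γ i j) : (mapIx F s).eval = F.mapPath s.eval := by
  induction s with
  | nil => rfl
  | snoc s k ih => exact congrArg (fun p => HPath.snoc p _) ih

theorem eval_unmapIx (F : VDFunctor A B) {X Y : Obj A} (Γ : HPath (HHom (A := A)) X Y) {i : X.I}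
    {j : Y.I} (s : Ix (mapPath F Γ) (X := (mapVert F).obj X) (Y := (mapVert F).obj Y) i j) :
    F.mapPath (unmapIx F Γ s).eval = s.eval := by
  rw [← eval_mapIx, mapIx_unmapIx]

theorem mapIx_join_heq (F : VDFunctor A B) {X Y Z : Obj A} {Γ : HPath (HHom (A := A)) X Y} {i : X.I}
    {j : Y.I} (s : Ix Γ i j) {Γ' : HPath (HHom (A := A)) Y Z} {k : Z.I} (t : Ix Γ' j k) :
    HEq ((mapIx F s).join (mapIx F t)) (mapIx F (s.join t)) := by
  induction t with
  | nil => rfl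
  | snoc t k ih => exact Ix.snoc_heq (Z := (mapVert F).obj _) (HPath.map_append _ _ _ _).symm (ih s) k

/-- The action of `Mat F` on the underlying data: `F` is applied entrywise. -/
abbrev mapMap (F : VDFunctor A B) : VDMap (graph A) (graph B) where
  vert := mapVert F
  mapH {X Y} Γ := mapHor F X Y Γ
  mapCell {_ _ _ _ Γ _ _ _} θ := fun i j s =>
    B.castTop (eval_unmapIx F Γ s) (F.mapCell (θ i j (unmapIx F Γ s)))

theorem mapCell_at_heq (F : VDFunctor A B) {X Y Z W : (graph A).Obj}
    {Γ : HPath (graph A).HHom X Y} {f : X ⟶ Z} {f' : Y ⟶ W} {Δ : (graph A).HHom Z W}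
    (θ : (graph A).Cell Γ f f' Δ) {i : X.I} {j : Y.I} (s : Ix Γ i j)
    {s' : Ix (mapPath F Γ) (X := (mapVert F).obj X) (Y := (mapVert F).obj Y) i j}
    (h : s' = mapIx F s) :
    HEq ((mapMap F).mapCell θ i j s') (F.mapCell (θ i j s)) := by
  subst h
  refine (VDGraph.castTop_heq _ _).trans ?_
  rw [unmapIx_mapIx]

theorem rowAt_mapRow (F : VDFunctor A B) : ∀ {X Y Z W : (graph A).Obj}
    {Γ : HPath (graph A).HHom X Y} {f : X ⟶ Z} {f' : Y ⟶ W} {Δ : HPath (graph A).HHom Z W}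
    (Θ : (graph A).Row Γ f f' Δ) {i : X.I} {j : Y.I} (s : Ix Γ i j),
    (rowAt ((mapMap F).mapRow Θ) (mapIx F s)).1 = mapIx F (rowAt Θ s).1 ∧
    HEq (rowAt ((mapMap F).mapRow Θ) (mapIx F s)).2 (F.mapRow (rowAt Θ s).2)
  | _, _, _, _, _, _, _, _, .nil _, _, _, .nil _ => ⟨rfl, HEq.rfl⟩
  | _, _, _, _, _, _, _, _, .snoc Θ θ rfl, _, _, s => by
    obtain ⟨l, s₁, s₂, rfl⟩ := Ix.exists_join _ s
    obtain ⟨e₁, e₂⟩ := rowAt_mapRow F Θ s₁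
    have h₁ := rowAt_snoc ((mapMap F).mapRow Θ) ((mapMap F).mapCell θ)
      (HPath.map_append _ _ _ _).symm (mapIx F s₁) (mapIx F s₂) _ (mapIx_join_heq F s₁ s₂)
    have h₂ := rowAt_snoc Θ θ rfl s₁ s₂ _ HEq.rfl
    have h₁' : rowAt ((mapMap F).mapRow (Θ.snoc θ rfl)) (mapIx F (s₁.join s₂)) = _ := h₁
    rw [h₁', h₂]
    refine ⟨congrArg (fun t => Ix.snoc t _) e₁, ?_⟩
    exact VDGraph.Row.snoc_heq _ _ (eval_mapIx _ _) (eval_mapIx _ _)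
      ((congrArg Ix.eval e₁).trans (eval_mapIx F (rowAt Θ s₁).1)) e₂ (mapCell_at_heq F θ s₂ rfl)

/-- The virtual double functor `Mat F`. -/
def map (F : VDFunctor A B) : VDFunctor A.matrices B.matrices where
  toVDMap := mapMap F
  map_idc {X Y} Γ := by
    funext i k s
    refine (castSides_at _ ((mapVert F).map_id X) ((mapVert F).map_id Y) s).trans ?_
    obtain rfl := Ix.single_eq (X := (mapVert F).obj X) (Y := (mapVert F).obj Y) s
    exact F.map_idc (Γ i k)
  map_comp {_ _ _ _ _ _ Γ u u' Δ v v' Λ} κ Θ := by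
    funext i k s
    refine Eq.trans ?_ (comp_at ((mapMap F).mapCell κ) _ ((mapVert F).map_comp u v).symm
      ((mapVert F).map_comp u' v').symm s).symm
    obtain ⟨s, rfl⟩ : ∃ s', mapIx F s' = s := ⟨_, mapIx_unmapIx F Γ s⟩
    apply eq_of_heq
    refine (mapCell_at_heq F _ s rfl).trans ?_
    obtain ⟨e₁, e₂⟩ := rowAt_mapRow F Θ s
    refine (heq_of_eq (F.map_comp (κ _ _ (rowAt Θ s).1) (rowAt Θ s).2)).trans ?_
    exact B.comp_heq _ _ (eval_mapIx F s).symm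
      ((congrArg Ix.eval e₁).trans (eval_mapIx F (rowAt Θ s).1)).symm
      (mapCell_at_heq F κ _ e₁).symm e₂.symm

end VDMat

theorem VertTrans.eq_eqToHom_comp_comp {A B : VDC.{w}} {F G : VDMap A.toVDGraph B.toVDGraph}
    {m : ∀ {X Y Z W : A.Obj} {Γ : HPath A.HHom X Y} {u : X ⟶ Z} {u' : Y ⟶ W} {Δ : A.HHom Z W},
      A.Cell Γ u u' Δ → B.Cell (F.mapPath Γ) (F.vert.map u) (F.vert.map u') (F.mapH Δ)}
    {n : ∀ {X Y Z W : A.Obj} {Γ : HPath A.HHom X Y} {u : X ⟶ Z} {u' : Y ⟶ W} {Δ : A.HHom Z W},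
      A.Cell Γ u u' Δ → B.Cell (G.mapPath Γ) (G.vert.map u) (G.vert.map u') (G.mapH Δ)}
    {h₁ h₂ h₃ h₄ k₁ k₂ k₃ k₄}
    (h : (⟨F, h₁, h₂⟩ : VDFunctor A B) = ⟨⟨F.vert, F.mapH, m⟩, h₃, h₄⟩)
    (k : (⟨G, k₁, k₂⟩ : VDFunctor A B) = ⟨⟨G.vert, G.mapH, n⟩, k₃, k₄⟩)
    (α : VertTrans (⟨⟨F.vert, F.mapH, m⟩, h₃, h₄⟩ : VDFunctor A B) ⟨G, k₁, k₂⟩)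
    (β : VertTrans (⟨F, h₁, h₂⟩ : VDFunctor A B) ⟨⟨G.vert, G.mapH, n⟩, k₃, k₄⟩)
    (hv : ∀ X, β.vert.app X = α.vert.app X)
    (hc : ∀ {X Y : A.Obj} (Γ : A.HHom X Y), HEq (β.cell Γ) (α.cell Γ)) :
    β = eqToHom h ≫ (α : _ ⟶ _) ≫ eqToHom k := by
  rw [← ofEq_eq h, ← ofEq_eq k]
  exact VertTrans.ext_heq
    (fun X => (hv X).trans ((Category.id_comp _).trans (Category.comp_id _)).symm)
    (fun Γ => (hc Γ).trans ((VertTrans.comp_id_heq _ _ _).trans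
      (VertTrans.id_comp_heq (α.cell Γ) _ _)).symm)

namespace VDMat

variable {A B C : VDC.{u + 1}}

theorem castTop_at_heq {X Y Z W : (graph A).Obj} {Γ Γ' : HPath (graph A).HHom X Y} {f : X ⟶ Z}
    {f' : Y ⟶ W} {Δ : (graph A).HHom Z W} (h : Γ = Γ') (θ : (graph A).Cell Γ f f' Δ) {i : X.I}
    {j : Y.I} {s : Ix Γ' i j} {s' : Ix Γ i j} (hs : HEq s s') :
    HEq ((graph A).castTop h θ i j s) (θ i j s') := by
  subst h
  cases hs
  rfl

theorem comp_single_at {X Y Z W E F : (graph A).Obj} {Γ : HPath (graph A).HHom X Y} {u : X ⟶ Z}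
    {u' : Y ⟶ W} {δ : (graph A).HHom Z W} {v : Z ⟶ E} {v' : W ⟶ F} {Λ : (graph A).HHom E F}
    (κ : (graph A).Cell (HPath.single δ) v v' Λ) (θ : (graph A).Cell Γ u u' δ) {i : X.I} {k : Y.I}
    (s : Ix Γ i k) :
    (ops A).comp κ (VDGraph.Row.single θ) rfl rfl i k s =
      A.comp (κ _ _ (.snoc (.nil _) _)) (VDGraph.Row.single (θ i k s)) rfl rfl := by
  change A.comp (κ _ _ (rowAt (VDGraph.Row.single _) _).1) _ rfl rfl = _
  rw [rowAt_single]

theorem mapIx_id_heq {X Y : Obj A} {Γ : HPath (HHom (A := A)) X Y} {i : X.I} {j : Y.I}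
    (s : Ix Γ i j) : HEq (mapIx (VDFunctor.id A) s) s := by
  induction s with
  | nil => rfl
  | snoc s k ih => exact Ix.snoc_heq (HPath.map_id _) ih k

theorem mapIx_comp_heq (F : VDFunctor A B) (G : VDFunctor B C) {X Y : Obj A}
    {Γ : HPath (HHom (A := A)) X Y} {i : X.I} {j : Y.I} (s : Ix Γ i j) :
    HEq (mapIx (F.comp G) s) (mapIx G (mapIx F s)) := by
  induction s with
  | nil => rfl
  | snoc s k ih =>
    exact Ix.snoc_heq (Z := (mapVert G).obj ((mapVert F).obj _)) 
      (VDMap.comp_mapPath (mapMap F) (mapMap G) _) ih k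

theorem map_id (A : VDC.{u + 1}) : map (VDFunctor.id A) = VDFunctor.id A.matrices :=
  VDFunctor.ext_cell fun {X Y _ _ Γ _ _ _} θ => by
    funext i j s
    obtain ⟨s, rfl⟩ : ∃ s', mapIx (VDFunctor.id A) s' = s := ⟨_, mapIx_unmapIx _ Γ s⟩
    apply eq_of_heq
    refine (mapCell_at_heq (VDFunctor.id A) θ s rfl).trans ?_
    refine (VDMap.id_mapCell_heq _).trans ?_
    exact (castTop_at_heq _ θ (mapIx_id_heq s)).symm

theorem map_comp (F : VDFunctor A B) (G : VDFunctor B C) :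
    map (F.comp G) = (map F).comp (map G) :=
  VDFunctor.ext_cell fun {X Y _ _ Γ _ _ _} θ => by
    funext i j s
    obtain ⟨s, rfl⟩ : ∃ s', mapIx (F.comp G) s' = s := ⟨_, mapIx_unmapIx _ Γ s⟩
    apply eq_of_heq
    refine (mapCell_at_heq (F.comp G) θ s rfl).trans ?_
    refine (VDMap.comp_mapCell_heq _ _ _).trans ?_
    refine HEq.trans ?_ (castTop_at_heq _ _ (mapIx_comp_heq F G s)).symm
    refine HEq.trans ?_ (mapCell_at_heq G ((mapMap F).mapCell θ) (mapIx F s) rfl).symm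
    exact (G.mapCell_heq (eval_mapIx F s) (mapCell_at_heq F θ s rfl)).symm

/-- A multicell with a single matrix on top is given by a matrix of multicells. -/
def ofEntries {X Y Z W : (graph A).Obj} {g : (graph A).HHom X Y} {f : X ⟶ Z} {f' : Y ⟶ W}
    {δ : (graph A).HHom Z W} (c : ∀ (i : X.I) (j : Y.I), A.Cell (HPath.single (g i j))
      (VHom.map f i) (VHom.map f' j) (δ (VHom.idx f i) (VHom.idx f' j))) :
    (graph A).Cell (HPath.single g) f f' δ := fun _ _ s => match s with
  | .snoc (.nil i) k => c i k

variable {F G H : VDFunctor A B}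

/-- The natural transformation underlying `Mat α`. -/
abbrev mapTrans (α : VertTrans F G) : mapVert F ⟶ mapVert G where
  app X := VHom.mk (fun i => i) (fun i => α.vert.app (X.fam i))
  naturality _ _ f := congrArg (VHom.mk _) (funext fun i => α.vert.naturality (f.map i))

/-- The cells of `Mat α`. -/
abbrev transCell (α : VertTrans F G) (X Y : (graph A).Obj) (Γ : (graph A).HHom X Y) :
    (graph B).Cell (HPath.single ((mapMap F).mapH Γ)) ((mapTrans α).app X) ((mapTrans α).app Y)
      ((mapMap G).mapH Γ) := ofEntries fun i j => α.cell (Γ i j)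

theorem rowAt_transRow (α : VertTrans F G) {X Y : (graph A).Obj} {Γ : HPath (graph A).HHom X Y}
    {i : X.I} {j : Y.I} (s : Ix Γ i j) :
    (rowAt (VDMap.transRow (F := mapMap F) (G := mapMap G) (mapTrans α) (transCell α) Γ)
      (mapIx F s)).1 = mapIx G s ∧
    HEq (rowAt (VDMap.transRow (F := mapMap F) (G := mapMap G) (mapTrans α) (transCell α) Γ)
      (mapIx F s)).2 (α.row s.eval) := by
  induction s with
  | nil => exact ⟨rfl, HEq.rfl⟩
  | @snoc _ _ _ g _ _ s k ih =>
    obtain ⟨e₁, e₂⟩ := ih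
    have h := rowAt_snoc (VDMap.transRow (F := mapMap F) (G := mapMap G) (mapTrans α) (transCell α) _)
      (transCell α _ _ g) rfl (mapIx F s) (.snoc (Z := (mapVert F).obj _) (.nil _) k)
      (mapIx F (.snoc (g := g) s k)) HEq.rfl
    have h' : rowAt (VDMap.transRow (F := mapMap F) (G := mapMap G) (mapTrans α) (transCell α) _)
      (mapIx F (.snoc (g := g) s k)) = _ := h
    rw [h']
    refine ⟨congrArg (fun t => Ix.snoc t _) e₁, ?_⟩
    exact VDGraph.Row.snoc_heq _ _ (eval_mapIx F s) rfl
      ((congrArg Ix.eval e₁).trans (eval_mapIx G s)) e₂ HEq.rfl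

/-- The vertical transformation `Mat α`. -/
def map₂ (α : VertTrans F G) : VertTrans (map F) (map G) where
  vert := mapTrans α
  cell {X Y} Γ := transCell α X Y Γ
  naturality {X Y Z W Γ u u' Δ} θ := by
    funext i k s
    refine Eq.trans ?_ (comp_at ((mapMap G).mapCell θ) _ ((mapTrans α).naturality u).symm
      ((mapTrans α).naturality u').symm s).symm
    obtain ⟨s, rfl⟩ : ∃ s', mapIx F s' = s := ⟨_, mapIx_unmapIx F Γ s⟩
    refine (comp_single_at (transCell α _ _ Δ) ((mapMap F).mapCell θ) _).trans ?_
    apply eq_of_heq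
    obtain ⟨e₁, e₂⟩ := rowAt_transRow α s
    refine HEq.trans ?_ ((heq_of_eq (α.naturality (θ i k s))).trans ?_)
    · exact B.comp_heq _ _ (eval_mapIx F s) rfl HEq.rfl
        (VDGraph.Row.snoc_heq _ _ rfl (eval_mapIx F s) rfl HEq.rfl (mapCell_at_heq F θ s rfl))
    · exact B.comp_heq _ _ (eval_mapIx F s).symm
        ((congrArg Ix.eval e₁).trans (eval_mapIx G s)).symm
        (mapCell_at_heq G θ s e₁).symm e₂.symm

theorem map₂_id (F : VDFunctor A B) : map₂ (VertTrans.id F) = VertTrans.id (map F) :=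
  VertTrans.ext_heq (fun _ => rfl) fun {X Y} Γ => heq_of_eq <| by
    funext i j s
    obtain rfl := Ix.single_eq (X := (mapVert F).obj X) (Y := (mapVert F).obj Y) s
    rfl

theorem map₂_comp (α : VertTrans F G) (β : VertTrans G H) :
    map₂ (α.comp β) = (map₂ α).comp (map₂ β) :=
  VertTrans.ext_heq (fun _ => rfl) fun {X Y} Γ => heq_of_eq <| by
    funext i j s
    refine Eq.trans ?_ (comp_single_at (transCell β _ _ Γ) (transCell α _ _ Γ) s).symm
    obtain rfl := Ix.single_eq (X := (mapVert F).obj X) (Y := (mapVert F).obj Y) s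
    rfl

end VDMat

/-- The 2-functor `Mat` from the 2-category of large virtual double categories to itself, sending
`A` to the virtual double category of matrices in `A`. -/
def VDC.Mat : StrictPseudofunctor VDC.{u + 1} VDC.{u + 1} := .mk''
  { obj A := A.matrices
    map F := VDMat.map F
    map₂ α := VDMat.map₂ α
    map_id A := VDMat.map_id A
    map_comp F G := VDMat.map_comp F G
    map₂_id F := VDMat.map₂_id F
    map₂_comp α β := VDMat.map₂_comp α β
    map₂_whisker_left F G H α := VertTrans.eq_eqToHom_comp_comp (VDMat.map_comp F G)
      (G := ((VDMat.map F).comp (VDMat.map H)).toVDMap) (VDMat.map_comp F H).symm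
      (VertTrans.whiskerLeft (VDMat.map F) (VDMat.map₂ α)) (VDMat.map₂ (VertTrans.whiskerLeft F α))
      (fun _ => rfl) (fun _ => HEq.rfl)
    map₂_whisker_right {_ _ _ F G} α H := VertTrans.eq_eqToHom_comp_comp (VDMat.map_comp F H)
      (G := ((VDMat.map G).comp (VDMat.map H)).toVDMap) (VDMat.map_comp G H).symm
      (VertTrans.whiskerRight (VDMat.map₂ α) (VDMat.map H)) (VDMat.map₂ (VertTrans.whiskerRight α H))
      (fun _ => rfl) (fun {X Y} Γ => heq_of_eq <| by
        funext i j s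
        obtain rfl := VDMat.Ix.single_eq (X := (VDMat.mapVert H).obj ((VDMat.mapVert F).obj X))
          (Y := (VDMat.mapVert H).obj ((VDMat.mapVert F).obj Y)) s
        rfl) }

/-! Everything rests on a universal property of matrices over `Set_hc`. For a virtual double functor
`b` from `X` to `Set_hc`, the pullback of `b` along `P_hc` is `elements b`: its objects are pairs of
an object `x` and an element `i` of the set `b x`, and its horizontal morphisms and multicells are
those of `X` between the underlying objects. A virtual double functor from `elements b` to `A`
therefore assigns to `x` a family of objects indexed by `b x`, to a horizontal morphism a matrix,
and to a multicell one multicell of `A` for each sequence of indices of its top boundary. This is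
the same as a virtual double functor from `X` to `Mat A` lying over `b`. Hence the domain of
`P_hc^*` is left 2-adjoint to `MatOver`, with unit `fibre` (an object goes to the family of its
elements) and counit `eval` (a family with a chosen index goes to its entry there); this is
`matAdjunction`.

Polynomial: the domain 2-functor of the slice over `(Set_*)_hc` is left 2-adjoint to the product
with `(Set_*)_hc`. So if `P_hc^*` has a right 2-adjoint, its composite with that product is a right
2-adjoint of the same 2-functor as `MatOver`, and right 2-adjoints are unique up to 2-natural
isomorphism. The dependent product itself comes out of the same adjunction: its value at `q` is the
pullback of the image of `q` under `MatOver` along the 1-cell that names the projection of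
`P_hc^*(1)` (`exists_isCouniversal_pullback`). This pullback exists because both virtual double
categories mapped along that 1-cell are chaotic, so that only their vertical categories matter
(`exists_isTwoPullback`).

Familial: the comparison from `Mat 1` to `Set_hc` is cancellable on 1-cells and 2-cells, so the
adjunction restricts from `Set_hc` to `Mat 1` (`cancelSigma`). The chosen lifts are the
transformations all of whose entries are identities (`IsReindexing`). They are cartesian because
identities can be cancelled entrywise, and a comparison between two lifts of the same 2-cell is an
identity in its indices and in its entries. They exist because, by the adjunction, every virtual
double functor to `Mat A` is the image under some `Mat h` of a universal family `fibre b`, where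
reindexing along a natural map of sets is explicit.

That `P_hc` is a discrete opfibration only expresses that a base point has a unique image. -/

namespace TwoCat

open Bicategory

universe w₁ v₁ u₁ w₂ v₂ u₂ w₃ v₃ u₃

/-! ### Heterogeneous equality of 2-cells in strict 2-categories. -/

section HEqCalculus

variable {K : Type u₁} [Bicategory.{w₁, v₁} K]

/-- Composites of 1-cells in a strict 2-category often agree only propositionally, so 2-cells
between them have different types. Chains of heterogeneous equalities, built from congruences such
as this one, replace the bookkeeping of `eqToHom`. -/
theorem whiskerLeft_heq {a b c : K} {f f' : a ⟶ b} {g g' h h' : b ⟶ c} {α : g ⟶ h} {α' : g' ⟶ h'}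
    (hf : f = f') (hg : g = g') (hh : h = h') (hα : HEq α α') : HEq (f ◁ α) (f' ◁ α') := by
  subst hf hg hh
  cases hα
  rfl

theorem whiskerRight_heq {a b c : K} {f f' g g' : a ⟶ b} {h h' : b ⟶ c} {α : f ⟶ g} {α' : f' ⟶ g'}
    (hf : f = f') (hg : g = g') (hα : HEq α α') (hh : h = h') : HEq (α ▷ h) (α' ▷ h') := by
  subst hf hg hh
  cases hα
  rfl

theorem comp₂_heq {a b : K} {f f' g g' h h' : a ⟶ b} {α : f ⟶ g} {α' : f' ⟶ g'} {β : g ⟶ h}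
    {β' : g' ⟶ h'} (hf : f = f') (hg : g = g') (hh : h = h') (hα : HEq α α') (hβ : HEq β β') :
    HEq (α ≫ β) (α' ≫ β') := by
  subst hf hg hh
  cases hα
  cases hβ
  rfl

theorem eqToHom_conj_heq {a b : K} {f f' g g' : a ⟶ b} (h : f' = f) (α : f ⟶ g) (h' : g = g') :
    HEq (eqToHom h ≫ α ≫ eqToHom h') α := by
  subst h h'
  simp

theorem eq_eqToHom_conj_of_heq {a b : K} {f f' g g' : a ⟶ b} (h : f' = f) {α : f ⟶ g} (h' : g = g')
    {β : f' ⟶ g'} (hβ : HEq β α) : β = eqToHom h ≫ α ≫ eqToHom h' :=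
  eq_of_heq (hβ.trans (eqToHom_conj_heq h α h').symm)

theorem eqToHom_heq_eqToHom {a b : K} {f f' g g' : a ⟶ b} (hf : f = f') (h : f = g)
    (h' : f' = g') : HEq (eqToHom h) (eqToHom h') := by
  subst hf h h'
  rfl

variable [Strict K]

/-- Strictness makes the associators `eqToHom`s, and conjugation by `eqToHom`s is invisible to
heterogeneous equality. The four lemmas that follow hold for the same reason. -/
theorem comp_whiskerLeft_heq {a b c d : K} (f : a ⟶ b) (g : b ⟶ c) {h h' : c ⟶ d} (η : h ⟶ h') :
    HEq ((f ≫ g) ◁ η) (f ◁ g ◁ η) := by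
  rw [comp_whiskerLeft, Strict.associator_eqToIso, Strict.associator_eqToIso]
  simp only [eqToIso.hom, eqToIso.inv]
  exact eqToHom_conj_heq _ _ _

theorem whiskerRight_comp_heq {a b c d : K} {f f' : a ⟶ b} (η : f ⟶ f') (g : b ⟶ c) (h : c ⟶ d) :
    HEq (η ▷ (g ≫ h)) ((η ▷ g) ▷ h) := by
  rw [whiskerRight_comp, Strict.associator_eqToIso, Strict.associator_eqToIso]
  simp only [eqToIso.hom, eqToIso.inv]
  exact eqToHom_conj_heq _ _ _

theorem whisker_assoc_heq {a b c d : K} (f : a ⟶ b) {g g' : b ⟶ c} (η : g ⟶ g') (h : c ⟶ d) :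
    HEq ((f ◁ η) ▷ h) (f ◁ η ▷ h) := by
  rw [whisker_assoc, Strict.associator_eqToIso, Strict.associator_eqToIso]
  simp only [eqToIso.hom, eqToIso.inv]
  exact eqToHom_conj_heq _ _ _

theorem id_whiskerLeft_heq {a b : K} {f g : a ⟶ b} (η : f ⟶ g) : HEq (𝟙 a ◁ η) η := by
  rw [id_whiskerLeft, Strict.leftUnitor_eqToIso, Strict.leftUnitor_eqToIso]
  simp only [eqToIso.hom, eqToIso.inv]
  exact eqToHom_conj_heq _ _ _

theorem whiskerRight_id_heq {a b : K} {f g : a ⟶ b} (η : f ⟶ g) : HEq (η ▷ 𝟙 b) η := by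
  rw [whiskerRight_id, Strict.rightUnitor_eqToIso, Strict.rightUnitor_eqToIso]
  simp only [eqToIso.hom, eqToIso.inv]
  exact eqToHom_conj_heq _ _ _

end HEqCalculus

/-! ### Strict 2-functors and 2-natural transformations up to heterogeneous equality. -/

section Functors

variable {K : Type u₁} [Bicategory.{w₁, v₁} K] {L : Type u₂} [Bicategory.{w₂, v₂} L]
  (F : StrictPseudofunctor K L)

theorem map₂_heq {a b : K} {f f' g g' : a ⟶ b} {α : f ⟶ g} {α' : f' ⟶ g'} (hf : f = f')
    (hg : g = g') (hα : HEq α α') : HEq (F.map₂ α) (F.map₂ α') := by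
  subst hf hg
  cases hα
  rfl

theorem map₂_whiskerLeft_heq {a b c : K} (f : a ⟶ b) {g g' : b ⟶ c} (η : g ⟶ g') :
    HEq (F.map₂ (f ◁ η)) (F.map f ◁ F.map₂ η) := by
  rw [F.map₂_whisker_left, F.mapComp_eq_eqToIso, F.mapComp_eq_eqToIso]
  simp only [eqToIso.hom, eqToIso.inv]
  exact eqToHom_conj_heq _ _ _

theorem map₂_whiskerRight_heq {a b c : K} {f f' : a ⟶ b} (η : f ⟶ f') (g : b ⟶ c) :
    HEq (F.map₂ (η ▷ g)) (F.map₂ η ▷ F.map g) := by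
  rw [F.map₂_whisker_right, F.mapComp_eq_eqToIso, F.mapComp_eq_eqToIso]
  simp only [eqToIso.hom, eqToIso.inv]
  exact eqToHom_conj_heq _ _ _

variable {F} {G : StrictPseudofunctor K L}

theorem TwoNatTrans.naturality₂_heq (τ : TwoNatTrans F G) {X Y : K} {f g : X ⟶ Y} (η : f ⟶ g) :
    HEq (F.map₂ η ▷ τ.app Y) (τ.app X ◁ G.map₂ η) := by
  rw [τ.naturality₂]
  exact eqToHom_conj_heq _ _ _

/-- A 2-natural transformation from naturality on 2-cells up to heterogeneous equality. -/
def TwoNatTrans.ofHEq (app : ∀ X : K, F.obj X ⟶ G.obj X)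
    (naturality : ∀ {X Y : K} (f : X ⟶ Y), F.map f ≫ app Y = app X ≫ G.map f)
    (naturality₂ : ∀ {X Y : K} {f g : X ⟶ Y} (η : f ⟶ g),
      HEq (F.map₂ η ▷ app Y) (app X ◁ G.map₂ η)) : TwoNatTrans F G where
  app := app
  naturality := naturality
  naturality₂ η := eq_eqToHom_conj_of_heq _ _ (naturality₂ η)

end Functors

/-! ### 2-adjunctions presented by couniversal arrows. -/

section Couniversal

variable {K : Type u₁} [Bicategory.{w₁, v₁} K] {L : Type u₂} [Bicategory.{w₂, v₂} L]

/-- A couniversal arrow from a 2-functor `F` to an object `Y`. -/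
structure IsCouniversal (F : StrictPseudofunctor K L) {Y : L} (g : K) (ϵ : F.obj g ⟶ Y) : Prop where
  existsUnique : ∀ {X : K} (f : F.obj X ⟶ Y), ∃! h : X ⟶ g, F.map h ≫ ϵ = f
  existsUnique₂ : ∀ {X : K} {h h' : X ⟶ g} (α : F.map h ≫ ϵ ⟶ F.map h' ≫ ϵ),
    ∃! χ : h ⟶ h', F.map₂ χ ▷ ϵ = α

namespace IsCouniversal

variable {F : StrictPseudofunctor K L} {Y : L} {g : K} {ϵ : F.obj g ⟶ Y}

theorem hom_ext (H : IsCouniversal F g ϵ) {X : K} {h h' : X ⟶ g} (e : F.map h ≫ ϵ = F.map h' ≫ ϵ) : h = h' :=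
  (H.existsUnique _).unique e rfl

theorem hom₂_ext (H : IsCouniversal F g ϵ) {X : K} {h h' : X ⟶ g} {χ χ' : h ⟶ h'} (e : F.map₂ χ ▷ ϵ = F.map₂ χ' ▷ ϵ) :
    χ = χ' :=
  (H.existsUnique₂ _).unique e rfl

theorem hom₂_ext_heq (H : IsCouniversal F g ϵ) {X : K} {h h' k k' : X ⟶ g} {χ : h ⟶ h'} {χ' : k ⟶ k'} (e₁ : h = k)
    (e₂ : h' = k') (e : HEq (F.map₂ χ ▷ ϵ) (F.map₂ χ' ▷ ϵ)) : HEq χ χ' := by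
  subst e₁ e₂
  exact heq_of_eq (H.hom₂_ext (eq_of_heq e))

/-- The factorization of a 1-cell through a couniversal arrow. -/
noncomputable def lift (H : IsCouniversal F g ϵ) {X : K} (f : F.obj X ⟶ Y) : X ⟶ g := (H.existsUnique f).exists.choose

theorem lift_fac (H : IsCouniversal F g ϵ) {X : K} (f : F.obj X ⟶ Y) : F.map (H.lift f) ≫ ϵ = f :=
  (H.existsUnique f).exists.choose_spec

theorem existsUnique₂_heq (H : IsCouniversal F g ϵ) {X : K} {h h' : X ⟶ g} {f f' : F.obj X ⟶ Y} (e : F.map h ≫ ϵ = f)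
    (e' : F.map h' ≫ ϵ = f') (α : f ⟶ f') : ∃ χ : h ⟶ h', HEq (F.map₂ χ ▷ ϵ) α := by
  subst e e'
  obtain ⟨χ, hχ, -⟩ := H.existsUnique₂ α
  exact ⟨χ, heq_of_eq hχ⟩

/-- The factorization of a 2-cell through a couniversal arrow. -/
noncomputable def lift₂ (H : IsCouniversal F g ϵ) {X : K} {h h' : X ⟶ g} {f f' : F.obj X ⟶ Y} (e : F.map h ≫ ϵ = f)
    (e' : F.map h' ≫ ϵ = f') (α : f ⟶ f') : h ⟶ h' := (H.existsUnique₂_heq e e' α).choose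

theorem lift₂_fac (H : IsCouniversal F g ϵ) {X : K} {h h' : X ⟶ g} {f f' : F.obj X ⟶ Y} (e : F.map h ≫ ϵ = f)
    (e' : F.map h' ≫ ϵ = f') (α : f ⟶ f') : HEq (F.map₂ (H.lift₂ e e' α) ▷ ϵ) α :=
  (H.existsUnique₂_heq e e' α).choose_spec

end IsCouniversal

/-- A 2-adjunction presented by a couniversal counit. -/
structure CounitAdjunction (F : StrictPseudofunctor K L) (G : StrictPseudofunctor L K) where
  counit : ∀ Y : L, F.obj (G.obj Y) ⟶ Y
  nat : ∀ {X Y : L} (f : X ⟶ Y), F.map (G.map f) ≫ counit Y = counit X ≫ f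
  nat₂ : ∀ {X Y : L} {f g : X ⟶ Y} (η : f ⟶ g),
    HEq (F.map₂ (G.map₂ η) ▷ counit Y) (counit X ◁ η)
  isCouniversal : ∀ Y : L, IsCouniversal F (G.obj Y) (counit Y)

variable [Strict K] [Strict L]

section OfCouniversal

variable (F : StrictPseudofunctor K L) (G : L → K) (ϵ : ∀ Y : L, F.obj (G Y) ⟶ Y)
  (H : ∀ Y : L, IsCouniversal F (G Y) (ϵ Y))

/-- The right 2-adjoint determined by couniversal arrows. -/
noncomputable def rightAdjoint : StrictPseudofunctor L K :=
  have fac : ∀ {X Y : L} (f : X ⟶ Y), F.map ((H Y).lift (ϵ X ≫ f)) ≫ ϵ Y = ϵ X ≫ f :=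
    fun {X Y} f => (H Y).lift_fac (ϵ X ≫ f)
  have fac₂ : ∀ {X Y : L} {f g : X ⟶ Y} (α : f ⟶ g),
      HEq (F.map₂ ((H Y).lift₂ (fac f) (fac g) (ϵ X ◁ α)) ▷ ϵ Y) (ϵ X ◁ α) :=
    fun {X Y f g} α => (H Y).lift₂_fac (fac f) (fac g) (ϵ X ◁ α)
  -- Each law of the 2-functor compares two factorizations through a couniversal arrow, so it is
  -- enough to compare them after applying `F` and composing with `ϵ`.
  have map_id : ∀ X : L, (H X).lift (ϵ X ≫ 𝟙 X) = 𝟙 (G X) := fun X => (H X).hom_ext (by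
    rw [fac, F.map_id, Strict.comp_id, Strict.id_comp])
  have map_comp : ∀ {X Y Z : L} (f : X ⟶ Y) (g : Y ⟶ Z),
      (H Z).lift (ϵ X ≫ f ≫ g) = (H Y).lift (ϵ X ≫ f) ≫ (H Z).lift (ϵ Y ≫ g) :=
    fun f g => (H _).hom_ext (by
      rw [fac, F.map_comp, Strict.assoc, fac g, ← Strict.assoc, ← Strict.assoc, fac f])
  .mk''
  { obj := G
    map {X Y} f := (H Y).lift (ϵ X ≫ f)
    map₂ {X Y f g} α := (H Y).lift₂ (fac f) (fac g) (ϵ X ◁ α)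
    map_id := map_id
    map_comp := map_comp
    map₂_id {X Y} f := (H Y).hom₂_ext (eq_of_heq ((fac₂ (𝟙 f)).trans (by
      rw [whiskerLeft_id, F.map₂_id, id_whiskerRight, fac])))
    map₂_comp {X Y f g h} α β := (H Y).hom₂_ext (eq_of_heq ((fac₂ (α ≫ β)).trans (by
      rw [whiskerLeft_comp, F.map₂_comp, comp_whiskerRight]
      exact (comp₂_heq (fac f) (fac g) (fac h) (fac₂ α) (fac₂ β)).symm)))
    map₂_whisker_left {X Y Z} f g g' η := by
      -- After whiskering with `ϵ Z` both sides become `(ϵ X ≫ f) ◁ η`.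
      refine eq_eqToHom_conj_of_heq _ _ ((H Z).hom₂_ext_heq (map_comp _ _) (map_comp _ _) ?_)
      refine (fac₂ _).trans ?_
      refine HEq.trans ?_ (whiskerRight_heq (F.map_comp _ _) (F.map_comp _ _)
        (map₂_whiskerLeft_heq F _ _) rfl).symm
      refine HEq.trans ?_ (whisker_assoc_heq _ _ _).symm
      refine HEq.trans ?_ (whiskerLeft_heq rfl (fac g) (fac g') (fac₂ η)).symm
      refine (comp_whiskerLeft_heq _ _ _).symm.trans ?_
      refine HEq.trans ?_ (comp_whiskerLeft_heq _ _ _)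
      exact whiskerLeft_heq (fac f).symm rfl rfl HEq.rfl
    map₂_whisker_right {X Y Z f f'} η g := by
      refine eq_eqToHom_conj_of_heq _ _ ((H Z).hom₂_ext_heq (map_comp _ _) (map_comp _ _) ?_)
      refine (fac₂ _).trans ?_
      refine HEq.trans ?_ (whiskerRight_heq (F.map_comp _ _) (F.map_comp _ _)
        (map₂_whiskerRight_heq F _ _) rfl).symm
      refine HEq.trans ?_ (whiskerRight_comp_heq _ _ _)
      refine HEq.trans ?_ (whiskerRight_heq rfl rfl HEq.rfl (fac g)).symm
      refine HEq.trans ?_ (whiskerRight_comp_heq _ _ _).symm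
      refine HEq.trans ?_ (whiskerRight_heq (fac f) (fac f') (fac₂ η) rfl).symm
      exact (whisker_assoc_heq _ _ _).symm }

/-- Couniversal arrows form the counit of a 2-adjunction. -/
noncomputable def counitAdjunctionOfCouniversal : CounitAdjunction F (rightAdjoint F G ϵ H) where
  counit := ϵ
  nat {X Y} f := (H Y).lift_fac (ϵ X ≫ f)
  nat₂ {X Y f g} α := (H Y).lift₂_fac ((H Y).lift_fac (ϵ X ≫ f)) ((H Y).lift_fac (ϵ X ≫ g)) (ϵ X ◁ α)
  isCouniversal := H

end OfCouniversal

namespace CounitAdjunction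

variable {F : StrictPseudofunctor K L} {G : StrictPseudofunctor L K}

/-- The unit of a 2-adjunction presented by its counit. -/
noncomputable def unit (A : CounitAdjunction F G) (X : K) : X ⟶ G.obj (F.obj X) :=
  (A.isCouniversal (F.obj X)).lift (𝟙 (F.obj X))

theorem unit_fac (A : CounitAdjunction F G) (X : K) :
    F.map (A.unit X) ≫ A.counit (F.obj X) = 𝟙 (F.obj X) :=
  (A.isCouniversal (F.obj X)).lift_fac _

/-- Both sides factorize `F.map f` through the counit at `F.obj Y`. In dimension two, both sides of
`unit_nat₂` factorize `F.map₂ η`. -/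
theorem unit_nat (A : CounitAdjunction F G) {X Y : K} (f : X ⟶ Y) :
    f ≫ A.unit Y = A.unit X ≫ G.map (F.map f) :=
  (A.isCouniversal (F.obj Y)).hom_ext (by
    rw [F.map_comp, F.map_comp, Strict.assoc, Strict.assoc, A.unit_fac, A.nat, ← Strict.assoc,
      A.unit_fac, Strict.comp_id, Strict.id_comp])

theorem unit_nat₂ (A : CounitAdjunction F G) {X Y : K} {f g : X ⟶ Y} (η : f ⟶ g) :
    HEq (η ▷ A.unit Y) (A.unit X ◁ G.map₂ (F.map₂ η)) :=
  (A.isCouniversal (F.obj Y)).hom₂_ext_heq (A.unit_nat f) (A.unit_nat g) (by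
    refine (whiskerRight_heq (F.map_comp _ _) (F.map_comp _ _)
      (map₂_whiskerRight_heq F _ _) rfl).trans ?_
    refine (whiskerRight_comp_heq _ _ _).symm.trans ?_
    refine (whiskerRight_heq rfl rfl HEq.rfl (A.unit_fac Y)).trans ?_
    refine (whiskerRight_id_heq _).trans ?_
    refine HEq.trans ?_ (whiskerRight_heq (F.map_comp _ _) (F.map_comp _ _)
      (map₂_whiskerLeft_heq F _ _) rfl).symm
    refine HEq.trans ?_ (whisker_assoc_heq _ _ _).symm
    refine HEq.trans ?_ (whiskerLeft_heq rfl (A.nat _) (A.nat _) (A.nat₂ _)).symm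
    refine HEq.trans ?_ (comp_whiskerLeft_heq _ _ _)
    refine HEq.trans ?_ (whiskerLeft_heq (A.unit_fac X) rfl rfl HEq.rfl).symm
    exact (id_whiskerLeft_heq _).symm)

theorem unit_counit (A : CounitAdjunction F G) (Y : L) :
    A.unit (G.obj Y) ≫ G.map (A.counit Y) = 𝟙 (G.obj Y) :=
  (A.isCouniversal Y).hom_ext (by
    rw [F.map_comp, Strict.assoc, A.nat, ← Strict.assoc, A.unit_fac, F.map_id])

/-- A 2-natural couniversal counit gives a 2-adjunction. -/
noncomputable def toTwoAdjunction (A : CounitAdjunction F G) : TwoAdjunction F G where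
  unit := .ofHEq A.unit A.unit_nat A.unit_nat₂
  counit := .ofHEq A.counit A.nat A.nat₂
  left_triangle := A.unit_fac
  right_triangle := A.unit_counit

/-- The 2-adjunction given by a unit and a counit satisfying the triangle identities. -/
def ofUnitCounit (η : ∀ X : K, X ⟶ G.obj (F.obj X)) (ϵ : ∀ Y : L, F.obj (G.obj Y) ⟶ Y)
    (unat : ∀ {X Y : K} (f : X ⟶ Y), f ≫ η Y = η X ≫ G.map (F.map f))
    (unat₂ : ∀ {X Y : K} {f g : X ⟶ Y} (α : f ⟶ g), HEq (α ▷ η Y) (η X ◁ G.map₂ (F.map₂ α)))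
    (nat : ∀ {X Y : L} (f : X ⟶ Y), F.map (G.map f) ≫ ϵ Y = ϵ X ≫ f)
    (nat₂ : ∀ {X Y : L} {f g : X ⟶ Y} (α : f ⟶ g), HEq (F.map₂ (G.map₂ α) ▷ ϵ Y) (ϵ X ◁ α))
    (lt : ∀ X : K, F.map (η X) ≫ ϵ (F.obj X) = 𝟙 (F.obj X))
    (rt : ∀ Y : L, η (G.obj Y) ≫ G.map (ϵ Y) = 𝟙 (G.obj Y)) : CounitAdjunction F G where
  counit := ϵ
  nat := nat
  nat₂ := nat₂
  isCouniversal Y := by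
    -- Sending `h` to `F.map h ≫ ϵ Y` has as inverse the assignment of `η X ≫ G.map f` to `f`.
    -- `back` and `back₂` are the halves of this bijection starting from `h` and from a 2-cell `χ`.
    have back : ∀ {X : K} (h : X ⟶ G.obj Y), η X ≫ G.map (F.map h ≫ ϵ Y) = h := fun h => by
      rw [G.map_comp, ← Strict.assoc, ← unat, Strict.assoc, rt, Strict.comp_id]
    have back₂ : ∀ {X : K} {h h' : X ⟶ G.obj Y} (χ : h ⟶ h'),
        HEq (η X ◁ G.map₂ (F.map₂ χ ▷ ϵ Y)) χ := fun χ => by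
      refine (whiskerLeft_heq rfl (G.map_comp _ _) (G.map_comp _ _)
        (map₂_whiskerRight_heq G _ _)).trans ?_
      refine (whisker_assoc_heq _ _ _).symm.trans ?_
      refine (whiskerRight_heq (unat _).symm (unat _).symm (unat₂ χ).symm rfl).trans ?_
      refine (whiskerRight_comp_heq _ _ _).symm.trans ?_
      exact (whiskerRight_heq rfl rfl HEq.rfl (rt _)).trans (whiskerRight_id_heq _)
    constructor
    · intro X f
      refine ⟨η X ≫ G.map f, ?_, ?_⟩
      · change F.map (η X ≫ G.map f) ≫ ϵ Y = f
        rw [F.map_comp, Strict.assoc, nat, ← Strict.assoc, lt, Strict.id_comp]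
      · rintro h rfl
        exact (back h).symm
    · intro X h h' α
      -- The transpose `η X ◁ G.map₂ α` has `h` and `h'` as its boundary only up to the equalities
      -- `back`.
      refine ⟨eqToHom (back h).symm ≫ η X ◁ G.map₂ α ≫ eqToHom (back h'), ?_, ?_⟩
      · apply eq_of_heq
        refine (whiskerRight_heq (congrArg F.map (back h).symm) (congrArg F.map (back h').symm)
          (map₂_heq F (back h).symm (back h').symm (eqToHom_conj_heq _ _ _)) rfl).trans ?_
        refine (whiskerRight_heq (F.map_comp _ _) (F.map_comp _ _)
          (map₂_whiskerLeft_heq F _ _) rfl).trans ?_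
        refine (whisker_assoc_heq _ _ _).trans ?_
        refine (whiskerLeft_heq rfl (nat _) (nat _) (nat₂ _)).trans ?_
        refine (comp_whiskerLeft_heq _ _ _).symm.trans ?_
        exact (whiskerLeft_heq (lt X) rfl rfl HEq.rfl).trans (id_whiskerLeft_heq _)
      · rintro χ rfl
        exact eq_eqToHom_conj_of_heq _ _ (back₂ χ).symm

/-- The counit of a 2-adjunction is couniversal. -/
def ofTwoAdjunction (A : TwoAdjunction F G) : CounitAdjunction F G :=
  ofUnitCounit (fun X => A.unit.app X) (fun X => A.counit.app X) (fun f => A.unit.naturality f)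
    (fun α => A.unit.naturality₂_heq α) (fun f => A.counit.naturality f)
    (fun α => A.counit.naturality₂_heq α) A.left_triangle A.right_triangle

/-- Right 2-adjoints are unique up to 2-natural isomorphism. -/
noncomputable def rightAdjointHom {G' : StrictPseudofunctor L K} (A : CounitAdjunction F G)
    (A' : CounitAdjunction F G') : TwoNatTrans G G' :=
  have fac : ∀ X : L, F.map ((A'.isCouniversal X).lift (A.counit X)) ≫ A'.counit X = A.counit X :=
    fun X => (A'.isCouniversal X).lift_fac _
  have hnat : ∀ {X Y : L} (f : X ⟶ Y), G.map f ≫ (A'.isCouniversal Y).lift (A.counit Y) =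
      (A'.isCouniversal X).lift (A.counit X) ≫ G'.map f := fun {X Y} f =>
    (A'.isCouniversal Y).hom_ext (by
      rw [F.map_comp, F.map_comp, Strict.assoc, Strict.assoc, fac, A'.nat, A.nat, ← Strict.assoc,
        fac])
  .ofHEq (fun X => (A'.isCouniversal X).lift (A.counit X)) hnat fun {X Y f g} α =>
    (A'.isCouniversal Y).hom₂_ext_heq (hnat f) (hnat g) (by
      refine (whiskerRight_heq (F.map_comp _ _) (F.map_comp _ _)
        (map₂_whiskerRight_heq F _ _) rfl).trans ?_
      refine (whiskerRight_comp_heq _ _ _).symm.trans ?_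
      refine (whiskerRight_heq rfl rfl HEq.rfl (fac Y)).trans ?_
      refine (A.nat₂ α).trans ?_
      refine HEq.trans ?_ (whiskerRight_heq (F.map_comp _ _) (F.map_comp _ _)
        (map₂_whiskerLeft_heq F _ _) rfl).symm
      refine HEq.trans ?_ (whisker_assoc_heq _ _ _).symm
      refine HEq.trans ?_ (whiskerLeft_heq rfl (A'.nat _) (A'.nat _) (A'.nat₂ _)).symm
      refine HEq.trans ?_ (comp_whiskerLeft_heq _ _ _)
      exact (whiskerLeft_heq (fac X) rfl rfl HEq.rfl).symm)

theorem rightAdjointHom_fac {G' : StrictPseudofunctor L K} (A : CounitAdjunction F G)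
    (A' : CounitAdjunction F G') (Y : L) :
    F.map ((rightAdjointHom A A').app Y) ≫ A'.counit Y = A.counit Y :=
  (A'.isCouniversal Y).lift_fac _

theorem rightAdjointHom_comp {G' : StrictPseudofunctor L K} (A : CounitAdjunction F G)
    (A' : CounitAdjunction F G') (Y : L) :
    (rightAdjointHom A A').app Y ≫ (rightAdjointHom A' A).app Y = 𝟙 (G.obj Y) :=
  (A.isCouniversal Y).hom_ext (by
    rw [F.map_comp, Strict.assoc, rightAdjointHom_fac, rightAdjointHom_fac, F.map_id,
      Strict.id_comp])

/-- Right 2-adjoints are unique up to 2-natural isomorphism. -/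
noncomputable def rightAdjointIso {G' : StrictPseudofunctor L K} (A : CounitAdjunction F G)
    (A' : CounitAdjunction F G') : TwoNatIso G G' where
  hom := rightAdjointHom A A'
  inv := rightAdjointHom A' A
  hom_inv_id := rightAdjointHom_comp A A'
  inv_hom_id := rightAdjointHom_comp A' A

/-- Transport of a 2-adjunction along an isomorphism of left 2-adjoints. -/
def ofLeftIso {F' : StrictPseudofunctor K L} (A : CounitAdjunction F G) (i : TwoNatIso F' F) :
    CounitAdjunction F' G where
  counit Y := i.hom.app (G.obj Y) ≫ A.counit Y
  nat f := by
    rw [← Strict.assoc, i.hom.naturality, Strict.assoc, A.nat, Strict.assoc]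
  nat₂ {X Y f g} α := by
    refine (whiskerRight_comp_heq _ _ _).trans ?_
    refine (whiskerRight_heq (i.hom.naturality _) (i.hom.naturality _)
      (i.hom.naturality₂_heq _) rfl).trans ?_
    refine (whisker_assoc_heq _ _ _).trans ?_
    refine (whiskerLeft_heq rfl (A.nat _) (A.nat _) (A.nat₂ _)).trans ?_
    exact (comp_whiskerLeft_heq _ _ _).symm
  isCouniversal Y := by
    -- Composition with the components of `i` and of its inverse exchanges factorizations through
    -- the new counit with factorizations through the old one.
    have e : ∀ {X : K} (h : X ⟶ G.obj Y), F'.map h ≫ i.hom.app (G.obj Y) ≫ A.counit Y =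
        i.hom.app X ≫ F.map h ≫ A.counit Y := fun h => by
      rw [← Strict.assoc, i.hom.naturality, Strict.assoc]
    have e' : ∀ {X : K} (h : X ⟶ G.obj Y), F.map h ≫ A.counit Y =
        i.inv.app X ≫ F'.map h ≫ i.hom.app (G.obj Y) ≫ A.counit Y := fun h => by
      rw [e, ← Strict.assoc, i.inv_hom_id, Strict.id_comp]
    have e₂ : ∀ {X : K} {h h' : X ⟶ G.obj Y} (χ : h ⟶ h'),
        HEq (F'.map₂ χ ▷ (i.hom.app (G.obj Y) ≫ A.counit Y))
          (i.hom.app X ◁ F.map₂ χ ▷ A.counit Y) := fun χ => by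
      refine (whiskerRight_comp_heq _ _ _).trans ?_
      refine (whiskerRight_heq (i.hom.naturality _) (i.hom.naturality _)
        (i.hom.naturality₂_heq _) rfl).trans ?_
      exact whisker_assoc_heq _ _ _
    have e₂' : ∀ {X : K} {h h' : X ⟶ G.obj Y} (χ : h ⟶ h'), HEq (F.map₂ χ ▷ A.counit Y)
        (i.inv.app X ◁ F'.map₂ χ ▷ (i.hom.app (G.obj Y) ≫ A.counit Y)) := fun χ => by
      refine HEq.trans ?_ (whiskerLeft_heq rfl (e _) (e _) (e₂ χ)).symm
      refine HEq.trans ?_ (comp_whiskerLeft_heq _ _ _)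
      refine HEq.trans ?_ (whiskerLeft_heq (i.inv_hom_id _) rfl rfl HEq.rfl).symm
      exact (id_whiskerLeft_heq _).symm
    constructor
    · intro X f
      refine ⟨(A.isCouniversal Y).lift (i.inv.app X ≫ f), ?_, ?_⟩
      · change F'.map _ ≫ _ ≫ _ = f
        rw [e, (A.isCouniversal Y).lift_fac, ← Strict.assoc, i.hom_inv_id, Strict.id_comp]
      · rintro h rfl
        refine (A.isCouniversal Y).hom_ext ?_
        rw [(A.isCouniversal Y).lift_fac, e']
    · intro X h h' α
      obtain ⟨χ, hχ⟩ := (A.isCouniversal Y).existsUnique₂_heq (e' h) (e' h') (i.inv.app X ◁ α)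
      refine ⟨χ, ?_, ?_⟩
      · apply eq_of_heq
        refine (e₂ χ).trans ((whiskerLeft_heq rfl (e' h) (e' h') hχ).trans ?_)
        refine (comp_whiskerLeft_heq _ _ _).symm.trans ?_
        refine (whiskerLeft_heq (i.hom_inv_id _) rfl rfl HEq.rfl).trans ?_
        exact id_whiskerLeft_heq _
      · rintro χ' rfl
        exact (A.isCouniversal Y).hom₂_ext (eq_of_heq ((e₂' χ').trans hχ.symm))

variable {M : Type u₃} [Bicategory.{w₃, v₃} M] [Strict M]

/-- Composition of 2-adjunctions. -/
def comp {F' : StrictPseudofunctor L M} {G' : StrictPseudofunctor M L} (A : CounitAdjunction F G)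
    (A' : CounitAdjunction F' G') : CounitAdjunction (F.comp F') (G'.comp G) where
  counit Y := F'.map (A.counit (G'.obj Y)) ≫ A'.counit Y
  nat {X Y} f := by
    change F'.map (F.map (G.map (G'.map f))) ≫ F'.map (A.counit (G'.obj Y)) ≫ A'.counit Y =
      (F'.map (A.counit (G'.obj X)) ≫ A'.counit X) ≫ f
    rw [← Strict.assoc, ← F'.map_comp, A.nat, F'.map_comp, Strict.assoc, A'.nat, Strict.assoc]
  nat₂ {X Y f g} α := by
    change HEq (F'.map₂ (F.map₂ (G.map₂ (G'.map₂ α))) ▷ (F'.map (A.counit (G'.obj Y)) ≫ A'.counit Y))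
      ((F'.map (A.counit (G'.obj X)) ≫ A'.counit X) ◁ α)
    refine (whiskerRight_comp_heq _ _ _).trans ?_
    refine (whiskerRight_heq (F'.map_comp _ _).symm (F'.map_comp _ _).symm
      (map₂_whiskerRight_heq F' _ _).symm rfl).trans ?_
    refine (whiskerRight_heq (congrArg F'.map (A.nat _)) (congrArg F'.map (A.nat _))
      (map₂_heq F' (A.nat _) (A.nat _) (A.nat₂ _)) rfl).trans ?_
    refine (whiskerRight_heq (F'.map_comp _ _) (F'.map_comp _ _)
      (map₂_whiskerLeft_heq F' _ _) rfl).trans ?_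
    refine (whisker_assoc_heq _ _ _).trans ?_
    refine (whiskerLeft_heq rfl (A'.nat _) (A'.nat _) (A'.nat₂ _)).trans ?_
    exact (comp_whiskerLeft_heq _ _ _).symm
  isCouniversal Y := by
    -- Factorizing through the composite counit means factorizing through `A'.counit` and then the
    -- result through `A.counit`.
    have e : ∀ {X : K} (h : X ⟶ G.obj (G'.obj Y)),
        F'.map (F.map h) ≫ F'.map (A.counit (G'.obj Y)) ≫ A'.counit Y =
          F'.map (F.map h ≫ A.counit (G'.obj Y)) ≫ A'.counit Y := fun h => by
      rw [F'.map_comp, Strict.assoc]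
    have e₂ : ∀ {X : K} {h h' : X ⟶ G.obj (G'.obj Y)} (χ : h ⟶ h'),
        HEq (F'.map₂ (F.map₂ χ) ▷ (F'.map (A.counit (G'.obj Y)) ≫ A'.counit Y))
          (F'.map₂ (F.map₂ χ ▷ A.counit (G'.obj Y)) ▷ A'.counit Y) := fun χ => by
      refine (whiskerRight_comp_heq _ _ _).trans ?_
      exact whiskerRight_heq (F'.map_comp _ _).symm (F'.map_comp _ _).symm
        (map₂_whiskerRight_heq F' _ _).symm rfl
    constructor
    · intro X (f : F'.obj (F.obj X) ⟶ Y)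
      refine ⟨(A.isCouniversal _).lift ((A'.isCouniversal Y).lift f), ?_, ?_⟩
      · refine (e _).trans ?_
        rw [(A.isCouniversal _).lift_fac, (A'.isCouniversal Y).lift_fac]
      · intro (h : X ⟶ G.obj (G'.obj Y))
          (hh : F'.map (F.map h) ≫ F'.map (A.counit (G'.obj Y)) ≫ A'.counit Y = f)
        rw [e] at hh
        subst hh
        refine (A.isCouniversal _).hom_ext ((A'.isCouniversal Y).hom_ext ?_)
        rw [(A.isCouniversal _).lift_fac, (A'.isCouniversal Y).lift_fac]
    · intro X h h' α
      obtain ⟨ψ, hψ⟩ := (A'.isCouniversal Y).existsUnique₂_heq (e h).symm (e h').symm α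
      obtain ⟨χ, hχ⟩ := (A.isCouniversal _).existsUnique₂_heq rfl rfl ψ
      obtain rfl := eq_of_heq hχ
      refine ⟨χ, eq_of_heq ((e₂ χ).trans hψ), ?_⟩
      intro χ' hχ'
      refine (A.isCouniversal _).hom₂_ext ((A'.isCouniversal Y).hom₂_ext (eq_of_heq ?_))
      exact (e₂ χ').symm.trans ((heq_of_eq hχ').trans hψ.symm)

end CounitAdjunction

end Couniversal

end TwoCat

namespace TwoCat

open Bicategory

universe w₁ v₁ u₁ w₂ v₂ u₂ w₃ v₃ u₃

/-! ### Slices, pullback 2-functors and cancellation of `∑ⱼ`. -/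

section Slices

variable {K : Type u₁} [Bicategory.{w₁, v₁} K] [Strict K]

theorem Slice.hom₂_heq {X : K} {a b : Slice X} {f f' g g' : a ⟶ b} {α : f ⟶ g} {α' : f' ⟶ g'}
    (hf : f = f') (hg : g = g') (h : HEq (Hom₂.left α) (Hom₂.left α')) : HEq α α' := by
  subst hf hg
  exact heq_of_eq (Hom₂.ext (eq_of_heq h))

theorem Slice.left_heq {X : K} {a b : Slice X} {f f' g g' : a ⟶ b} {α : f ⟶ g} {α' : f' ⟶ g'}
    (hf : f = f') (hg : g = g') (h : HEq α α') : HEq (Hom₂.left α) (Hom₂.left α') := by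
  subst hf hg
  cases h
  rfl

/-- A 2-pullback square is a couniversal arrow from `∑ₚ`. -/
theorem IsTwoPullback.isCouniversal {X Y : K} {p : X ⟶ Y} {b : Slice Y} {P : K} {fst : P ⟶ b.left}
    {snd : P ⟶ X} (H : IsTwoPullback fst snd b.hom p) :
    IsCouniversal (Slice.sigma p) (Y := b) (Slice.mk P snd) (Slice.Hom.mk fst H.w) := by
  constructor
  · intro Z f
    obtain ⟨l, ⟨h₁, h₂⟩, hl⟩ := H.existsUnique_lift (Slice.Hom.left f) Z.hom (Slice.Hom.w f)
    refine ⟨Slice.Hom.mk l h₂, Slice.Hom.ext h₁, ?_⟩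
    intro h hh
    exact Slice.Hom.ext (hl _ ⟨congrArg Slice.Hom.left hh, Slice.Hom.w h⟩)
  · intro Z h h' α
    have hα : Slice.Hom₂.left α ▷ b.hom = eqToHom _ := Slice.Hom₂.w α
    -- A 2-cell of the slice over `X` whiskers to an identity, so its component along `snd` has to
    -- be an `eqToHom`.
    have key := H.existsUnique_lift₂ h.left h'.left (Slice.Hom₂.left α)
      (eqToHom ((Slice.Hom.w h).trans (Slice.Hom.w h').symm)) (by
        refine (congrArg (· ≫ _) hα).trans ?_
        rw [eqToHom_whiskerRight, eqToHom_trans]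
        exact eqToHom_trans _ _)
    obtain ⟨χ, ⟨h₁, h₂⟩, hχ⟩ := key
    refine ⟨Slice.Hom₂.mk χ h₂, Slice.Hom₂.ext h₁, ?_⟩
    intro χ' hχ'
    exact Slice.Hom₂.ext (hχ _ ⟨congrArg Slice.Hom₂.left hχ', Slice.Hom₂.w χ'⟩)

/-- A pullback 2-functor is right 2-adjoint to `∑ₚ`. -/
def PullbackFunctor.adjunction {X Y : K} {p : X ⟶ Y} (Q : PullbackFunctor p) :
    CounitAdjunction (Slice.sigma p) Q.functor where
  counit b := Slice.Hom.mk (Q.proj.app b) (Q.isTwoPullback b).w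
  nat f := Slice.Hom.ext (Q.proj.naturality f)
  nat₂ {_ _ f g} η := Slice.hom₂_heq (Slice.Hom.ext (Q.proj.naturality f))
    (Slice.Hom.ext (Q.proj.naturality g)) (Q.proj.naturality₂_heq η)
  isCouniversal b := (Q.isTwoPullback b).isCouniversal

/-- The pullback 2-functor determined by a choice of 2-pullbacks. -/
noncomputable def PullbackFunctor.ofPullbacks {X Y : K} (p : X ⟶ Y) (P : Slice Y → Slice X)
    (fst : ∀ b, (P b).left ⟶ b.left) (H : ∀ b, IsTwoPullback (fst b) (P b).hom b.hom p) :
    PullbackFunctor p where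
  functor := rightAdjoint (Slice.sigma p) P (fun b => Slice.Hom.mk (fst b) (H b).w)
    (fun b => (H b).isCouniversal)
  proj := .ofHEq fst
    (fun f => congrArg Slice.Hom.left ((counitAdjunctionOfCouniversal (Slice.sigma p) P
      (fun b => Slice.Hom.mk (fst b) (H b).w) (fun b => (H b).isCouniversal)).nat f))
    (fun {_ _ f g} η => Slice.left_heq
      ((counitAdjunctionOfCouniversal (Slice.sigma p) P
      (fun b => Slice.Hom.mk (fst b) (H b).w) (fun b => (H b).isCouniversal)).nat f)
      ((counitAdjunctionOfCouniversal (Slice.sigma p) P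
      (fun b => Slice.Hom.mk (fst b) (H b).w) (fun b => (H b).isCouniversal)).nat g)
      ((counitAdjunctionOfCouniversal (Slice.sigma p) P
      (fun b => Slice.Hom.mk (fst b) (H b).w) (fun b => (H b).isCouniversal)).nat₂ η))
  isTwoPullback := H

/-- The forgetful 2-functor from the slice over a terminal object is left 2-adjoint to
`A ↦ (A ⟶ 1)`. -/
def Terminal.forgetAdjunction {T : K} (hT : Terminal T) :
    CounitAdjunction (Slice.forget T) (overTerminal (StrictPseudofunctor.id K) hT) where
  counit A := 𝟙 A
  nat f := (Strict.comp_id f).trans (Strict.id_comp f).symm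
  nat₂ η := (whiskerRight_id_heq η).trans (id_whiskerLeft_heq η).symm
  isCouniversal A := by
    constructor
    · intro X f
      refine ⟨Slice.Hom.mk f (hT.one_uniq _ _), Strict.comp_id f, ?_⟩
      intro h hh
      exact Slice.Hom.ext ((Strict.comp_id _).symm.trans hh)
    · intro X h h' α
      have e : ∀ f : X.left ⟶ A, f ≫ 𝟙 A = f := Strict.comp_id
      refine ⟨Slice.Hom₂.mk (eqToHom (e h.left).symm ≫ (α : h.left ≫ 𝟙 A ⟶ h'.left ≫ 𝟙 A) ≫
        eqToHom (e h'.left)) (hT.two_uniq _ _), ?_, ?_⟩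
      · apply eq_of_heq
        refine (whiskerRight_id_heq (a := X.left) (b := A) _).trans (eqToHom_conj_heq (a := X.left) (b := A) _ _ _)
      · rintro χ rfl
        refine Slice.Hom₂.ext (eq_eqToHom_conj_of_heq (a := X.left) (b := A) _ _ ?_)
        exact (whiskerRight_id_heq (a := X.left) (b := A) _).symm

/-- If composition with `j` is injective on 1-cells and 2-cells then `∑ⱼ` can be cancelled from a
right 2-adjoint. -/
def CounitAdjunction.cancelSigma {L : Type u₂} [Bicategory.{w₂, v₂} L] [Strict L] {X Y : K}
    (j : X ⟶ Y)
    (hj : ∀ {Z : K} (f g : Z ⟶ X), f ≫ j = g ≫ j → f = g)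
    (hj₂ : ∀ {Z : K} {f g : Z ⟶ X} (α β : f ⟶ g), α ▷ j = β ▷ j → α = β)
    {F : StrictPseudofunctor (Slice Y) L} {G : StrictPseudofunctor L (Slice X)}
    (A : CounitAdjunction F (G.comp (Slice.sigma j))) :
    CounitAdjunction ((Slice.sigma j).comp F) G where
  counit := A.counit
  nat := A.nat
  nat₂ := A.nat₂
  isCouniversal B := by
    constructor
    · intro Z f
      obtain ⟨h, hh, hu⟩ := (A.isCouniversal B).existsUnique f
      -- The factorization is given only over `Y`; since `j` can be cancelled, it lies over `X` as
      -- well.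
      refine ⟨Slice.Hom.mk (Slice.Hom.left (a := (Slice.sigma j).obj Z)
        (b := (Slice.sigma j).obj (G.obj B)) h) (hj _ _ ?_), hh, ?_⟩
      · exact (Strict.assoc _ _ _).trans (Slice.Hom.w h)
      · intro h' hh'
        exact Slice.Hom.ext (congrArg (Slice.Hom.left (a := (Slice.sigma j).obj Z)
          (b := (Slice.sigma j).obj (G.obj B))) (hu ((Slice.sigma j).map h') hh'))
    · intro Z h h' α
      obtain ⟨χ, hχ, hu⟩ := (A.isCouniversal B).existsUnique₂ (h := (Slice.sigma j).map h)
        (h' := (Slice.sigma j).map h') α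
      refine ⟨Slice.Hom₂.mk (Slice.Hom₂.left (f := (Slice.sigma j).map h)
        (g := (Slice.sigma j).map h') χ) (hj₂ _ _ ?_), hχ, ?_⟩
      · have e := Slice.Hom₂.w χ
        apply eq_of_heq
        refine (whiskerRight_comp_heq _ _ _).symm.trans ((heq_of_eq e).trans ?_)
        rw [eqToHom_whiskerRight]
        exact eqToHom_heq_eqToHom (Strict.assoc _ _ _).symm _ _
      · intro χ' hχ'
        exact Slice.Hom₂.ext (congrArg (Slice.Hom₂.left (f := (Slice.sigma j).map h)
          (g := (Slice.sigma j).map h')) (hu ((Slice.sigma j).map₂ χ') hχ'))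

/-! ### The right 2-adjoint of `p^*` from a right 2-adjoint of its domain. -/

section DependentProduct

variable {E B : K} {p : E ⟶ B} {Q : PullbackFunctor p} {M : StrictPseudofunctor K (Slice B)}
  (A : CounitAdjunction (Q.functor.comp (Slice.forget E)) M)

/-- The 1-cell `B ⟶ M E` over `B` that corresponds to the projection of the pullback of the
identity. -/
noncomputable def nameOfProjection : Slice.mk B (𝟙 B) ⟶ M.obj E :=
  (A.isCouniversal E).lift (Q.functor.obj (Slice.mk B (𝟙 B))).hom

/-- The unique 1-cell to the terminal object of the slice. -/
def Slice.toId (x : Slice B) : x ⟶ Slice.mk B (𝟙 B) := Slice.Hom.mk x.hom (Strict.comp_id _)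

theorem PullbackFunctor.map_comp_left (Q : PullbackFunctor p) {x y z : Slice B} (f : x ⟶ y)
    (g : y ⟶ z) : Slice.Hom.left (Q.functor.map (f ≫ g)) =
      Slice.Hom.left (Q.functor.map f) ≫ Slice.Hom.left (Q.functor.map g) :=
  congrArg Slice.Hom.left (Q.functor.map_comp f g)

theorem PullbackFunctor.map₂_whiskerRight_left (Q : PullbackFunctor p) {x y z : Slice B}
    {f f' : x ⟶ y} (α : f ⟶ f') (g : y ⟶ z) : HEq (Slice.Hom₂.left (Q.functor.map₂ (α ▷ g)))
      (Slice.Hom₂.left (Q.functor.map₂ α) ▷ Slice.Hom.left (Q.functor.map g)) :=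
  Slice.left_heq (Q.functor.map_comp f g) (Q.functor.map_comp f' g)
    (map₂_whiskerRight_heq Q.functor α g)

/-- The transpose of the name is the projection of `p^*(1)`, and `p^*` sends the 1-cell from `x` to
the terminal object of the slice to a 1-cell over `E`. Thus a 1-cell into `M.obj E` that factors
through the name is one whose transpose is the structure map of `p^* x`. -/
theorem map_nameOfProjection (x : Slice B) :
    Slice.Hom.left (Q.functor.map (Slice.toId x ≫ nameOfProjection A)) ≫ A.counit E =
      (Q.functor.obj x).hom := by
  have h : Slice.Hom.left (Q.functor.map (nameOfProjection A)) ≫ A.counit E = _ :=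
    (A.isCouniversal E).lift_fac (Q.functor.obj (Slice.mk B (𝟙 B))).hom
  rw [Q.map_comp_left]
  exact (Strict.assoc _ _ _).trans ((congrArg _ h).trans (Slice.Hom.w (Q.functor.map _)))

/-- If `M` is right 2-adjoint to the domain of `p^*`, then pulling back `M q` along the name of the
projection gives the value at `q` of a right 2-adjoint of `p^*`. -/
theorem exists_isCouniversal_pullback (q : Slice E) {P : K} {fst : P ⟶ (M.obj q.left).left}
    {snd : P ⟶ B} (H : IsTwoPullback fst snd (Slice.Hom.left (M.map q.hom))
      (Slice.Hom.left (nameOfProjection A))) :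
    ∃ ϵ : Q.functor.obj (Slice.mk P snd) ⟶ q, IsCouniversal Q.functor (Slice.mk P snd) ϵ := by
  -- The name and the image of `q.hom` both lie over `B`, so commutativity of the square makes `fst`
  -- a 1-cell over `B`.
  have fstw : fst ≫ (M.obj q.left).hom = snd := by
    rw [← Slice.Hom.w (M.map q.hom), ← Strict.assoc, H.w, Strict.assoc,
      Slice.Hom.w (nameOfProjection A)]
    exact Strict.comp_id _
  let fst' : Slice.mk P snd ⟶ M.obj q.left := Slice.Hom.mk fst fstw
  let e : (Q.functor.obj (M.obj q.left)).left ⟶ q.left := A.counit q.left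
  let eE : (Q.functor.obj (M.obj E)).left ⟶ E := A.counit E
  have fst_comp : fst' ≫ M.map q.hom = Slice.toId _ ≫ nameOfProjection A := Slice.Hom.ext H.w
  have enat : Slice.Hom.left (Q.functor.map (M.map q.hom)) ≫ eE = e ≫ q.hom := A.nat q.hom
  have ename : ∀ x : Slice B,
      Slice.Hom.left (Q.functor.map (Slice.toId x ≫ nameOfProjection A)) ≫ eE =
      (Q.functor.obj x).hom := map_nameOfProjection A
  -- The universal properties of `A` at `q.left` and at `E`, with the composite 2-functor unfolded
  -- so that equations about domains can be rewritten.
  have hC : ∀ {x : Slice B} (f : (Q.functor.obj x).left ⟶ q.left),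
      ∃! h : x ⟶ M.obj q.left, Slice.Hom.left (Q.functor.map h) ≫ e = f :=
    fun f => (A.isCouniversal q.left).existsUnique f
  have hC₂ : ∀ {x : Slice B} {h h' : x ⟶ M.obj q.left} {f f' : (Q.functor.obj x).left ⟶ q.left}
      (_ : Slice.Hom.left (Q.functor.map h) ≫ e = f) (_ : Slice.Hom.left (Q.functor.map h') ≫ e = f')
      (α : f ⟶ f'), ∃ χ : h ⟶ h', HEq (Slice.Hom₂.left (Q.functor.map₂ χ) ▷ e) α :=
    fun e₁ e₂ α => (A.isCouniversal q.left).existsUnique₂_heq e₁ e₂ α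
  have hC₂u : ∀ {x : Slice B} {h h' k k' : x ⟶ M.obj q.left} {χ : h ⟶ h'} {χ' : k ⟶ k'}
      (_ : h = k) (_ : h' = k'), HEq (Slice.Hom₂.left (Q.functor.map₂ χ) ▷ e)
        (Slice.Hom₂.left (Q.functor.map₂ χ') ▷ e) → HEq χ χ' :=
    fun e₁ e₂ h => (A.isCouniversal q.left).hom₂_ext_heq e₁ e₂ h
  have hE : ∀ {x : Slice B} {h h' : x ⟶ M.obj E},
      Slice.Hom.left (Q.functor.map h) ≫ eE = Slice.Hom.left (Q.functor.map h') ≫ eE → h = h' :=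
    fun h => (A.isCouniversal E).hom_ext h
  have hE₂ : ∀ {x : Slice B} {h h' : x ⟶ M.obj E} {χ χ' : h ⟶ h'},
      HEq (Slice.Hom₂.left (Q.functor.map₂ χ) ▷ eE) (Slice.Hom₂.left (Q.functor.map₂ χ') ▷ eE) →
      χ = χ' := fun h => (A.isCouniversal E).hom₂_ext (eq_of_heq h)
  have ew : (Slice.Hom.left (Q.functor.map fst') ≫ e) ≫ q.hom =
      (Q.functor.obj (Slice.mk P snd)).hom := by
    rw [Strict.assoc, ← enat, ← Strict.assoc, ← Q.map_comp_left, fst_comp, ename]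
  have efac : ∀ {x : Slice B} (l : x ⟶ Slice.mk P snd),
      Slice.Hom.left (Q.functor.map l) ≫ Slice.Hom.left (Q.functor.map fst') ≫ e =
        Slice.Hom.left (Q.functor.map (l ≫ fst')) ≫ e := fun l => by
    rw [Q.map_comp_left, Strict.assoc]
  have efac₂ : ∀ {x : Slice B} {l l' : x ⟶ Slice.mk P snd} (χ : l ⟶ l'),
      HEq (Slice.Hom₂.left (Q.functor.map₂ χ) ▷ (Slice.Hom.left (Q.functor.map fst') ≫ e))
        (Slice.Hom₂.left (Q.functor.map₂ (χ ▷ fst')) ▷ e) := fun χ =>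
    (whiskerRight_comp_heq _ _ _).trans (whiskerRight_heq (Q.map_comp_left _ _).symm
      (Q.map_comp_left _ _).symm (Q.map₂_whiskerRight_left _ _).symm rfl)
  refine ⟨Slice.Hom.mk (Slice.Hom.left (Q.functor.map fst') ≫ e) ew, ?_, ?_⟩
  · intro x f
    obtain ⟨h, hh, hu⟩ := hC (Slice.Hom.left f)
    -- That `f` lies over `E` transposes to the condition for `h` to factor through the pullback:
    -- both sides have the transpose `(Q.functor.obj x).hom`.
    have hq : h ≫ M.map q.hom = Slice.toId x ≫ nameOfProjection A := hE (by
      rw [ename, Q.map_comp_left, Strict.assoc, enat, ← Strict.assoc, hh]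
      exact Slice.Hom.w f)
    obtain ⟨l, ⟨hl₁, hl₂⟩, hlu⟩ := H.existsUnique_lift (Slice.Hom.left h) x.hom
      (congrArg Slice.Hom.left hq)
    refine ⟨Slice.Hom.mk l hl₂, Slice.Hom.ext ?_, ?_⟩
    · refine (efac _).trans (Eq.trans ?_ hh)
      exact congrArg (fun t => Slice.Hom.left (Q.functor.map t) ≫ e) (Slice.Hom.ext hl₁)
    · intro l' hl'
      refine Slice.Hom.ext (hlu _ ⟨?_, Slice.Hom.w l'⟩)
      exact congrArg Slice.Hom.left (hu (l' ≫ fst') ((efac l').symm.trans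
        (congrArg Slice.Hom.left hl')))
  · intro x l l' α
    obtain ⟨χ, hχ⟩ := hC₂ (efac l).symm (efac l').symm (Slice.Hom₂.left α)
    have hl : ∀ l : x ⟶ Slice.mk P snd, (l ≫ fst') ≫ M.map q.hom =
        Slice.toId x ≫ nameOfProjection A := fun l => by
      rw [Strict.assoc, fst_comp, ← Strict.assoc]
      exact congrArg (· ≫ nameOfProjection A) (Slice.Hom.ext (Slice.Hom.w l))
    have hαw : Slice.Hom₂.left α ▷ q.hom = eqToHom _ := Slice.Hom₂.w α
    -- The same argument for 2-cells: `α` whiskers to an identity over `E`, hence its transpose `χ`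
    -- whiskers to an identity over `M.obj E`.
    have hχq : χ ▷ M.map q.hom = eqToHom ((hl l).trans (hl l').symm) := hE₂ (by
      refine (whiskerRight_heq (Q.map_comp_left _ _) (Q.map_comp_left _ _)
        (Q.map₂_whiskerRight_left χ (M.map q.hom)) rfl).trans ?_
      refine (whiskerRight_comp_heq _ _ _).symm.trans ?_
      refine (whiskerRight_heq rfl rfl HEq.rfl enat).trans ?_
      refine (whiskerRight_comp_heq _ _ _).trans ?_
      refine (whiskerRight_heq (efac l).symm (efac l').symm hχ rfl).trans ?_
      refine (heq_of_eq hαw).trans ?_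
      rw [PrelaxFunctor.map₂_eqToHom, Slice.eqToHom_left, eqToHom_whiskerRight]
      refine eqToHom_heq_eqToHom ?_ _ _
      refine (Strict.assoc _ _ _).trans ((congrArg _ ew).trans ((Slice.Hom.w (Q.functor.map l)).trans ?_))
      rw [hl l, ename])
    have hχl : Slice.Hom₂.left χ ▷ Slice.Hom.left (M.map q.hom) = eqToHom _ :=
      (congrArg Slice.Hom₂.left hχq).trans (Slice.eqToHom_left _)
    obtain ⟨ψ, ⟨h₁, h₂⟩, hu⟩ := H.existsUnique_lift₂ (Slice.Hom.left l) (Slice.Hom.left l')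
      (Slice.Hom₂.left χ) (eqToHom ((Slice.Hom.w l).trans (Slice.Hom.w l').symm)) (by
        refine (congrArg (· ≫ _) hχl).trans ?_
        rw [eqToHom_whiskerRight, eqToHom_trans]
        exact (eqToHom_trans _ _).symm)
    refine ⟨Slice.Hom₂.mk ψ h₂, Slice.Hom₂.ext (eq_of_heq ?_), ?_⟩
    · refine (efac₂ _).trans (HEq.trans ?_ hχ)
      exact heq_of_eq (congrArg (fun t => Slice.Hom₂.left (Q.functor.map₂ t) ▷ e)
        (Slice.Hom₂.ext h₁))
    · intro ψ' hψ'
      refine Slice.Hom₂.ext (hu _ ⟨?_, Slice.Hom₂.w ψ'⟩)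
      refine congrArg Slice.Hom₂.left (eq_of_heq (hC₂u (χ := ψ' ▷ fst') (χ' := χ) rfl rfl ?_))
      exact (efac₂ ψ').symm.trans ((heq_of_eq (congrArg Slice.Hom₂.left hψ')).trans hχ.symm)

end DependentProduct

end Slices

end TwoCat

/-! ### Congruence of rows, composites and transformations under equality of boundaries. -/

namespace VDGraph

variable {G : VDGraph.{w}}

/-- In contrast to `Row.snoc_heq`, the lower objects, the sides and the bottom boundary may vary
too. This is needed when functoriality, or the preservation of an index, holds only propositionally.
-/
theorem Row.snoc_hcongr {A B B' C₁ D₁ D₁' C₂ D₂ D₂' : G.Obj} {Γ₁ Γ₂ : HPath G.HHom A B}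
    {Γ₁' Γ₂' : HPath G.HHom B B'} {Γ₁'' Γ₂'' : HPath G.HHom A B'}
    {u₁ : A ⟶ C₁} {u₁' : B ⟶ D₁} {u₁'' : B' ⟶ D₁'} {u₂ : A ⟶ C₂} {u₂' : B ⟶ D₂} {u₂'' : B' ⟶ D₂'}
    {Δ₁ : HPath G.HHom C₁ D₁} {Δ₂ : HPath G.HHom C₂ D₂} {δ₁ : G.HHom D₁ D₁'} {δ₂ : G.HHom D₂ D₂'}
    {Θ₁ : G.Row Γ₁ u₁ u₁' Δ₁} {Θ₂ : G.Row Γ₂ u₂ u₂' Δ₂}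
    {θ₁ : G.Cell Γ₁' u₁' u₁'' δ₁} {θ₂ : G.Cell Γ₂' u₂' u₂'' δ₂}
    (h₁ : Γ₁.append Γ₁' = Γ₁'') (h₂ : Γ₂.append Γ₂' = Γ₂'')
    (hC : C₁ = C₂) (hD : D₁ = D₂) (hD' : D₁' = D₂') (hΓ : Γ₁ = Γ₂) (hΓ' : Γ₁' = Γ₂')
    (hu : HEq u₁ u₂) (hu' : HEq u₁' u₂') (hu'' : HEq u₁'' u₂'') (hΔ : HEq Δ₁ Δ₂) (hδ : HEq δ₁ δ₂)
    (hΘ : HEq Θ₁ Θ₂) (hθ : HEq θ₁ θ₂) :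
    HEq (Row.snoc Θ₁ θ₁ h₁) (Row.snoc Θ₂ θ₂ h₂) := by
  subst hC hD hD' hΓ hΓ' h₁ h₂
  cases hu
  cases hu'
  cases hu''
  cases hΔ
  cases hδ
  cases hΘ
  cases hθ
  rfl

theorem Row.nil_hcongr {A C₁ C₂ : G.Obj} {u₁ : A ⟶ C₁} {u₂ : A ⟶ C₂} (hC : C₁ = C₂)
    (hu : HEq u₁ u₂) : HEq (Row.nil (G := G) u₁) (Row.nil (G := G) u₂) := by
  subst hC
  cases hu
  rfl

end VDGraph

theorem VDOps.comp_hcongr (G : VDOps.{w}) {A B C₁ D₁ E₁ F₁ C₂ D₂ E₂ F₂ : G.Obj}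
    {Γ₁ Γ₂ : HPath G.HHom A B} {u₁ : A ⟶ C₁} {u₁' : B ⟶ D₁} {u₂ : A ⟶ C₂} {u₂' : B ⟶ D₂}
    {Δ₁ : HPath G.HHom C₁ D₁} {Δ₂ : HPath G.HHom C₂ D₂} {v₁ : C₁ ⟶ E₁} {v₁' : D₁ ⟶ F₁}
    {v₂ : C₂ ⟶ E₂} {v₂' : D₂ ⟶ F₂} {Λ₁ : G.HHom E₁ F₁} {Λ₂ : G.HHom E₂ F₂}
    {κ₁ : G.Cell Δ₁ v₁ v₁' Λ₁} {κ₂ : G.Cell Δ₂ v₂ v₂' Λ₂} {Θ₁ : G.Row Γ₁ u₁ u₁' Δ₁}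
    {Θ₂ : G.Row Γ₂ u₂ u₂' Δ₂} {w₁ : A ⟶ E₁} {w₁' : B ⟶ F₁} {w₂ : A ⟶ E₂} {w₂' : B ⟶ F₂}
    (hw₁ : u₁ ≫ v₁ = w₁) (hw₁' : u₁' ≫ v₁' = w₁') (hw₂ : u₂ ≫ v₂ = w₂) (hw₂' : u₂' ≫ v₂' = w₂')
    (hC : C₁ = C₂) (hD : D₁ = D₂) (hE : E₁ = E₂) (hF : F₁ = F₂)
    (hΓ : Γ₁ = Γ₂) (hu : HEq u₁ u₂) (hu' : HEq u₁' u₂') (hΔ : HEq Δ₁ Δ₂) (hv : HEq v₁ v₂)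
    (hv' : HEq v₁' v₂') (hΛ : HEq Λ₁ Λ₂) (hκ : HEq κ₁ κ₂) (hΘ : HEq Θ₁ Θ₂) :
    HEq (G.comp κ₁ Θ₁ hw₁ hw₁') (G.comp κ₂ Θ₂ hw₂ hw₂') := by
  subst hC hD hE hF hΓ
  cases hu
  cases hu'
  cases hΔ
  cases hv
  cases hv'
  cases hΛ
  cases hκ
  cases hΘ
  subst hw₁ hw₁' hw₂ hw₂'
  rfl

namespace VDMap

variable {A B : VDGraph.{w}}

theorem mapRow_append_heq (F : VDMap A B) {X Y Z W : A.Obj} {Γ : HPath A.HHom X Y} {u : X ⟶ Z}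
    {u' : Y ⟶ W} {Δ : HPath A.HHom Z W} (Θ : A.Row Γ u u' Δ) {Y' W' : A.Obj}
    {Γ' : HPath A.HHom Y Y'} {u'' : Y' ⟶ W'} {Δ' : HPath A.HHom W W'} (Ξ : A.Row Γ' u' u'' Δ') :
    HEq (F.mapRow (Θ.append Ξ)) ((F.mapRow Θ).append (F.mapRow Ξ)) := by
  induction Ξ with
  | nil => rfl
  | snoc Ξ θ h ih =>
    exact VDGraph.Row.snoc_heq _ _ (F.mapPath_append _ _) rfl (F.mapPath_append _ _) (ih Θ) HEq.rfl

/-- The action on two-storey arrangements. -/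
def mapTower (F : VDMap A B) {X Y Z W U V : A.Obj} {Γ : HPath A.HHom X Y} {a : X ⟶ Z} {a' : Y ⟶ W}
    {Δ : HPath A.HHom Z W} {b : Z ⟶ U} {b' : W ⟶ V} {Λ : HPath A.HHom U V} :
    A.Tower Γ a a' Δ b b' Λ → B.Tower (F.mapPath Γ) (F.vert.map a) (F.vert.map a') (F.mapPath Δ)
      (F.vert.map b) (F.vert.map b') (F.mapPath Λ)
  | .nil _ _ => .nil _ _
  | .snoc T Ξ θ hΓ hΔ => .snoc (mapTower F T) (F.mapRow Ξ) (F.mapCell θ)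
      ((F.mapPath_append _ _).symm.trans (congrArg F.mapPath hΓ))
      ((F.mapPath_append _ _).symm.trans (congrArg F.mapPath hΔ))

theorem mapTower_upper (F : VDMap A B) {X Y Z W U V : A.Obj} {Γ : HPath A.HHom X Y} {a : X ⟶ Z}
    {a' : Y ⟶ W} {Δ : HPath A.HHom Z W} {b : Z ⟶ U} {b' : W ⟶ V} {Λ : HPath A.HHom U V}
    (T : A.Tower Γ a a' Δ b b' Λ) : (F.mapTower T).upper = F.mapRow T.upper := by
  induction T with
  | nil => rfl
  | snoc T Ξ θ hΓ hΔ ih =>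
    subst hΓ hΔ
    apply eq_of_heq
    refine (VDGraph.Tower.upper_snoc_heq _ _ _ _ _).trans ?_
    rw [ih]
    exact (F.mapRow_append_heq _ _).symm

theorem mapTower_lower (F : VDMap A B) {X Y Z W U V : A.Obj} {Γ : HPath A.HHom X Y} {a : X ⟶ Z}
    {a' : Y ⟶ W} {Δ : HPath A.HHom Z W} {b : Z ⟶ U} {b' : W ⟶ V} {Λ : HPath A.HHom U V}
    (T : A.Tower Γ a a' Δ b b' Λ) : (F.mapTower T).lower = F.mapRow T.lower := by
  induction T with
  | nil => rfl
  | snoc T Ξ θ hΓ hΔ ih =>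
    change VDGraph.Row.snoc (F.mapTower T).lower _ _ = VDGraph.Row.snoc (F.mapRow T.lower) _ _
    rw [ih]

end VDMap

theorem VDFunctor.mapH_heq {A B : VDC.{w}} {F G : VDFunctor A B} (h : F = G) {X Y : A.Obj}
    (Γ : A.HHom X Y) : HEq (F.mapH Γ) (G.mapH Γ) := by
  subst h
  rfl

theorem VDFunctor.mapCell_heq_of_eq {A B : VDC.{w}} {F G : VDFunctor A B} (h : F = G)
    {X Y Z W : A.Obj} {Γ : HPath A.HHom X Y} {u : X ⟶ Z} {u' : Y ⟶ W} {Δ : A.HHom Z W}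
    (θ : A.Cell Γ u u' Δ) : HEq (F.mapCell θ) (G.mapCell θ) := by
  subst h
  rfl

theorem VertTrans.app_heq {A B : VDC.{w}} {F F' G G' : VDFunctor A B} {α : VertTrans F G}
    {β : VertTrans F' G'} (hF : F = F') (hG : G = G') (h : HEq α β) (X : A.Obj) :
    HEq (α.vert.app X) (β.vert.app X) := by
  subst hF hG
  cases h
  rfl

theorem VertTrans.cell_heq {A B : VDC.{w}} {F F' G G' : VDFunctor A B} {α : VertTrans F G}
    {β : VertTrans F' G'} (hF : F = F') (hG : G = G') (h : HEq α β) {X Y : A.Obj}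
    (Γ : A.HHom X Y) : HEq (α.cell Γ) (β.cell Γ) := by
  subst hF hG
  cases h
  rfl

theorem VertTrans.hext {A B : VDC.{w}} {F F' G G' : VDFunctor A B} {α : VertTrans F G}
    {β : VertTrans F' G'} (hF : F = F') (hG : G = G')
    (h : ∀ X, HEq (α.vert.app X) (β.vert.app X))
    (h' : ∀ {X Y : A.Obj} (Γ : A.HHom X Y), HEq (α.cell Γ) (β.cell Γ)) : HEq α β := by
  subst hF hG
  exact heq_of_eq (VertTrans.ext_heq (fun X => eq_of_heq (h X)) h')

namespace VDC

/-! ### Restriction along a functor into the vertical category, and its universal property. -/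

section Restrict

variable (A : VDC.{w}) {C : Type w} [Category.{w} C] (U : C ⥤ A.Obj)

/-- The data of the restriction of a virtual double category along a functor into its vertical
category. -/
abbrev restrictGraph : VDGraph.{w} where
  Obj := C
  HHom X Y := A.HHom (U.obj X) (U.obj Y)
  Cell Γ f f' Δ := A.Cell (Γ.map U.obj (fun _ _ e => e)) (U.map f) (U.map f') Δ

/-- The projection of the restriction, on underlying data. -/
abbrev restrictMap : VDMap (restrictGraph A U) A.toVDGraph where
  vert := U
  mapH Γ := Γ
  mapCell θ := θ

/-- The operations of the restriction. -/
abbrev restrictOps : VDOps.{w} where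
  toVDGraph := restrictGraph A U
  idc {X Y} Γ := A.castSides (U.map_id X).symm (U.map_id Y).symm (A.idc Γ)
  comp κ Θ _ _ hw hw' := A.comp κ ((restrictMap A U).mapRow Θ)
    (by rw [← hw, U.map_comp]) (by rw [← hw', U.map_comp])

/-- The sides on the left are images of identities under `U`, equal to identities only
propositionally; hence the heterogeneous form. -/
theorem restrictMap_idRow {X Y : C} (Δ : HPath (restrictGraph A U).HHom X Y) :
    HEq ((restrictMap A U).mapRow ((restrictOps A U).idRow Δ))
      (A.idRow ((restrictMap A U).mapPath Δ)) := by
  induction Δ with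
  | nil => exact VDGraph.Row.nil_hcongr rfl (heq_of_eq (U.map_id _))
  | snoc Δ δ ih =>
    exact VDGraph.Row.snoc_hcongr _ _ rfl rfl rfl rfl rfl (heq_of_eq (U.map_id _))
      (heq_of_eq (U.map_id _)) (heq_of_eq (U.map_id _)) HEq.rfl HEq.rfl ih
      (VDGraph.castSides_heq _ _ _)

theorem restrictMap_compRow {X Y Z W V V' : (restrictGraph A U).Obj} {Γ : HPath (restrictGraph A U).HHom X Y}
    {a : X ⟶ Z} {a' : Y ⟶ W} {Δ : HPath (restrictGraph A U).HHom Z W} {b : Z ⟶ V} {b' : W ⟶ V'}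
    {Λ : HPath (restrictGraph A U).HHom V V'} (T : (restrictGraph A U).Tower Γ a a' Δ b b' Λ) :
    HEq ((restrictMap A U).mapRow ((restrictOps A U).compRow T))
      (A.compRow ((restrictMap A U).mapTower T)) := by
  induction T with
  | nil a b => exact VDGraph.Row.nil_hcongr rfl (heq_of_eq (U.map_comp _ _))
  | snoc T Ξ θ hΓ hΔ ih =>
    exact VDGraph.Row.snoc_hcongr _ _ rfl rfl rfl rfl rfl (heq_of_eq (U.map_comp _ _))
      (heq_of_eq (U.map_comp _ _)) (heq_of_eq (U.map_comp _ _)) HEq.rfl HEq.rfl ih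
      (A.comp_hcongr _ _ _ _ rfl rfl rfl rfl rfl HEq.rfl HEq.rfl HEq.rfl HEq.rfl HEq.rfl HEq.rfl
        HEq.rfl HEq.rfl)

/-- The restriction of a virtual double category along a functor into its vertical category. -/
def restrict : VDC.{w} where
  toVDOps := restrictOps A U
  id_comp {X Y Z W Γ f f' δ} θ := by
    refine (VDOps.comp_castSides _ _ _ _ _ _ _).trans ?_
    exact A.id_comp (Γ := (restrictMap A U).mapPath Γ) θ
  comp_id {X Y Z W Δ v v' Λ} κ := by
    refine Eq.trans (eq_of_heq ?_) (A.comp_id (Δ := (restrictMap A U).mapPath Δ) κ)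
    exact A.comp_hcongr _ _ _ _ rfl rfl rfl rfl rfl (heq_of_eq (U.map_id _))
      (heq_of_eq (U.map_id _)) HEq.rfl HEq.rfl HEq.rfl HEq.rfl HEq.rfl (restrictMap_idRow A U Δ)
  assoc {_ _ _ _ _ _ _ _ Γ a a' Δ b b' Λ c c' l} κ T := by
    change A.comp (A.comp κ ((restrictMap A U).mapRow T.lower) _ _)
      ((restrictMap A U).mapRow T.upper) _ _ =
      A.comp κ ((restrictMap A U).mapRow ((restrictOps A U).compRow T)) _ _
    -- The images of the two storeys are the storeys of the image, so associativity in `A` applies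
    -- to the image of `T`.
    simp only [← VDMap.mapTower_upper, ← VDMap.mapTower_lower]
    refine (A.assoc_of_eq κ ((restrictMap A U).mapTower T) _ _ _ _).trans (eq_of_heq ?_)
    exact A.comp_hcongr _ _ _ _ rfl rfl rfl rfl rfl (heq_of_eq (U.map_comp _ _).symm)
      (heq_of_eq (U.map_comp _ _).symm) HEq.rfl HEq.rfl HEq.rfl HEq.rfl HEq.rfl
      (restrictMap_compRow A U T).symm

/-- The projection of the restriction. -/
def restrictProj : VDFunctor (A.restrict U) A where
  toVDMap := restrictMap A U
  map_idc _ := eq_of_heq ((VDGraph.castSides_heq _ _ _).trans (VDGraph.castSides_heq _ _ _))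
  map_comp _ _ := rfl

variable {A U} {Z : VDC.{w}}

/-- Horizontal morphisms and multicells of the restriction are those of `A` on the image boundary. A
lift of the vertical functor is thus the only datum missing: the action of `G` on the rest is
reused, up to transport of top boundaries. -/
theorem exists_restrictLift (G : VDFunctor Z A) (V : Z.Obj ⥤ C) (h : V ⋙ U = G.vert) :
    ∃ L : VDFunctor Z (A.restrict U), L.vert = V ∧ L.comp (A.restrictProj U) = G := by
  obtain ⟨⟨v, mH, mC⟩, h₁, h₂⟩ := G
  subst h
  let L : VDMap Z.toVDGraph (restrictGraph A U) :=
    { vert := V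
      mapH := mH
      mapCell := fun θ => A.castTop (HPath.map_map ..).symm (mC θ) }
  have hL : L.comp (restrictMap A U) = ⟨V ⋙ U, mH, mC⟩ := by
    change VDMap.mk _ _ _ = VDMap.mk _ _ _
    congr
    funext X Y Z W Γ f f' Δ θ
    exact eq_of_heq ((VDGraph.castTop_heq _ _).trans (VDGraph.castTop_heq _ _))
  have hrow : ∀ {X Y Z' W : Z.Obj} {Γ : HPath Z.HHom X Y} {f : X ⟶ Z'} {f' : Y ⟶ W}
      {Δ : HPath Z.HHom Z' W} (Θ : Z.Row Γ f f' Δ),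
      HEq ((restrictMap A U).mapRow (L.mapRow Θ)) (VDMap.mapRow ⟨V ⋙ U, mH, mC⟩ Θ) := by
    intro X Y Z' W Γ f f' Δ Θ
    rw [← hL]
    exact (VDMap.comp_mapRow_heq L (restrictMap A U) Θ).symm
  refine ⟨⟨L, ?_, ?_⟩, rfl, ?_⟩
  · intro X Y Γ
    apply eq_of_heq
    refine (VDGraph.castSides_heq (G := restrictGraph A U) _ _ _).trans ?_
    refine (VDGraph.castTop_heq (G := A.toVDGraph) (HPath.map_map ..).symm (mC (Z.idc Γ))).trans ?_
    refine HEq.trans ?_ (VDGraph.castSides_heq _ _ _).symm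
    exact (VDGraph.castSides_heq _ _ _).symm.trans (heq_of_eq (h₁ Γ))
  · intro X Y Z' W S T Γ f f' Δ v v' Λ κ Θ
    apply eq_of_heq
    refine (VDGraph.castTop_heq _ _).trans ?_
    refine (heq_of_eq (h₂ κ Θ)).trans ?_
    exact A.comp_heq _ _ (VDMap.comp_mapPath L (restrictMap A U) Γ)
      (VDMap.comp_mapPath L (restrictMap A U) Δ)
      (VDGraph.castTop_heq _ _).symm (hrow Θ).symm
  · exact VDFunctor.ext_cell (fun θ =>
      eq_of_heq ((VDGraph.castTop_heq _ _).trans (VDGraph.castTop_heq _ _)))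

/-- The projection is the identity on horizontal morphisms and multicells, so it loses only vertical
information, which `hv` supplies. -/
theorem restrict_hom_ext {L L' : VDFunctor Z (A.restrict U)} (hv : L.vert = L'.vert)
    (h : L.comp (A.restrictProj U) = L'.comp (A.restrictProj U)) : L = L' :=
  VDFunctor.ext_of hv (fun Γ => VDFunctor.mapH_heq h Γ) fun θ =>
    (VDMap.comp_mapCell_heq L.toVDMap (restrictMap A U) θ).symm.trans
      ((VDFunctor.mapCell_heq_of_eq h θ).trans
        (VDMap.comp_mapCell_heq L'.toVDMap (restrictMap A U) θ))

theorem restrictMap_transRow {L L' : VDFunctor Z (A.restrict U)} (ν : L.vert ⟶ L'.vert)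
    (α : VertTrans (L.comp (A.restrictProj U)) (L'.comp (A.restrictProj U)))
    (h : ∀ z, U.map (ν.app z) = α.vert.app z) {X Y : Z.Obj} (Γ : HPath Z.HHom X Y) :
    HEq ((restrictMap A U).mapRow (VDMap.transRow (F := L.toVDMap) (G := L'.toVDMap) ν
      (fun X Y e => A.castSides (h X).symm (h Y).symm (α.cell e)) Γ)) (α.row Γ) := by
  induction Γ with
  | nil => exact VDGraph.Row.nil_hcongr rfl (heq_of_eq (h _))
  | snoc Γ e ih =>
    exact VDGraph.Row.snoc_hcongr _ _ rfl rfl rfl (HPath.map_map ..) rfl (heq_of_eq (h _))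
      (heq_of_eq (h _)) (heq_of_eq (h _)) (heq_of_eq (HPath.map_map ..)) HEq.rfl ih
      (VDGraph.castSides_heq _ _ _)

/-- Vertical transformations into a restriction. -/
def restrictLift₂ {L L' : VDFunctor Z (A.restrict U)} (ν : L.vert ⟶ L'.vert)
    (α : VertTrans (L.comp (A.restrictProj U)) (L'.comp (A.restrictProj U)))
    (h : ∀ z, U.map (ν.app z) = α.vert.app z) : VertTrans L L' where
  vert := ν
  cell {X Y} Γ := A.castSides (h X).symm (h Y).symm (α.cell Γ)
  naturality {X Y X' Y' Γ f f' Δ} θ := by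
    apply eq_of_heq
    refine HEq.trans ?_ ((heq_of_eq (α.naturality θ)).trans ?_)
    · refine A.comp_hcongr _ _ _ _ rfl rfl rfl rfl (HPath.map_map ..) HEq.rfl HEq.rfl HEq.rfl
        (heq_of_eq (h _)) (heq_of_eq (h _)) HEq.rfl (VDGraph.castSides_heq _ _ _) ?_
      exact VDGraph.Row.snoc_hcongr _ _ rfl rfl rfl rfl (HPath.map_map ..) HEq.rfl HEq.rfl HEq.rfl
        HEq.rfl HEq.rfl HEq.rfl (VDMap.comp_mapCell_heq L.toVDMap (restrictMap A U) θ).symm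
    · exact A.comp_hcongr _ _ _ _ rfl rfl rfl rfl
        (VDMap.comp_mapPath L.toVDMap (restrictMap A U) Γ) (heq_of_eq (h _).symm)
        (heq_of_eq (h _).symm) (heq_of_eq (VDMap.comp_mapPath L'.toVDMap (restrictMap A U) Γ)) HEq.rfl HEq.rfl HEq.rfl
        (VDMap.comp_mapCell_heq L'.toVDMap (restrictMap A U) θ) (restrictMap_transRow ν α h Γ).symm

theorem restrictLift₂_whiskerRight {L L' : VDFunctor Z (A.restrict U)} (ν : L.vert ⟶ L'.vert)
    (α : VertTrans (L.comp (A.restrictProj U)) (L'.comp (A.restrictProj U)))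
    (h : ∀ z, U.map (ν.app z) = α.vert.app z) :
    VertTrans.whiskerRight (restrictLift₂ ν α h) (A.restrictProj U) = α :=
  VertTrans.ext_heq h fun _ => VDGraph.castSides_heq _ _ _

theorem restrict_hom₂_ext {L L' : VDFunctor Z (A.restrict U)} {α β : VertTrans L L'}
    (hv : ∀ z, α.vert.app z = β.vert.app z)
    (h : VertTrans.whiskerRight α (A.restrictProj U) = VertTrans.whiskerRight β (A.restrictProj U)) :
    α = β :=
  VertTrans.ext_heq hv fun Γ => VertTrans.cell_heq rfl rfl (heq_of_eq h) Γ

end Restrict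

end VDC

/-! ### Chaotic virtual double categories. -/

/-- Virtual double categories with exactly one horizontal morphism between any two objects and
exactly one multicell with any given boundary. -/
structure VDC.IsChaotic (B : VDC.{w}) : Prop where
  nonempty_hhom : ∀ X Y : B.Obj, Nonempty (B.HHom X Y)
  subsingleton_hhom : ∀ X Y : B.Obj, Subsingleton (B.HHom X Y)
  nonempty_cell : ∀ {X Y Z W : B.Obj} (Γ : HPath B.HHom X Y) (f : X ⟶ Z) (f' : Y ⟶ W)
    (Δ : B.HHom Z W), Nonempty (B.Cell Γ f f' Δ)
  subsingleton_cell : ∀ {X Y Z W : B.Obj} (Γ : HPath B.HHom X Y) (f : X ⟶ Z) (f' : Y ⟶ W)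
    (Δ : B.HHom Z W), Subsingleton (B.Cell Γ f f' Δ)

theorem VDC.isChaotic_hc (C : Type w) [Category.{w} C] : (VDC.hc C).IsChaotic where
  nonempty_hhom _ _ := ⟨PUnit.unit⟩
  subsingleton_hhom _ _ := inferInstanceAs (Subsingleton PUnit)
  nonempty_cell _ _ _ _ := ⟨PUnit.unit⟩
  subsingleton_cell _ _ _ _ := inferInstanceAs (Subsingleton PUnit)

/-- Existence and uniqueness hold entrywise. The instances that matter are matrices over
`(Set_*)_hc`, which receive the name of the projection, and matrices over `1`. -/
theorem VDC.IsChaotic.matrices {A : VDC.{u + 1}} (hA : A.IsChaotic) : A.matrices.IsChaotic where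
  nonempty_hhom _ _ := ⟨fun _ _ => (hA.nonempty_hhom _ _).some⟩
  subsingleton_hhom _ _ := ⟨fun _ _ => funext fun _ => funext fun _ =>
    (hA.subsingleton_hhom _ _).elim _ _⟩
  nonempty_cell _ _ _ _ := ⟨fun _ _ _ => (hA.nonempty_cell _ _ _ _).some⟩
  subsingleton_cell _ _ _ _ := ⟨fun _ _ => funext fun _ => funext fun _ => funext fun _ =>
    (hA.subsingleton_cell _ _ _ _).elim _ _⟩

namespace VDC.IsChaotic

variable {B Z : VDC.{w}}

/-- A chaotic target sees only the vertical functor. This reduces equations over `Set_hc`,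
`(Set_*)_hc` and `Mat 1` to equations between functors of categories. -/
theorem hom_ext (hB : B.IsChaotic) {F G : VDFunctor Z B} (h : F.vert = G.vert) : F = G := by
  obtain ⟨⟨v, k, c⟩, _, _⟩ := F
  obtain ⟨⟨v', k', c'⟩, _, _⟩ := G
  obtain rfl : v = v' := h
  obtain rfl : @k = @k' := by
    funext X Y Γ
    exact (hB.subsingleton_hhom _ _).elim _ _
  obtain rfl : @c = @c' := by
    funext X Y Z W Γ u u' Δ θ
    exact (hB.subsingleton_cell _ _ _ _).elim _ _
  rfl

theorem hom₂_ext (hB : B.IsChaotic) {F G : VDFunctor Z B} {α β : VertTrans F G}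
    (h : ∀ X, α.vert.app X = β.vert.app X) : α = β :=
  VertTrans.ext' (NatTrans.ext (funext h)) fun _ => (hB.subsingleton_cell _ _ _ _).elim _ _

/-- A virtual double functor into a chaotic virtual double category is a functor. -/
noncomputable def hom (hB : B.IsChaotic) (V : Z.Obj ⥤ B.Obj) : VDFunctor Z B where
  vert := V
  mapH _ := (hB.nonempty_hhom _ _).some
  mapCell _ := (hB.nonempty_cell _ _ _ _).some
  map_idc _ := (hB.subsingleton_cell _ _ _ _).elim _ _
  map_comp _ _ := (hB.subsingleton_cell _ _ _ _).elim _ _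

end VDC.IsChaotic

/-! ### 2-pullbacks computed on vertical categories. -/

/-- Strict pullback squares of categories, with their two-dimensional universal property. -/
structure IsCatPullback {C D₁ D₂ S : Type w} [Category.{w} C] [Category.{w} D₁] [Category.{w} D₂]
    [Category.{w} S] (U : C ⥤ D₁) (V : C ⥤ D₂) (g : D₁ ⥤ S) (p : D₂ ⥤ S) : Prop where
  w : U ⋙ g = V ⋙ p
  exists_lift : ∀ {D : Type w} [Category.{w} D] (a : D ⥤ D₁) (x : D ⥤ D₂), a ⋙ g = x ⋙ p →
    ∃ l : D ⥤ C, l ⋙ U = a ∧ l ⋙ V = x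
  hom_ext : ∀ {D : Type w} [Category.{w} D] {l l' : D ⥤ C}, l ⋙ U = l' ⋙ U → l ⋙ V = l' ⋙ V → l = l'
  exists_lift₂ : ∀ {D : Type w} [Category.{w} D] (l l' : D ⥤ C) (α : l ⋙ U ⟶ l' ⋙ U)
    (ξ : l ⋙ V ⟶ l' ⋙ V), (∀ d, HEq (g.map (α.app d)) (p.map (ξ.app d))) →
    ∃ χ : l ⟶ l', ∀ d, U.map (χ.app d) = α.app d ∧ V.map (χ.app d) = ξ.app d
  faithful : ∀ {c c' : C} {f f' : c ⟶ c'}, U.map f = U.map f' → V.map f = V.map f' → f = f'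

theorem CategoryTheory.heq_of_comp_eqToHom {C : Type u} [Category.{v} C] {a b a' b' : C}
    {f : a ⟶ b} {g : a' ⟶ b'} (h : b = b') (h' : a = a') (e : f ≫ eqToHom h = eqToHom h' ≫ g) :
    HEq f g := by
  subst h h'
  exact heq_of_eq (by simpa using e)

/-- The restriction along a pullback of vertical categories is a 2-pullback of virtual double
categories along a virtual double functor between chaotic ones. -/
theorem VDC.isTwoPullback_restrict {A B X : VDC.{w}} (hB : B.IsChaotic) (hX : X.IsChaotic)
    {C : Type w} [Category.{w} C] {U : C ⥤ A.Obj} (g : VDFunctor A X) (p : VDFunctor B X)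
    (snd : VDFunctor (A.restrict U) B)
    (H : IsCatPullback U (show C ⥤ B.Obj from snd.vert) g.vert p.vert) :
    TwoCat.IsTwoPullback (K := VDC.{w}) (A.restrictProj U) snd g p where
  w := hX.hom_ext H.w
  existsUnique_lift {Z} a x h := by
    have hv : a.vert ⋙ g.vert = x.vert ⋙ p.vert := congrArg (fun F : VDFunctor Z X => F.vert) h
    obtain ⟨l, hl₁, hl₂⟩ := H.exists_lift a.vert x.vert hv
    -- The vertical part of the lift comes from the pullback of categories and its multicells from
    -- `a`; the other projection imposes nothing more because `B` is chaotic.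
    obtain ⟨L, hL, hLa⟩ := VDC.exists_restrictLift a l hl₁
    refine ⟨L, ⟨hLa, hB.hom_ext ?_⟩, ?_⟩
    · change L.vert ⋙ snd.vert = x.vert
      rw [hL]
      exact hl₂
    · rintro L' ⟨h₁, h₂⟩
      refine VDC.restrict_hom_ext (H.hom_ext ?_ ?_) (h₁.trans hLa.symm)
      · exact (congrArg (fun F : VDFunctor Z A => F.vert) (h₁.trans hLa.symm))
      · rw [hL]
        exact (congrArg (fun F : VDFunctor Z B => F.vert) h₂).trans hl₂.symm
  existsUnique_lift₂ {Z} l l' α ξ h := by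
    have hh : HEq (Bicategory.whiskerRight α g) (Bicategory.whiskerRight ξ p) :=
      heq_of_comp_eqToHom _ _ h
    -- The boundaries of the two whiskered 2-cells agree, which allows `hh` to be read on
    -- components.
    have e : ∀ l : VDFunctor Z (A.restrict U), (l.comp (A.restrictProj U)).comp g =
        (l.comp snd).comp p := fun l => hX.hom_ext (congrArg (l.vert ⋙ ·) H.w)
    obtain ⟨χ, hχ⟩ := H.exists_lift₂ l.vert l'.vert α.vert ξ.vert
      (fun d => VertTrans.app_heq (e l) (e l') hh d)
    refine ⟨VDC.restrictLift₂ χ α (fun d => (hχ d).1), ⟨VDC.restrictLift₂_whiskerRight _ _ _,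
      hB.hom₂_ext fun d => (hχ d).2⟩, ?_⟩
    rintro χ' ⟨h₁, h₂⟩
    refine VDC.restrict_hom₂_ext (fun d => H.faithful ?_ ?_)
      (h₁.trans (VDC.restrictLift₂_whiskerRight _ _ _).symm)
    · exact (congrArg (fun t : VertTrans _ _ => t.vert.app d) h₁).trans (hχ d).1.symm
    · exact (congrArg (fun t : VertTrans _ _ => t.vert.app d) h₂).trans (hχ d).2.symm

/-- Objects of the strict pullback of categories. -/
@[ext]
structure CatPullback {D₁ D₂ S : Type w} [Category.{w} D₁] [Category.{w} D₂] [Category.{w} S]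
    (g : D₁ ⥤ S) (p : D₂ ⥤ S) : Type w where
  fst : D₁
  snd : D₂
  w : g.obj fst = p.obj snd

namespace CatPullback

variable {D₁ D₂ S : Type w} [Category.{w} D₁] [Category.{w} D₂] [Category.{w} S]
  (g : D₁ ⥤ S) (p : D₂ ⥤ S)

/-- Morphisms of the strict pullback of categories. -/
@[ext]
structure Hom (x y : CatPullback g p) : Type w where
  fst : x.fst ⟶ y.fst
  snd : x.snd ⟶ y.snd
  w : g.map fst ≫ eqToHom y.w = eqToHom x.w ≫ p.map snd

instance category : Category.{w} (CatPullback g p) where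
  Hom x y := Hom g p x y
  id x := ⟨𝟙 _, 𝟙 _, by simp⟩
  comp f f' := ⟨f.fst ≫ f'.fst, f.snd ≫ f'.snd, by
    rw [g.map_comp, p.map_comp, Category.assoc, f'.w, ← Category.assoc, f.w, Category.assoc]⟩
  id_comp _ := Hom.ext (Category.id_comp _) (Category.id_comp _)
  comp_id _ := Hom.ext (Category.comp_id _) (Category.comp_id _)
  assoc _ _ _ := Hom.ext (Category.assoc _ _ _) (Category.assoc _ _ _)

/-- The first projection. -/
def fstFunctor : CatPullback g p ⥤ D₁ where
  obj x := x.fst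
  map f := Hom.fst f

/-- The second projection. -/
def sndFunctor : CatPullback g p ⥤ D₂ where
  obj x := x.snd
  map f := Hom.snd f

theorem hom_heq {x y x' y' : CatPullback g p} {f : x ⟶ y} {f' : x' ⟶ y'} (hx : x = x')
    (hy : y = y') (h₁ : HEq (Hom.fst f) (Hom.fst f')) (h₂ : HEq (Hom.snd f) (Hom.snd f')) :
    HEq f f' := by
  subst hx hy
  exact heq_of_eq (Hom.ext (eq_of_heq h₁) (eq_of_heq h₂))

theorem isCatPullback : IsCatPullback (fstFunctor g p) (sndFunctor g p) g p where
  w := CategoryTheory.Functor.ext (fun x => x.w) fun x y f => by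
    have key : ∀ {a b a' b' : S} (f : a ⟶ b) (f' : a' ⟶ b') (e : a = a') (e' : b = b'),
        f ≫ eqToHom e' = eqToHom e ≫ f' → f = eqToHom e ≫ f' ≫ eqToHom e'.symm := by
      rintro a b _ _ f f' rfl rfl h
      simpa using h
    exact key _ _ _ _ (Hom.w f)
  exists_lift {D _} a x h :=
    ⟨{ obj := fun d => ⟨a.obj d, x.obj d, Functor.congr_obj h d⟩
       map := fun f => ⟨a.map f, x.map f, by
         have := Functor.congr_hom h f
         simp only [Functor.comp_map] at this
         rw [this]
         simp⟩
       map_id := fun _ => Hom.ext (a.map_id _) (x.map_id _)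
       map_comp := fun _ _ => Hom.ext (a.map_comp _ _) (x.map_comp _ _) }, rfl, rfl⟩
  hom_ext {D _ l l'} h₁ h₂ := by
    have e : ∀ d, l.obj d = l'.obj d := fun d =>
      CatPullback.ext (Functor.congr_obj h₁ d) (Functor.congr_obj h₂ d)
    exact CategoryTheory.Functor.hext e fun d d' f => hom_heq g p (e d) (e d')
      (Functor.hcongr_hom h₁ f) (Functor.hcongr_hom h₂ f)
  exists_lift₂ {D _} l l' α ξ h :=
    ⟨{ app := fun d => ⟨α.app d, ξ.app d, by
        have key : ∀ {a b a' b' : S} (f : a ⟶ b) (f' : a' ⟶ b') (e : a = a') (e' : b = b'),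
            HEq f f' → f ≫ eqToHom e' = eqToHom e ≫ f' := by
          rintro a b _ _ f f' rfl rfl h
          simpa using eq_of_heq h
        exact key _ _ _ _ (h d)⟩
       naturality := fun d d' f => Hom.ext (α.naturality f) (ξ.naturality f) },
      fun _ => ⟨rfl, rfl⟩⟩
  faithful h₁ h₂ := Hom.ext h₁ h₂

end CatPullback

/-- 2-pullbacks along virtual double functors between chaotic virtual double categories exist. -/
theorem VDC.exists_isTwoPullback {A B X : VDC.{w}} (hB : B.IsChaotic) (hX : X.IsChaotic)
    (g : A ⟶ X) (p : B ⟶ X) :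
    ∃ (P : VDC.{w}) (fst : P ⟶ A) (snd : P ⟶ B), TwoCat.IsTwoPullback fst snd g p :=
  ⟨A.restrict (CatPullback.fstFunctor g.vert p.vert), A.restrictProj _,
    hB.hom (CatPullback.sndFunctor g.vert p.vert),
    VDC.isTwoPullback_restrict hB hX g p _ (CatPullback.isCatPullback g.vert p.vert)⟩

/-! ### Pointed sets and categories of elements. -/

/-- The function underlying a morphism of `Set`. -/
def setFun {I J : ULiftHom.{u + 1} (Type u)} (f : I ⟶ J) (i : I.objDown) : J.objDown :=
  (f.down : I.objDown ⟶ J.objDown) i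

/-- The morphism of `Set` given by a function. -/
def setHom {I J : Type u} (f : I → J) :
    (ULiftHom.objUp.{u + 1} I) ⟶ (ULiftHom.objUp.{u + 1} J) := ⟨↾f⟩

@[simp]
theorem setFun_comp {I J K : ULiftHom.{u + 1} (Type u)} (f : I ⟶ J) (g : J ⟶ K) (i : I.objDown) :
    setFun (f ≫ g) i = setFun g (setFun f i) := rfl

/-- A functor to `Set` with a natural choice of elements gives a functor to pointed sets. -/
def mkPointed {D : Type (u + 1)} [Category.{u + 1} D] (F : D ⥤ ULiftHom.{u + 1} (Type u))
    (pt : ∀ d, (F.obj d).objDown) (nat : ∀ {d d' : D} (f : d ⟶ d'), setFun (F.map f) (pt d) = pt d') :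
    D ⥤ ULiftHom.{u + 1} Pointed.{u} where
  obj d := ULiftHom.objUp (⟨(F.obj d).objDown, pt d⟩ : Pointed.{u})
  map {d d'} f := ⟨(⟨setFun (F.map f), nat f⟩ : Pointed.Hom _ _)⟩
  map_id d := ULift.ext _ _ (Pointed.Hom.ext (by
    change setFun (F.map (𝟙 d)) = _
    rw [F.map_id]
    rfl))
  map_comp {x y z} f g := ULift.ext _ _ (Pointed.Hom.ext (by
    change setFun (F.map (f ≫ g)) = _
    rw [F.map_comp]
    rfl))

/-- The underlying functor of `P_hc`. -/
abbrev forgetPointed : ULiftHom.{u + 1} Pointed.{u} ⥤ ULiftHom.{u + 1} (Type u) :=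
  ULiftHom.down ⋙ forget Pointed.{u} ⋙ ULiftHom.up

/-- A lift of a functor through pointed sets carries exactly the data of a natural choice of
elements. -/
theorem exists_mkPointed {D : Type (u + 1)} [Category.{u + 1} D]
    (F : D ⥤ ULiftHom.{u + 1} (Type u)) (x : D ⥤ ULiftHom.{u + 1} Pointed.{u})
    (h : F = x ⋙ forgetPointed) : ∃ (pt : ∀ d, (F.obj d).objDown)
      (nat : ∀ {d d' : D} (f : d ⟶ d'), setFun (F.map f) (pt d) = pt d'), mkPointed F pt nat = x := by
  subst h
  exact ⟨fun d => Pointed.point (x.obj d).objDown, fun f => Pointed.Hom.map_point (x.map f).down, rfl⟩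

/-- Objects of the category of elements of a functor to `Set`. -/
structure Elt {D : Type (u + 1)} [Category.{u + 1} D] (b : D ⥤ ULiftHom.{u + 1} (Type u)) :
    Type (u + 1) where
  base : D
  pt : (b.obj base).objDown

namespace Elt

variable {D : Type (u + 1)} [Category.{u + 1} D] (b : D ⥤ ULiftHom.{u + 1} (Type u))

/-- Morphisms of the category of elements. -/
@[ext]
structure Hom (x y : Elt b) : Type (u + 1) where
  base : x.base ⟶ y.base
  w : setFun (b.map base) x.pt = y.pt

instance category : Category.{u + 1} (Elt b) where
  Hom x y := Hom b x y
  id x := ⟨𝟙 _, by rw [b.map_id]; rfl⟩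
  comp f g := ⟨f.base ≫ g.base, by rw [b.map_comp, setFun_comp, f.w, g.w]⟩
  id_comp _ := Hom.ext (Category.id_comp _)
  comp_id _ := Hom.ext (Category.comp_id _)
  assoc _ _ _ := Hom.ext (Category.assoc _ _ _)

/-- The projection of the category of elements. -/
abbrev proj : Elt b ⥤ D where
  obj x := x.base
  map f := Hom.base f

/-- The functor from the category of elements to pointed sets. -/
def toPointed : Elt b ⥤ ULiftHom.{u + 1} Pointed.{u} :=
  mkPointed (proj b ⋙ b) (fun x => x.pt) (fun f => Hom.w f)

theorem obj_ext {x y : Elt b} (h : x.base = y.base) (h' : HEq x.pt y.pt) : x = y := by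
  obtain ⟨_, _⟩ := x
  obtain ⟨_, _⟩ := y
  obtain rfl := h
  cases h'
  rfl

theorem hom_heq {x y x' y' : Elt b} {f : x ⟶ y} {f' : x' ⟶ y'} (hx : x = x')
    (hy : y = y') (h : HEq (Hom.base f) (Hom.base f')) : HEq f f' := by
  subst hx hy
  exact heq_of_eq (Hom.ext (eq_of_heq h))

/-- By `exists_mkPointed`, a functor to pointed sets lying over `b` is a natural choice of elements.
This model of the pullback stores an element in place of a pointed set together with an equation of
underlying sets, which keeps the families of elements below explicit. -/
theorem isCatPullback : IsCatPullback (proj b) (toPointed b) b forgetPointed where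
  w := rfl
  exists_lift a x h := by
    obtain ⟨pt, nat, rfl⟩ := exists_mkPointed (a ⋙ b) x h
    exact ⟨{ obj := fun d => ⟨a.obj d, pt d⟩
             map := fun f => ⟨a.map f, nat f⟩
             map_id := fun _ => Hom.ext (a.map_id _)
             map_comp := fun _ _ => Hom.ext (a.map_comp _ _) }, rfl, rfl⟩
  hom_ext {D _ l l'} h₁ h₂ := by
    have hp : ∀ {x y : Pointed.{u}}, x = y → HEq x.point y.point := by
      rintro x _ rfl
      rfl
    have e : ∀ d, l.obj d = l'.obj d := fun d =>
      obj_ext b (Functor.congr_obj h₁ d) (hp (Functor.congr_obj h₂ d))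
    exact CategoryTheory.Functor.hext e fun d d' f => hom_heq b (e d) (e d')
      (Functor.hcongr_hom h₁ f)
  exists_lift₂ l l' α ξ h := by
    have e : ∀ d, setFun (b.map (α.app d)) = Pointed.Hom.toFun (ξ.app d).down := fun d =>
      congrArg setFun (eq_of_heq (h d))
    exact ⟨{ app := fun d => ⟨α.app d, (congrFun (e d) _).trans
               (Pointed.Hom.map_point (ξ.app d).down)⟩
             naturality := fun _ _ f => Hom.ext (α.naturality f) },
      fun d => ⟨rfl, ULift.ext _ _ (Pointed.Hom.ext (e d))⟩⟩
  faithful h _ := Hom.ext h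

end Elt

namespace VDC

theorem isChaotic_SetHc : SetHc.{u}.IsChaotic := isChaotic_hc _

theorem isChaotic_PointedHc : PointedHc.{u}.IsChaotic := isChaotic_hc _

/-- The functor to `Set` underlying a virtual double functor to `Set_hc`. -/
abbrev setFunctor {X : VDC.{u + 1}} (b : VDFunctor X SetHc.{u}) :
    X.Obj ⥤ ULiftHom.{u + 1} (Type u) := b.vert

/-- The virtual double category of elements of a virtual double functor to `Set_hc`. -/
def elements {X : VDC.{u + 1}} (b : VDFunctor X SetHc.{u}) : VDC.{u + 1} :=
  X.restrict (Elt.proj (setFunctor b))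

/-- The projection of the virtual double category of elements. -/
def elementsProj {X : VDC.{u + 1}} (b : VDFunctor X SetHc.{u}) : VDFunctor (elements b) X :=
  X.restrictProj (Elt.proj (setFunctor b))

/-- The virtual double functor from the virtual double category of elements to `(Set_*)_hc`. -/
def elementsPt {X : VDC.{u + 1}} (b : VDFunctor X SetHc.{u}) :
    VDFunctor (elements b) PointedHc.{u} where
  vert := Elt.toPointed (setFunctor b)
  mapH _ := PUnit.unit
  mapCell _ := PUnit.unit
  map_idc _ := rfl
  map_comp _ _ := rfl

theorem isTwoPullback_elements {X : VDC.{u + 1}} (b : VDFunctor X SetHc.{u}) :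
    TwoCat.IsTwoPullback (K := VDC.{u + 1}) (elementsProj b) (elementsPt b) b Phc.{u} :=
  isTwoPullback_restrict isChaotic_PointedHc isChaotic_SetHc b Phc.{u} (elementsPt b)
    (Elt.isCatPullback (setFunctor b))

/-- Pullback along `P_hc`, with the virtual double categories of elements as values. -/
noncomputable def pullbackPhc : TwoCat.PullbackFunctor Phc.{u} :=
  .ofPullbacks _ (fun b => ⟨elements b.hom, elementsPt b.hom⟩) (fun b => elementsProj b.hom)
    (fun b => isTwoPullback_elements b.hom)

/-- Pullback along the virtual double functor from a chaotic virtual double category to another. -/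
noncomputable def pullbackOfChaotic {B X : VDC.{w}} (hB : B.IsChaotic) (hX : X.IsChaotic)
    (p : B ⟶ X) : TwoCat.PullbackFunctor p :=
  .ofPullbacks p (fun b => ⟨_, (exists_isTwoPullback hB hX b.hom p).choose_spec.choose_spec.choose⟩)
    (fun b => (exists_isTwoPullback hB hX b.hom p).choose_spec.choose)
    (fun b => (exists_isTwoPullback hB hX b.hom p).choose_spec.choose_spec.choose_spec)

end VDC

/-! ### Functoriality of virtual double categories of elements. -/

namespace VDC

section ElementsMap

variable {X Y : VDC.{u + 1}} {b : VDFunctor X SetHc.{u}} {b' : VDFunctor Y SetHc.{u}}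

/-- The functor between categories of elements induced by a functor and a natural transformation
to `Set`. -/
def eltMap (f : VDFunctor X Y) (ν : setFunctor b ⟶ f.vert ⋙ setFunctor b') :
    Elt (setFunctor b) ⥤ Elt (setFunctor b') where
  obj x := ⟨f.vert.obj x.base, setFun (ν.app x.base) x.pt⟩
  map {x y} g := ⟨f.vert.map (Elt.Hom.base g), by
    have e := congrArg (fun m => setFun m x.pt) (ν.naturality (Elt.Hom.base g))
    exact e.symm.trans (congrArg (setFun (ν.app y.base)) (Elt.Hom.w g))⟩
  map_id _ := Elt.Hom.ext (f.vert.map_id _)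
  map_comp _ _ := Elt.Hom.ext (f.vert.map_comp _ _)

theorem mapPath_eltMap (f : VDFunctor X Y) (ν : setFunctor b ⟶ f.vert ⋙ setFunctor b') {x y : (elements b).Obj}
    (Γ : HPath (elements b).HHom x y) :
    ((elementsProj b').mapPath (Γ.map (eltMap f ν).obj (fun _ _ e => f.mapH e))) =
      f.mapPath ((elementsProj b).mapPath Γ) := by
  induction Γ with
  | nil => rfl
  | snoc Γ e ih => exact congrArg (fun p => HPath.snoc p _) ih

/-- The virtual double functor between virtual double categories of elements, on underlying data. -/
abbrev elementsMapData (f : VDFunctor X Y) (ν : setFunctor b ⟶ f.vert ⋙ setFunctor b') :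
    VDMap (elements b).toVDGraph (elements b').toVDGraph where
  vert := eltMap f ν
  mapH e := f.mapH e
  mapCell {_ _ _ _ Γ _ _ _} θ := Y.castTop (mapPath_eltMap f ν Γ).symm
    (f.mapCell ((elementsProj b).mapCell θ))

theorem mapRow_elementsMapData (f : VDFunctor X Y) (ν : setFunctor b ⟶ f.vert ⋙ setFunctor b') {x y z t : (elements b).Obj}
    {Γ : HPath (elements b).HHom x y} {g : x ⟶ z} {g' : y ⟶ t} {Δ : HPath (elements b).HHom z t}
    (Θ : (elements b).Row Γ g g' Δ) :
    HEq ((elementsProj b').mapRow ((elementsMapData f ν).mapRow Θ))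
      (f.mapRow ((elementsProj b).mapRow Θ)) := by
  induction Θ with
  | nil => rfl
  | snoc Θ θ h ih =>
    exact VDGraph.Row.snoc_heq _ _ (mapPath_eltMap f ν _) (mapPath_eltMap f ν _)
      (mapPath_eltMap f ν _) ih (VDGraph.castTop_heq _ _)

/-- The virtual double functor between virtual double categories of elements induced by a virtual
double functor and a natural transformation to `Set`. -/
def elementsMapOf (f : VDFunctor X Y) (ν : setFunctor b ⟶ f.vert ⋙ setFunctor b') : VDFunctor (elements b) (elements b') where
  toVDMap := elementsMapData f ν
  map_idc {x y} Γ := by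
    apply eq_of_heq
    refine (VDGraph.castSides_heq _ _ _).trans ?_
    refine (VDGraph.castTop_heq (G := Y.toVDGraph) (mapPath_eltMap f ν (HPath.single Γ)).symm
      (f.mapCell ((elementsProj b).mapCell ((elements b).idc Γ)))).trans ?_
    refine HEq.trans ?_ ((VertTrans.map_idc_heq f (X := x.base) (Y := y.base) Γ).trans
      (VertTrans.map_idc_heq (elementsProj b') ((elementsMapData f ν).mapH Γ)).symm)
    exact f.mapCell_heq_sides rfl rfl (VertTrans.map_idc_heq (elementsProj b) Γ)
  map_comp {_ _ _ _ _ _ Γ _ _ Δ _ _ _} κ Θ := by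
    apply eq_of_heq
    refine (VDGraph.castTop_heq (G := Y.toVDGraph) _ _).trans ?_
    refine (heq_of_eq (f.map_comp_of_eq _ _ _ _)).trans ?_
    exact Y.comp_heq _ _ (mapPath_eltMap f ν Γ).symm (mapPath_eltMap f ν Δ).symm
      (VDGraph.castTop_heq _ _).symm (mapRow_elementsMapData f ν Θ).symm

theorem elementsMapOf_comp_proj (f : VDFunctor X Y) (ν : setFunctor b ⟶ f.vert ⋙ setFunctor b') :
    (elementsMapOf f ν).comp (elementsProj b') = (elementsProj b).comp f :=
  VDFunctor.ext_cell fun _ => eq_of_heq ((VDMap.comp_mapCell_heq _ _ _).trans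
    ((VDGraph.castTop_heq (G := Y.toVDGraph) _ _).trans (VDMap.comp_mapCell_heq _ _ _).symm))

theorem setObj_eq {f : VDFunctor X Y} (w : f.comp b' = b) (x : X.Obj) :
    ((setFunctor b).obj x).objDown = ((setFunctor b').obj (f.vert.obj x)).objDown :=
  congrArg ULiftHom.objDown
    (congrArg (fun F : VDFunctor X SetHc.{u} => (setFunctor F).obj x) w).symm

/-- The natural transformation with identity components. -/
def overTrans {f : VDFunctor X Y} (w : f.comp b' = b) : setFunctor b ⟶ f.vert ⋙ setFunctor b' where
  app x := ⟨↾cast (setObj_eq w x)⟩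
  naturality x y g := by
    subst w
    rfl

/-- The virtual double functor between virtual double categories of elements induced by a virtual
double functor over `Set_hc`. -/
def elementsMap (f : VDFunctor X Y) (w : f.comp b' = b) : VDFunctor (elements b) (elements b') :=
  elementsMapOf f (overTrans w)

theorem elementsMap_comp_proj (f : VDFunctor X Y) (w : f.comp b' = b) :
    (elementsMap f w).comp (elementsProj b') = (elementsProj b).comp f :=
  elementsMapOf_comp_proj f (overTrans w)

theorem elementsMap_comp_pt (f : VDFunctor X Y) (w : f.comp b' = b) :
    (elementsMap f w).comp (elementsPt b') = elementsPt b := by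
  subst w
  exact isChaotic_PointedHc.hom_ext rfl

end ElementsMap

/-- The 2-functor `pullbackPhc` acts on 1-cells through a choice of factorizations. Both sides have
the same projections to the 2-pullback, whose universal property identifies the chosen 1-cell with
the explicit one. -/
theorem pullbackPhc_map {b b' : TwoCat.Slice SetHc.{u}} (f : b ⟶ b') :
    TwoCat.Slice.Hom.left (pullbackPhc.functor.map f) =
      elementsMap (TwoCat.Slice.Hom.left f) (TwoCat.Slice.Hom.w f) := by
  refine ((isTwoPullback_elements b'.hom).existsUnique_lift
    ((elementsProj b.hom).comp (TwoCat.Slice.Hom.left f)) (elementsPt b.hom) ?_).unique ⟨?_, ?_⟩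
    ⟨elementsMap_comp_proj _ _, elementsMap_comp_pt _ _⟩
  · refine Eq.trans ?_ (isTwoPullback_elements b.hom).w
    exact (VDFunctor.comp_assoc _ _ _).trans
      (congrArg (elementsProj b.hom).comp (TwoCat.Slice.Hom.w f))
  · exact pullbackPhc.proj.naturality f
  · exact TwoCat.Slice.Hom.w (pullbackPhc.functor.map f)

section ElementsMap₂

variable {X Y : VDC.{u + 1}} {b : VDFunctor X SetHc.{u}} {b' : VDFunctor Y SetHc.{u}}

/-- Over `Set_hc` the transformation is an identity, so its components fix elements up to the casts.
This is why `α` lifts to virtual double categories of elements. -/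
theorem setFun_app {f g : VDFunctor X Y} (w : f.comp b' = b) (w' : g.comp b' = b)
    (α : VertTrans f g) (h : HEq (VertTrans.whiskerRight α b') (VertTrans.id b)) (x : X.Obj)
    (i : ((setFunctor b).obj x).objDown) :
    setFun ((setFunctor b').map (α.vert.app x)) (cast (setObj_eq w x) i) =
      cast (setObj_eq w' x) i := by
  have e := VertTrans.app_heq w w' h x
  have key : ∀ {I J K : ULiftHom.{u + 1} (Type u)} (m : J ⟶ K) (hJ : J = I) (hK : K = I)
      (_ : HEq m (𝟙 I)) (i : I.objDown), setFun m (cast (congrArg ULiftHom.objDown hJ.symm) i) =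
        cast (congrArg ULiftHom.objDown hK.symm) i := by
    rintro I _ _ m rfl rfl h i
    cases h
    rfl
  exact key _ (congrArg (fun F : VDFunctor X SetHc.{u} => (setFunctor F).obj x) w)
    (congrArg (fun F : VDFunctor X SetHc.{u} => (setFunctor F).obj x) w') e i

/-- The projection of the vertical transformation between virtual double functors of elements. -/
def elementsTrans {f g : VDFunctor X Y} (w : f.comp b' = b) (w' : g.comp b' = b)
    (α : VertTrans f g) : VertTrans ((elementsMap f w).comp (elementsProj b'))
      ((elementsMap g w').comp (elementsProj b')) :=
  let α' : (elementsProj b).comp f ⟶ (elementsProj b).comp g :=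
    VertTrans.whiskerLeft (elementsProj b) α
  eqToHom (elementsMap_comp_proj f w) ≫ α' ≫ eqToHom (elementsMap_comp_proj g w').symm

theorem elementsTrans_heq {f g : VDFunctor X Y} (w : f.comp b' = b) (w' : g.comp b' = b)
    (α : VertTrans f g) :
    HEq (elementsTrans w w' α) (VertTrans.whiskerLeft (elementsProj b) α) :=
  TwoCat.eqToHom_conj_heq (K := VDC.{u + 1}) (elementsMap_comp_proj f w) _
    (elementsMap_comp_proj g w').symm

theorem elementsTrans_app {f g : VDFunctor X Y} (w : f.comp b' = b) (w' : g.comp b' = b)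
    (α : VertTrans f g) (x : (elements b).Obj) :
    α.vert.app x.base = (elementsTrans w w' α).vert.app x :=
  (eq_of_heq (VertTrans.app_heq (elementsMap_comp_proj f w) (elementsMap_comp_proj g w')
    (elementsTrans_heq w w' α) x)).symm

/-- The vertical transformation between virtual double functors of elements. -/
def elementsMap₂ {f g : VDFunctor X Y} (w : f.comp b' = b) (w' : g.comp b' = b)
    (α : VertTrans f g) (h : HEq (VertTrans.whiskerRight α b') (VertTrans.id b)) :
    VertTrans (elementsMap f w) (elementsMap g w') :=
  restrictLift₂ (A := Y) (U := Elt.proj (setFunctor b'))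
    (L := elementsMap f w) (L' := elementsMap g w')
    { app := fun x => ⟨α.vert.app x.base, setFun_app w w' α h x.base x.pt⟩
      naturality := fun _ _ u => Elt.Hom.ext (α.vert.naturality (Elt.Hom.base u)) }
    (elementsTrans w w' α) (elementsTrans_app w w' α)

theorem elementsMap₂_whiskerRight {f g : VDFunctor X Y} (w : f.comp b' = b) (w' : g.comp b' = b)
    (α : VertTrans f g) (h : HEq (VertTrans.whiskerRight α b') (VertTrans.id b)) :
    HEq (VertTrans.whiskerRight (elementsMap₂ w w' α h) (elementsProj b'))
      (VertTrans.whiskerLeft (elementsProj b) α) :=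
  (heq_of_eq (restrictLift₂_whiskerRight (A := Y) (U := Elt.proj (setFunctor b'))
    (L := elementsMap f w) (L' := elementsMap g w') _ (elementsTrans w w' α)
    (elementsTrans_app w w' α))).trans (elementsTrans_heq w w' α)

theorem elementsMap₂_cell {f g : VDFunctor X Y} (w : f.comp b' = b) (w' : g.comp b' = b)
    (α : VertTrans f g) (h : HEq (VertTrans.whiskerRight α b') (VertTrans.id b))
    {x y : (elements b).Obj} (Γ : (elements b).HHom x y) :
    HEq ((elementsMap₂ w w' α h).cell Γ) (α.cell (X := x.base) (Y := y.base) Γ) :=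
  VertTrans.cell_heq (elementsMap_comp_proj f w) (elementsMap_comp_proj g w')
    (elementsMap₂_whiskerRight w w' α h) Γ

end ElementsMap₂

theorem slice_whiskerRight_heq {b b' : TwoCat.Slice SetHc.{u}} {f g : b ⟶ b'} (α : f ⟶ g) :
    HEq (VertTrans.whiskerRight (TwoCat.Slice.Hom₂.left α) b'.hom) (VertTrans.id b.hom) :=
  (heq_of_eq (TwoCat.Slice.Hom₂.w α)).trans
    (TwoCat.eqToHom_heq_eqToHom (K := VDC.{u + 1}) (TwoCat.Slice.Hom.w f) _ rfl)

/-- Both sides project to the same 2-cell. Vertical morphisms of a category of elements are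
determined by their projections, and cells of the restriction are cells of the base, so the
projections decide. -/
theorem pullbackPhc_map₂ {b b' : TwoCat.Slice SetHc.{u}} {f g : b ⟶ b'} (α : f ⟶ g) :
    HEq (TwoCat.Slice.Hom₂.left (pullbackPhc.functor.map₂ α))
      (elementsMap₂ (TwoCat.Slice.Hom.w f) (TwoCat.Slice.Hom.w g) (TwoCat.Slice.Hom₂.left α)
        (slice_whiskerRight_heq α)) := by
  have h₁ : HEq (VertTrans.whiskerRight (TwoCat.Slice.Hom₂.left (pullbackPhc.functor.map₂ α))
      (elementsProj b'.hom)) (VertTrans.whiskerLeft (elementsProj b.hom) (TwoCat.Slice.Hom₂.left α)) :=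
    pullbackPhc.proj.naturality₂_heq α
  have e : ∀ f : b ⟶ b', (TwoCat.Slice.Hom.left (pullbackPhc.functor.map f)).comp
      (elementsProj b'.hom) = (elementsProj b.hom).comp (TwoCat.Slice.Hom.left f) :=
    fun f => pullbackPhc.proj.naturality f
  have h₂ := h₁.trans (elementsMap₂_whiskerRight (TwoCat.Slice.Hom.w f) (TwoCat.Slice.Hom.w g)
    (TwoCat.Slice.Hom₂.left α) (slice_whiskerRight_heq α)).symm
  refine VertTrans.hext (pullbackPhc_map f) (pullbackPhc_map g) (fun x => ?_) (fun {x y} Γ => ?_)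
  · exact Elt.hom_heq _ (congrArg (fun F : VDFunctor _ _ => F.vert.obj x) (pullbackPhc_map f))
      (congrArg (fun F : VDFunctor _ _ => F.vert.obj x) (pullbackPhc_map g))
      (VertTrans.app_heq ((e f).trans (elementsMap_comp_proj _ _).symm)
        ((e g).trans (elementsMap_comp_proj _ _).symm) h₂ x)
  · exact VertTrans.cell_heq ((e f).trans (elementsMap_comp_proj _ _).symm)
        ((e g).trans (elementsMap_comp_proj _ _).symm) h₂ Γ

end VDC

/-! ### Heterogeneous equality of transformations and cells of matrices. -/

namespace VDMat

variable {X : VDC.{u + 1}} {A B : VDC.{u + 1}}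

/-- The index sequences of a single matrix are the pairs `(i, j)`, so a transformation is determined
by its index functions, its vertical entries and its cells at these pairs. The indices are related
by `HEq` because the boundary functors agree only propositionally. -/
theorem vertTrans_hext {F F' G G' : VDFunctor X A.matrices} {α : VertTrans F G}
    {β : VertTrans F' G'} (hF : F = F') (hG : G = G')
    (hidx : ∀ (x : X.Obj) (i : (F.vert.obj x).I) (i' : (F'.vert.obj x).I), HEq i i' →
      HEq (VHom.idx (α.vert.app x) i) (VHom.idx (β.vert.app x) i'))
    (hmap : ∀ (x : X.Obj) (i : (F.vert.obj x).I) (i' : (F'.vert.obj x).I), HEq i i' →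
      HEq (VHom.map (α.vert.app x) i) (VHom.map (β.vert.app x) i'))
    (hcell : ∀ {x y : X.Obj} (Γ : X.HHom x y) (i : (F.vert.obj x).I) (i' : (F'.vert.obj x).I)
      (j : (F.vert.obj y).I) (j' : (F'.vert.obj y).I), HEq i i' → HEq j j' →
      HEq (α.cell Γ i j (.snoc (.nil i) j)) (β.cell Γ i' j' (.snoc (.nil i') j'))) : HEq α β := by
  subst hF hG
  have e : ∀ x, α.vert.app x = β.vert.app x := fun x =>
    VHom.ext (funext fun i => eq_of_heq (hidx x i i HEq.rfl))
      (Function.hfunext rfl fun i i' h => hmap x i i' h)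
  refine heq_of_eq (VertTrans.ext_heq e fun {x y} Γ => ?_)
  have key : ∀ {a b c d : (graph A).Obj} {p : HPath (graph A).HHom a b} {f g : a ⟶ c} {f' g' : b ⟶ d}
      {Δ : (graph A).HHom c d} {θ : (graph A).Cell p f f' Δ} {θ' : (graph A).Cell p g g' Δ}, f = g →
      f' = g' → (∀ i j s, HEq (θ i j s) (θ' i j s)) → HEq θ θ' := by
    rintro a b c d p f _ f' _ Δ θ θ' rfl rfl h
    exact heq_of_eq (funext fun i => funext fun j => funext fun s => eq_of_heq (h i j s))
  refine key (e x) (e y) fun i j s => ?_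
  obtain rfl := Ix.single_eq s
  exact hcell Γ i i j j HEq.rfl HEq.rfl

theorem Ix.snoc_hcongr {X Y Z : Obj A} {Γ : HPath (HHom (A := A)) X Y} {g : HHom Y Z} {i i' : X.I}
    {j j' : Y.I} {k k' : Z.I} {s : Ix Γ i j} {s' : Ix Γ i' j'} (hi : i = i') (hj : j = j')
    (hk : k = k') (hs : HEq s s') : HEq (Ix.snoc (g := g) s k) (Ix.snoc (g := g) s' k') := by
  subst hi hj hk
  cases hs
  rfl

theorem Ix.eval_hcongr {X Y : Obj A} {Γ : HPath (HHom (A := A)) X Y} {i i' : X.I} {j j' : Y.I}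
    {s : Ix Γ i j} {s' : Ix Γ i' j'} (hi : i = i') (hj : j = j') (hs : HEq s s') :
    HEq s.eval s'.eval := by
  subst hi hj
  cases hs
  rfl

theorem hhom_heq {X Y : Obj A} (Γ : HHom X Y) {i i' : X.I} {j j' : Y.I} (hi : i = i')
    (hj : j = j') : HEq (Γ i j) (Γ i' j') := by
  subst hi hj
  rfl

theorem map_heq {X Y : Obj A} (f : X ⟶ Y) {i i' : X.I} (hi : i = i') :
    HEq (VHom.map f i) (VHom.map f i') := by
  subst hi
  rfl

theorem cell_heq {X Y Z W : (graph A).Obj} {Γ : HPath (graph A).HHom X Y} {f : X ⟶ Z} {f' : Y ⟶ W}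
    {Δ : (graph A).HHom Z W} (θ : (graph A).Cell Γ f f' Δ) {i i' : X.I} {j j' : Y.I} {s : Ix Γ i j}
    {s' : Ix Γ i' j'} (hi : i = i') (hj : j = j') (hs : HEq s s') :
    HEq (θ i j s) (θ i' j' s') := by
  subst hi hj
  cases hs
  rfl

theorem castSides_at_heq {a b c d : (graph A).Obj} {p : HPath (graph A).HHom a b} {f g : a ⟶ c}
    {f' g' : b ⟶ d} (h : f = g) (h' : f' = g') {Δ : (graph A).HHom c d}
    (θ : (graph A).Cell p f f' Δ) {i : a.I} {j : b.I} (s : Ix p i j) :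
    HEq ((graph A).castSides h h' θ i j s) (θ i j s) := by
  subst h h'
  rfl

theorem comp_at_heq {X Y Z W E F : (graph A).Obj} {Γ : HPath (graph A).HHom X Y} {u : X ⟶ Z}
    {u' : Y ⟶ W} {Δ : HPath (graph A).HHom Z W} {v : Z ⟶ E} {v' : W ⟶ F} {Λ : (graph A).HHom E F}
    (κ : (graph A).Cell Δ v v' Λ) (Θ : (graph A).Row Γ u u' Δ) {w : X ⟶ E} {w' : Y ⟶ F}
    (h : u ≫ v = w) (h' : u' ≫ v' = w') {i : X.I} {k : Y.I} (s : Ix Γ i k) :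
    HEq ((ops A).comp κ Θ h h' i k s)
      (A.comp (κ _ _ (rowAt Θ s).1) (rowAt Θ s).2 rfl rfl) :=
  castSides_at_heq h h' _ s

end VDMat

namespace VDC

/-- The virtual double functor sending a family to its index set. -/
def matrixIndex (A : VDC.{u + 1}) : VDFunctor A.matrices SetHc.{u} where
  vert := { obj := fun X => ULiftHom.objUp (VDMat.Obj.I X)
            map := fun f => setHom (VDMat.VHom.idx f) }
  mapH _ := PUnit.unit
  mapCell _ := PUnit.unit
  map_idc _ := rfl
  map_comp _ _ := rfl

/-- The virtual double functor sending a family to its index set, through the families of objects of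
the terminal virtual double category. -/
abbrev familyIndex (A : VDC.{u + 1}) : VDFunctor A.matrices SetHc.{u} :=
  (VDMat.map (oneTerminal.toHom A)).comp (matrixIndex one)

/-- The 2-functor `Mat`, with values in virtual double categories over `Set_hc`. -/
def MatOver : StrictPseudofunctor VDC.{u + 1} (TwoCat.Slice SetHc.{u}) :=
  (TwoCat.overTerminal Mat.{u} oneTerminal).comp (TwoCat.Slice.sigma (matrixIndex one))

/-! ### The unit: the family of elements of an object. -/

section Unit

variable {X : VDC.{u + 1}} (b : VDFunctor X SetHc.{u})

/-- The family of elements of an object. -/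
abbrev fibreFunctor : X.Obj ⥤ (VDMat.graph (elements b)).Obj where
  obj x := ⟨((setFunctor b).obj x).objDown, fun i => Elt.mk x i⟩
  map {x y} f := VDMat.VHom.mk (fun i => setFun ((setFunctor b).map f) i) (fun i => ⟨f, rfl⟩)
  map_id x := by
    have e : ∀ i, setFun ((setFunctor b).map (𝟙 x)) i = i := fun i => by
      rw [CategoryTheory.Functor.map_id]
      rfl
    refine VDMat.VHom.ext (funext e) (Function.hfunext rfl fun i i' h => ?_)
    cases h
    exact Elt.hom_heq _ rfl (Elt.obj_ext _ rfl (heq_of_eq (e i))) HEq.rfl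
  map_comp {x y z} f g := by
    have e : ∀ i, setFun ((setFunctor b).map (f ≫ g)) i =
        setFun ((setFunctor b).map g) (setFun ((setFunctor b).map f) i) := fun i => by
      rw [Functor.map_comp]
      rfl
    refine VDMat.VHom.ext (funext e) (Function.hfunext rfl fun i i' h => ?_)
    cases h
    exact Elt.hom_heq _ rfl (Elt.obj_ext _ rfl (heq_of_eq (e i))) HEq.rfl

/-- All entries of the matrix assigned to a horizontal morphism `e` are `e` itself, so the choice of
indices is immaterial after projecting to `X`. -/
theorem eval_fibre {x : X.Obj} : ∀ {y : X.Obj} (Γ : HPath X.HHom x y)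
    {i : ((fibreFunctor b).obj x).I} {j : ((fibreFunctor b).obj y).I}
    (s : VDMat.Ix (A := elements b) (Γ.map (fibreFunctor b).obj (fun _ _ e _ _ => e)) i j),
    (elementsProj b).mapPath s.eval = Γ
  | _, .nil, i, j, s => by
    obtain rfl : i = j := VDMat.Ix.eq_of_nil (X := (fibreFunctor b).obj _) s
    obtain rfl := VDMat.Ix.nil_eq (X := (fibreFunctor b).obj _) s
    rfl
  | _, .snoc (c := z) Γ e, _, _, s => by
    have h := VDMat.Ix.snoc_unsnoc (Z := (fibreFunctor b).obj z) s
    rw [← h]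
    exact congrArg (fun p => HPath.snoc p e) (eval_fibre Γ _)

/-- The unit of the adjunction, on underlying data. -/
abbrev fibreData : VDMap X.toVDGraph (VDMat.graph (elements b)) where
  vert := fibreFunctor b
  mapH e := fun _ _ => e
  mapCell {_ _ _ _ Γ _ _ _} θ := fun _ _ s => X.castTop (eval_fibre b Γ s).symm θ

theorem rowAt_fibre : ∀ {x y z t : X.Obj} {Γ : HPath X.HHom x y} {f : x ⟶ z} {f' : y ⟶ t}
    {Δ : HPath X.HHom z t} (Θ : X.Row Γ f f' Δ) {i : ((fibreFunctor b).obj x).I}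
    {j : ((fibreFunctor b).obj y).I} (s : VDMat.Ix ((fibreData b).mapPath Γ) i j),
    HEq ((elementsProj b).mapRow (VDMat.rowAt ((fibreData b).mapRow Θ) s).2) Θ
  | _, _, _, _, _, _, _, _, .nil _, i, j, s => by
    obtain rfl : i = j := VDMat.Ix.eq_of_nil (X := (fibreFunctor b).obj _) s
    obtain rfl := VDMat.Ix.nil_eq (X := (fibreFunctor b).obj _) s
    rfl
  | _, _, _, _, _, _, _, _, .snoc (Γ := Γ) (Γ' := Γ') Θ θ rfl, i, k, s => by
    -- The image of a concatenation is the concatenation of the images only propositionally; `s` is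
    -- transported so that it can be split.
    obtain ⟨s', hs'⟩ : ∃ s' : VDMat.Ix (((fibreData b).mapPath Γ).append ((fibreData b).mapPath Γ')) i k,
        HEq s' s := ⟨_, cast_heq (congrArg (fun p => VDMat.Ix p i k) (HPath.map_append _ _ _ _)) s⟩
    obtain ⟨l, s₁, s₂, rfl⟩ := VDMat.Ix.exists_join _ s'
    have h := VDMat.rowAt_snoc ((fibreData b).mapRow Θ) ((fibreData b).mapCell θ)
      (HPath.map_append _ _ _ _).symm s₁ s₂ s hs'
    have h' : VDMat.rowAt ((fibreData b).mapRow (Θ.snoc θ rfl)) s = _ := h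
    rw [h']
    exact VDGraph.Row.snoc_heq _ _ (eval_fibre b _ _) (eval_fibre b _ _) (eval_fibre b _ _)
      (rowAt_fibre Θ s₁) (VDGraph.castTop_heq _ _)

/-- The virtual double functor sending an object to the family of its elements. -/
def fibre : VDFunctor X (elements b).matrices where
  toVDMap := fibreData b
  map_idc {x y} Γ := by
    funext i j s
    apply eq_of_heq
    refine (VDMat.castSides_at_heq ((fibreFunctor b).map_id x) ((fibreFunctor b).map_id y) _ s).trans ?_
    have h : HEq ((fibreData b).mapCell (X.idc Γ) i j s) (X.idc Γ) := VDGraph.castTop_heq _ _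
    refine h.trans ?_
    obtain rfl := VDMat.Ix.single_eq (X := (fibreFunctor b).obj x) (Y := (fibreFunctor b).obj y) s
    exact (VertTrans.map_idc_heq (elementsProj b) (X := Elt.mk x i) (Y := Elt.mk y j) Γ).symm
  map_comp {_ _ _ _ _ _ Γ u u' Δ v v' Λ} κ Θ := by
    funext i k s
    apply eq_of_heq
    refine (VDGraph.castTop_heq _ _).trans ?_
    refine HEq.trans ?_ (VDMat.comp_at_heq _ _ ((fibreFunctor b).map_comp u v).symm
      ((fibreFunctor b).map_comp u' v').symm s).symm
    exact X.comp_heq _ _ (eval_fibre b Γ s).symm (eval_fibre b Δ _).symm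
      (VDGraph.castTop_heq _ _).symm (rowAt_fibre b Θ s).symm

end Unit

/-! ### The counit: evaluation of a family at a chosen index. -/

section Counit

variable (A : VDC.{u + 1})

/-- The virtual double category of families with a chosen index. -/
abbrev pointedMatrices : VDC.{u + 1} := elements (familyIndex A)

/-- The index of an object of the virtual double category of families with a chosen index. -/
abbrev index {A : VDC.{u + 1}} (x : (pointedMatrices A).Obj) :
    (show (VDMat.graph A).Obj from Elt.base x).I := Elt.pt x

variable {A}

theorem index_eq {x y : (pointedMatrices A).Obj} (f : x ⟶ y) :
    VDMat.VHom.idx (Elt.Hom.base f) (index x) = index y := Elt.Hom.w f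

/-- Transport of a vertical morphism along an equality of indices. -/
def castIndex {Z : VDMat.Obj A} {a : A.Obj} {i j : Z.I} (h : i = j) (f : a ⟶ Z.fam i) :
    a ⟶ Z.fam j := h ▸ f

theorem castIndex_heq {Z : VDMat.Obj A} {a : A.Obj} {i j : Z.I} (h : i = j) (f : a ⟶ Z.fam i) :
    HEq (castIndex h f) f := by
  subst h
  rfl

/-- Transport of a multicell along equalities of indices. -/
def castIndices {Z W : VDMat.Obj A} {a b : A.Obj} {Γ : HPath A.HHom a b} {i i' : Z.I} {j j' : W.I}
    {f : a ⟶ Z.fam i} {f' : b ⟶ W.fam j} {Δ : VDMat.HHom Z W} (h : i = i') (h' : j = j')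
    (θ : A.Cell Γ f f' (Δ i j)) : A.Cell Γ (castIndex h f) (castIndex h' f') (Δ i' j') :=
  match i', j', h, h' with
  | _, _, rfl, rfl => θ

theorem castIndices_heq {Z W : VDMat.Obj A} {a b : A.Obj} {Γ : HPath A.HHom a b} {i i' : Z.I}
    {j j' : W.I} {f : a ⟶ Z.fam i} {f' : b ⟶ W.fam j} {Δ : VDMat.HHom Z W} (h : i = i') (h' : j = j')
    (θ : A.Cell Γ f f' (Δ i j)) : HEq (castIndices h h' θ) θ := by
  subst h h'
  rfl

/-- The functor evaluating a family at an index. -/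
abbrev evalFunctor (A : VDC.{u + 1}) : (pointedMatrices A).Obj ⥤ A.Obj where
  obj x := VDMat.Obj.fam (Elt.base x) (index x)
  map {x y} f := castIndex (index_eq f) (VDMat.VHom.map (Elt.Hom.base f) (index x))
  map_id _ := rfl
  map_comp {x y z} f g := by
    -- The indices `j` and `k` are made variables so that the equations defining them can be
    -- eliminated.
    have key : ∀ {X Y Z : VDMat.Obj A} (f : X ⟶ Y) (g : Y ⟶ Z) (i : X.I) {j : Y.I} {k : Z.I}
        (h : VDMat.VHom.idx f i = j) (h' : VDMat.VHom.idx g j = k)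
        (h'' : VDMat.VHom.idx g (VDMat.VHom.idx f i) = k),
        castIndex h'' (VDMat.VHom.map f i ≫ VDMat.VHom.map g (VDMat.VHom.idx f i)) =
          castIndex h (VDMat.VHom.map f i) ≫ castIndex h' (VDMat.VHom.map g j) := by
      rintro X Y Z f g i _ _ rfl rfl _
      rfl
    exact key _ _ _ (index_eq f) (index_eq g) _

/-- The sequence of the chosen indices. -/
def indices {x : (pointedMatrices A).Obj} : {y : (pointedMatrices A).Obj} →
    (Γ : HPath (pointedMatrices A).HHom x y) →
    VDMat.Ix (A := A) ((elementsProj (familyIndex A)).mapPath Γ) (index x) (index y)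
  | _, .nil => .nil (X := Elt.base x) _
  | y, .snoc Γ _ => .snoc (Z := Elt.base y) (indices Γ) (index y)

theorem eval_indices {x y : (pointedMatrices A).Obj} (Γ : HPath (pointedMatrices A).HHom x y) :
    (indices Γ).eval = Γ.map (evalFunctor A).obj (fun x y e => e (index x) (index y)) := by
  induction Γ with
  | nil => rfl
  | snoc Γ e ih => exact congrArg (fun p => HPath.snoc p _) ih

theorem indices_append {x y z : (pointedMatrices A).Obj} (Γ : HPath (pointedMatrices A).HHom x y)
    (Γ' : HPath (pointedMatrices A).HHom y z) :
    HEq ((indices Γ).join (indices Γ')) (indices (Γ.append Γ')) := by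
  induction Γ' with
  | nil => rfl
  | snoc Γ' e ih => exact VDMat.Ix.snoc_heq (HPath.map_append _ _ _ _).symm ih _

/-- Evaluation of families at an index, on underlying data. -/
abbrev evalData (A : VDC.{u + 1}) : VDMap (pointedMatrices A).toVDGraph A.toVDGraph where
  vert := evalFunctor A
  mapH {x y} e := e (index x) (index y)
  mapCell {_ _ _ _ Γ f f' _} θ := A.castTop (eval_indices Γ)
    (castIndices (index_eq f) (index_eq f') (θ _ _ (indices Γ)))

/-- Vertical morphisms of `pointedMatrices A` preserve the chosen indices. Reading a row at the
chosen indices of its top therefore yields the chosen indices of its bottom, which makes evaluation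
compatible with composition. -/
theorem rowAt_eval {x y z t : (pointedMatrices A).Obj} {Γ : HPath (pointedMatrices A).HHom x y}
    {f : x ⟶ z} {f' : y ⟶ t} {Δ : HPath (pointedMatrices A).HHom z t}
    (Θ : (pointedMatrices A).Row Γ f f' Δ) :
    HEq (VDMat.rowAt ((elementsProj (familyIndex A)).mapRow Θ) (indices Γ)).1 (indices Δ) ∧
      HEq (VDMat.rowAt ((elementsProj (familyIndex A)).mapRow Θ) (indices Γ)).2
        ((evalData A).mapRow Θ) := by
  induction Θ with
  | nil f =>
    have key : ∀ {Z : VDMat.Obj A} {i j : Z.I} (_ : i = j),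
        HEq (VDMat.Ix.nil i) (VDMat.Ix.nil (A := A) j) := by
      rintro Z i _ rfl
      rfl
    exact ⟨key (index_eq f), VDGraph.Row.nil_hcongr (congrArg _ (index_eq f))
      (castIndex_heq _ _).symm⟩
  | @snoc b b' c d d' Γ Γ' Γ'' f f' f'' Δ δ Θ θ h ih =>
    subst h
    obtain ⟨e₁, e₂⟩ := ih
    have h := VDMat.rowAt_snoc ((elementsProj (familyIndex A)).mapRow Θ)
      ((elementsProj (familyIndex A)).mapCell θ) (HPath.map_append _ _ _ _).symm (indices Γ)
      (indices Γ') (indices (Γ.append Γ')) (indices_append Γ Γ')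
    have h' : VDMat.rowAt ((elementsProj (familyIndex A)).mapRow (Θ.snoc θ rfl))
      (indices (Γ.append Γ')) = _ := h
    rw [h']
    refine ⟨VDMat.Ix.snoc_hcongr (index_eq f) (index_eq f') (index_eq f'') e₁, ?_⟩
    refine VDGraph.Row.snoc_hcongr _ _ (congrArg _ (index_eq f)) (congrArg _ (index_eq f'))
      (congrArg _ (index_eq f'')) (eval_indices Γ) (eval_indices Γ') (castIndex_heq _ _).symm
      (castIndex_heq _ _).symm (castIndex_heq _ _).symm
      ((VDMat.Ix.eval_hcongr (index_eq f) (index_eq f') e₁).trans (heq_of_eq (eval_indices Δ)))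
      (VDMat.hhom_heq δ (index_eq f') (index_eq f'')) e₂ ?_
    exact ((VDGraph.castTop_heq _ _).trans (castIndices_heq _ _ _)).symm

theorem evalData_mapCell_heq {x y z t : (pointedMatrices A).Obj}
    {Γ : HPath (pointedMatrices A).HHom x y} {f : x ⟶ z} {f' : y ⟶ t}
    {Δ : (pointedMatrices A).HHom z t} (θ : (pointedMatrices A).Cell Γ f f' Δ) :
    HEq ((evalData A).mapCell θ) (θ (index x) (index y) (indices Γ)) :=
  (VDGraph.castTop_heq _ _).trans (castIndices_heq _ _ _)

/-- The virtual double functor evaluating families at an index. -/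
def eval (A : VDC.{u + 1}) : VDFunctor (pointedMatrices A) A where
  toVDMap := evalData A
  map_idc {x y} Γ := by
    apply eq_of_heq
    refine (VDGraph.castSides_heq _ _ _).trans ?_
    exact evalData_mapCell_heq ((pointedMatrices A).idc Γ)
  map_comp {x y _ _ _ _ Γ f f' Δ g g' Λ} κ Θ := by
    apply eq_of_heq
    refine (evalData_mapCell_heq _).trans ?_
    obtain ⟨e₁, e₂⟩ := rowAt_eval Θ
    have h : HEq ((pointedMatrices A).comp κ Θ rfl rfl (index x) (index y) (indices Γ)) _ :=
      VDMat.comp_at_heq (A := A) (u := Elt.Hom.base f) (u' := Elt.Hom.base f')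
        (v := Elt.Hom.base g) (v' := Elt.Hom.base g') (w := Elt.Hom.base (f ≫ g))
        (w' := Elt.Hom.base (f' ≫ g'))
        κ ((elementsProj (familyIndex A)).mapRow Θ) rfl rfl (indices Γ)
    refine h.trans ?_
    exact A.comp_hcongr _ _ _ _ (congrArg _ (index_eq f)) (congrArg _ (index_eq f'))
      (congrArg _ (index_eq (f ≫ g))) (congrArg _ (index_eq (f' ≫ g')))
      (eval_indices Γ) (castIndex_heq _ _).symm (castIndex_heq _ _).symm
      ((VDMat.Ix.eval_hcongr (index_eq f) (index_eq f') e₁).trans (heq_of_eq (eval_indices Δ)))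
      ((VDMat.map_heq (Elt.Hom.base g) (index_eq f)).trans (castIndex_heq _ _).symm)
      ((VDMat.map_heq (Elt.Hom.base g') (index_eq f')).trans (castIndex_heq _ _).symm)
      (VDMat.hhom_heq Λ (index_eq (f ≫ g)) (index_eq (f' ≫ g')))
      ((VDMat.cell_heq κ (index_eq f) (index_eq f') e₁).trans (evalData_mapCell_heq κ).symm) e₂

end Counit

end VDC

theorem VDMap.mapCell_hcongr {A B : VDGraph.{w}} (F : VDMap A B) {X Y Z W Z' W' : A.Obj}
    {Γ Γ' : HPath A.HHom X Y} {u : X ⟶ Z} {u' : Y ⟶ W} {v : X ⟶ Z'} {v' : Y ⟶ W'} {Δ : A.HHom Z W}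
    {Δ' : A.HHom Z' W'} {θ : A.Cell Γ u u' Δ} {θ' : A.Cell Γ' v v' Δ'} (hZ : Z = Z') (hW : W = W')
    (hΓ : Γ = Γ') (hu : HEq u v) (hu' : HEq u' v') (hΔ : HEq Δ Δ') (h : HEq θ θ') :
    HEq (F.mapCell θ) (F.mapCell θ') := by
  subst hZ hW hΓ
  cases hu
  cases hu'
  cases hΔ
  cases h
  rfl

namespace VDMat

variable {X Y : VDC.{u + 1}} {A B : VDC.{u + 1}}

theorem castTop_at {X Y Z W : (graph A).Obj} {Γ Γ' : HPath (graph A).HHom X Y} {f : X ⟶ Z}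
    {f' : Y ⟶ W} {Δ : (graph A).HHom Z W} (h : Γ = Γ') (θ : (graph A).Cell Γ f f' Δ) {i : X.I}
    {j : Y.I} (s : Ix Γ' i j) :
    ∃ s' : Ix Γ i j, HEq s s' ∧ HEq ((graph A).castTop h θ i j s) (θ i j s') := by
  subst h
  exact ⟨s, HEq.rfl, HEq.rfl⟩

/-- Composing two maps transports top boundaries, so an entry of the composite is read at a
transported sequence of indices. For functors whose entries do not depend on the indices, the mere
existence of `s'` is enough. -/
theorem comp_map_at (F : VDFunctor X A.matrices) (G : VDFunctor A B)
    {x y z t : X.Obj} {Γ : HPath X.HHom x y} {f : x ⟶ z} {f' : y ⟶ t} {Δ : X.HHom z t}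
    (θ : X.Cell Γ f f' Δ) {i : (F.vert.obj x).I} {j : (F.vert.obj y).I}
    (s : Ix (X := (F.comp (map G)).vert.obj x) (Y := (F.comp (map G)).vert.obj y)
      ((F.comp (map G)).mapPath Γ) i j) :
    ∃ s' : Ix (F.mapPath Γ) i j, HEq s (mapIx G s') ∧
      HEq ((F.comp (map G)).mapCell θ i j s) (G.mapCell (F.mapCell θ i j s')) := by
  obtain ⟨s₁, h, h'⟩ := castTop_at (HPath.map_map F.vert.obj (fun _ _ => F.mapH) (mapVert G).obj
    (fun _ _ => (mapMap G).mapH) Γ) ((mapMap G).mapCell (F.mapCell θ)) s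
  refine ⟨unmapIx G _ s₁, ?_, h'.trans (mapCell_at_heq G _ _ (mapIx_unmapIx G _ s₁).symm)⟩
  exact h.trans (heq_of_eq (mapIx_unmapIx G _ s₁).symm)

end VDMat

/-! ### Naturality of unit and counit, and the triangle identities. -/

namespace VDC

section Unit

variable {X Y : VDC.{u + 1}}

theorem fibre_familyIndex (b : VDFunctor X SetHc.{u}) :
    (fibre b).comp (familyIndex (elements b)) = b :=
  isChaotic_SetHc.hom_ext rfl

theorem fibre_mapCell_heq (b : VDFunctor X SetHc.{u}) {x y z t : X.Obj} {Γ : HPath X.HHom x y}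
    {f : x ⟶ z} {f' : y ⟶ t} {Δ : X.HHom z t} (θ : X.Cell Γ f f' Δ)
    {i : ((fibreFunctor b).obj x).I} {j : ((fibreFunctor b).obj y).I}
    (s : VDMat.Ix ((fibreData b).mapPath Γ) i j) :
    HEq ((fibre b).mapCell θ i j s) θ := VDGraph.castTop_heq _ _

theorem elementsMapOf_mapCell_heq {b : VDFunctor X SetHc.{u}} {b' : VDFunctor Y SetHc.{u}}
    (f : VDFunctor X Y) (ν : setFunctor b ⟶ f.vert ⋙ setFunctor b') {x y z t : (elements b).Obj}
    {Γ : HPath (elements b).HHom x y} {g : x ⟶ z} {g' : y ⟶ t} {Δ : (elements b).HHom z t}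
    (θ : (elements b).Cell Γ g g' Δ) :
    HEq ((elementsMapOf f ν).mapCell θ) (f.mapCell ((elementsProj b).mapCell θ)) :=
  VDGraph.castTop_heq _ _

/-- Naturality of the unit. The entries of `fibre` are constant, so on both sides each entry at `θ`
is `f.mapCell θ`, whatever the indices. -/
theorem comp_fibre {b : VDFunctor X SetHc.{u}} {b' : VDFunctor Y SetHc.{u}} (f : VDFunctor X Y)
    (w : f.comp b' = b) : f.comp (fibre b') = (fibre b).comp (VDMat.map (elementsMap f w)) := by
  subst w
  refine VDFunctor.ext_cell fun {x y _ _ Γ _ _ _} θ => ?_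
  funext i j s
  apply eq_of_heq
  obtain ⟨s₁, -, h₁⟩ := VDMat.castTop_at (HPath.map_map f.vert.obj (fun _ _ => f.mapH)
    (fibreFunctor b').obj (fun _ _ => (fibreData b').mapH) Γ) ((fibre b').mapCell (f.mapCell θ)) s
  obtain ⟨s₂, -, h₂⟩ := VDMat.comp_map_at (fibre (f.comp b')) (elementsMap f rfl) θ s
  refine (h₁.trans (fibre_mapCell_heq _ _ _)).trans (HEq.trans ?_ h₂.symm)
  refine HEq.trans ?_ (elementsMapOf_mapCell_heq f (overTrans rfl) _).symm
  exact (f.mapCell_heq (eval_fibre _ Γ s₂) (fibre_mapCell_heq _ θ s₂)).symm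

/-- Two-dimensional naturality of the unit. The index functions agree by `setFun_app`; the entries
on both sides are those of `α`. -/
theorem whiskerRight_fibre {b : VDFunctor X SetHc.{u}} {b' : VDFunctor Y SetHc.{u}}
    {f g : VDFunctor X Y} (w : f.comp b' = b) (w' : g.comp b' = b) (α : VertTrans f g)
    (h : HEq (VertTrans.whiskerRight α b') (VertTrans.id b)) :
    HEq (VertTrans.whiskerRight α (fibre b'))
      (VertTrans.whiskerLeft (fibre b) (VDMat.map₂ (elementsMap₂ w w' α h))) := by
  have hw : ∀ {f : VDFunctor X Y} (w : f.comp b' = b) (x : X.Obj) {i}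
      {i' : ((setFunctor b).obj x).objDown}, HEq i i' → i = cast (setObj_eq w x) i' := fun w x i i' hi =>
    eq_of_heq (hi.trans (cast_heq _ _).symm)
  refine VDMat.vertTrans_hext (comp_fibre f w) (comp_fibre g w') (fun x i i' hi => ?_)
    (fun x i i' hi => ?_) (fun {x y} Γ i i' j j' hi hj => ?_)
  · obtain rfl := hw w x hi
    exact (heq_of_eq (setFun_app w w' α h x i')).trans (cast_heq _ _)
  · obtain rfl := hw w x hi
    exact Elt.hom_heq _ rfl (Elt.obj_ext _ rfl (heq_of_eq (setFun_app w w' α h x i'))) HEq.rfl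
  · refine (fibre_mapCell_heq b' (α.cell Γ) (VDMat.Ix.snoc (Z := (fibreFunctor b').obj (f.vert.obj y))
      (VDMat.Ix.nil (X := (fibreFunctor b').obj (f.vert.obj x)) i) j)).trans ?_
    exact (elementsMap₂_cell w w' α h (x := Elt.mk x i') (y := Elt.mk y j') Γ).symm

end Unit

section Counit

variable {A B : VDC.{u + 1}}

theorem map_familyIndex (f : VDFunctor A B) : (VDMat.map f).comp (familyIndex B) = familyIndex A :=
  isChaotic_SetHc.hom_ext rfl

theorem map_castIndex_heq (F : A.Obj ⥤ B.Obj) {Z : VDMat.Obj A} {a : A.Obj} {i j : Z.I} (h : i = j)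
    (f : a ⟶ Z.fam i) : HEq (F.map (castIndex h f)) (F.map f) := by
  subst h
  rfl

theorem indices_map (f : VDFunctor A B) {x y : (pointedMatrices A).Obj}
    (Γ : HPath (pointedMatrices A).HHom x y) :
    HEq (indices ((elementsMap (VDMat.map f) (map_familyIndex f)).mapPath Γ))
      (VDMat.mapIx f (indices Γ)) := by
  induction Γ with
  | nil => rfl
  | snoc Γ e ih =>
    exact VDMat.Ix.snoc_heq (mapPath_eltMap (VDMat.map f) (overTrans (map_familyIndex f)) _) ih _

/-- Naturality of the counit: `VDMat.map f` acts entrywise and preserves indices, so it commutes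
with reading off one entry. -/
theorem elementsMap_comp_eval (f : VDFunctor A B) :
    (elementsMap (VDMat.map f) (map_familyIndex f)).comp (eval B) = (eval A).comp f := by
  refine VDFunctor.ext_of (CategoryTheory.Functor.hext (fun _ => rfl) fun x y g => ?_)
    (fun _ => HEq.rfl) fun {x y z t Γ g g' Δ} θ => ?_
  · exact (castIndex_heq _ _).trans (map_castIndex_heq f.vert _ _).symm
  · refine (VDMap.comp_mapCell_heq _ _ _).trans ?_
    refine HEq.trans ?_ (VDMap.comp_mapCell_heq _ _ _).symm
    refine (evalData_mapCell_heq _).trans ?_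
    refine (VDMat.castTop_at_heq _ _ (indices_map f Γ)).trans ?_
    refine (VDMat.mapCell_at_heq f _ (indices Γ) rfl).trans ?_
    exact f.mapCell_hcongr (congrArg _ (index_eq g)) (congrArg _ (index_eq g')) (eval_indices Γ)
      (castIndex_heq _ _).symm (castIndex_heq _ _).symm
      (VDMat.hhom_heq Δ (index_eq g) (index_eq g')) (evalData_mapCell_heq θ).symm

theorem map₂_familyIndex {f g : VDFunctor A B} (α : VertTrans f g) :
    HEq (VertTrans.whiskerRight (VDMat.map₂ α) (familyIndex B)) (VertTrans.id (familyIndex A)) :=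
  VertTrans.hext (map_familyIndex f) (map_familyIndex g) (fun _ => HEq.rfl) (fun _ => HEq.rfl)

theorem whiskerRight_eval {f g : VDFunctor A B} (α : VertTrans f g) :
    HEq (VertTrans.whiskerRight (elementsMap₂ (map_familyIndex f) (map_familyIndex g)
      (VDMat.map₂ α) (map₂_familyIndex α)) (eval B)) (VertTrans.whiskerLeft (eval A) α) := by
  refine VertTrans.hext (elementsMap_comp_eval f) (elementsMap_comp_eval g) (fun x => HEq.rfl)
    fun {x y} Γ => ?_
  refine (evalData_mapCell_heq (A := B) ((elementsMap₂ (map_familyIndex f) (map_familyIndex g)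
      (VDMat.map₂ α) (map₂_familyIndex α)).cell Γ)).trans ?_
  have e := eq_of_heq (elementsMap₂_cell (map_familyIndex f) (map_familyIndex g)
      (VDMat.map₂ α) (map₂_familyIndex α) Γ)
  exact heq_of_eq (congrFun (congrFun (congrFun e (index x)) (index y))
    (.snoc (.nil (X := (VDMat.mapVert f).obj (Elt.base x)) _) _))

/-- A triangle identity: the family of elements of `x`, evaluated at the index `i`, is the element
`(x, i)`. -/
theorem elementsMap_fibre_comp_eval {X : VDC.{u + 1}} (b : VDFunctor X SetHc.{u}) :
    (elementsMap (fibre b) (fibre_familyIndex b)).comp (eval (elements b)) =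
      VDFunctor.id (elements b) := by
  refine VDFunctor.ext_of (CategoryTheory.Functor.hext (fun _ => rfl) fun x y g => ?_)
    (fun _ => HEq.rfl) fun {x y z t Γ g g' Δ} θ => ?_
  · refine (castIndex_heq _ _).trans ?_
    exact Elt.hom_heq _ rfl (Elt.obj_ext _ rfl (heq_of_eq (Elt.Hom.w g))) HEq.rfl
  · refine (VDMap.comp_mapCell_heq _ _ _).trans ?_
    refine HEq.trans ?_ (VDMap.id_mapCell_heq _).symm
    refine (evalData_mapCell_heq _).trans ?_
    obtain ⟨s, -, h⟩ := VDMat.castTop_at (mapPath_eltMap (fibre b) (overTrans (fibre_familyIndex b)) Γ).symm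
      ((fibre b).mapCell ((elementsProj b).mapCell θ))
      (indices ((elementsMap (fibre b) (fibre_familyIndex b)).mapPath Γ))
    exact h.trans (fibre_mapCell_heq b _ s)

/-- A sequence of indices `s` picks out a sequence of matrices with chosen indices, and the indices
chosen there are those of `s`. The other triangle identity needs this to locate an entry of a
multicell. -/
theorem indices_eval {x : A.matrices.Obj} : ∀ {y : A.matrices.Obj} (Γ : HPath A.matrices.HHom x y)
    {i : VDMat.Obj.I x} {j : VDMat.Obj.I y}
    (s : VDMat.Ix ((fibreData (familyIndex A)).mapPath Γ) i j),
    HEq (indices s.eval) (VDMat.mapIx (eval A) s)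
  | _, .nil, i, j, s => by
    obtain rfl : i = j := VDMat.Ix.eq_of_nil (X := (fibreFunctor (familyIndex A)).obj _) s
    obtain rfl := VDMat.Ix.nil_eq (X := (fibreFunctor (familyIndex A)).obj _) s
    rfl
  | _, .snoc (c := z) Γ e, i, k, s => by
    have h := VDMat.Ix.snoc_unsnoc (Z := (fibreFunctor (familyIndex A)).obj z) s
    rw [← h]
    exact VDMat.Ix.snoc_heq ((eval_fibre _ Γ _).trans
      ((VDMap.comp_mapPath (fibreData (familyIndex A)) (VDMat.mapMap (eval A)) Γ).symm.trans
        (HPath.map_id Γ)).symm)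
      (indices_eval Γ _) k

/-- The other triangle identity: a family is recovered by evaluating it at each of its own indices.
-/
theorem fibre_comp_eval (A : VDC.{u + 1}) :
    (fibre (familyIndex A)).comp (VDMat.map (eval A)) = VDFunctor.id A.matrices := by
  refine VDFunctor.ext_cell fun {x y _ _ Γ _ _ _} θ => ?_
  funext i j s
  apply eq_of_heq
  obtain ⟨s₁, e₁, h₁⟩ := VDMat.comp_map_at (fibre (familyIndex A)) (eval A) θ s
  obtain ⟨s₂, e₂, h₂⟩ := VDMat.castTop_at (HPath.map_id Γ).symm θ s
  refine (h₁.trans ?_).trans h₂.symm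
  refine (evalData_mapCell_heq _).trans ?_
  refine VDMat.castTop_at_heq _ _ ?_
  exact (indices_eval Γ s₁).trans (e₁.symm.trans e₂)

end Counit

theorem comp_fibre_pullback {b b' : TwoCat.Slice SetHc.{u}} (f : b ⟶ b') :
    (TwoCat.Slice.Hom.left f).comp (fibre b'.hom) = (fibre b.hom).comp
      (VDMat.map (TwoCat.Slice.Hom.left (pullbackPhc.functor.map f))) :=
  (comp_fibre _ (TwoCat.Slice.Hom.w f)).trans
    (congrArg (fun F : VDFunctor _ _ => (fibre b.hom).comp (VDMat.map F)) (pullbackPhc_map f).symm)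

theorem whiskerRight_fibre_pullback {b b' : TwoCat.Slice SetHc.{u}} {f g : b ⟶ b'} (α : f ⟶ g) :
    HEq (VertTrans.whiskerRight (TwoCat.Slice.Hom₂.left α) (fibre b'.hom))
      (VertTrans.whiskerLeft (fibre b.hom)
        (VDMat.map₂ (TwoCat.Slice.Hom₂.left (pullbackPhc.functor.map₂ α)))) :=
  (whiskerRight_fibre (TwoCat.Slice.Hom.w f) (TwoCat.Slice.Hom.w g) _
    (slice_whiskerRight_heq α)).trans
    (TwoCat.whiskerLeft_heq (K := VDC.{u + 1}) rfl
      (congrArg (fun F : VDFunctor _ _ => VDMat.map F) (pullbackPhc_map f).symm)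
      (congrArg (fun F : VDFunctor _ _ => VDMat.map F) (pullbackPhc_map g).symm)
      (TwoCat.map₂_heq Mat.{u} (pullbackPhc_map f).symm (pullbackPhc_map g).symm
        (pullbackPhc_map₂ α).symm))

/-- The domain of the pullback along `P_hc` is left 2-adjoint to `Mat`, as a 2-functor to virtual
double categories over `Set_hc`. -/
noncomputable def matAdjunction : TwoCat.CounitAdjunction
    (pullbackPhc.functor.comp (TwoCat.Slice.forget PointedHc.{u})) MatOver.{u} :=
  .ofUnitCounit (fun b => TwoCat.Slice.Hom.mk (fibre b.hom) (fibre_familyIndex b.hom))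
    (fun A => eval A)
    (fun f => TwoCat.Slice.Hom.ext (comp_fibre_pullback f))
    (fun {_ _ f g} α => TwoCat.Slice.hom₂_heq (TwoCat.Slice.Hom.ext (comp_fibre_pullback f))
      (TwoCat.Slice.Hom.ext (comp_fibre_pullback g)) (whiskerRight_fibre_pullback α))
    (fun {_ B} f => (congrArg (fun F : VDFunctor _ _ => F.comp (eval B)) (pullbackPhc_map _)).trans
      (elementsMap_comp_eval f))
    (fun α => (TwoCat.whiskerRight_heq (K := VDC.{u + 1}) (pullbackPhc_map _)
      (pullbackPhc_map _) (pullbackPhc_map₂ (MatOver.map₂ α)) rfl).trans (whiskerRight_eval α))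
    (fun b => (congrArg (fun F : VDFunctor _ _ => F.comp (eval (elements b.hom))) (pullbackPhc_map _)).trans
      (elementsMap_fibre_comp_eval b.hom))
    (fun A => TwoCat.Slice.Hom.ext (fibre_comp_eval A))

end VDC

/-! ### Recognition of polynomial 2-functors. -/

namespace TwoCat

open Bicategory

universe w₁ v₁ u₁

variable {K : Type u₁} [Bicategory.{w₁, v₁} K] [Strict K]

/-- The forgetful 2-functor of a slice is left 2-adjoint to the pullback along the morphism to the
terminal object. -/
def PullbackFunctor.forgetAdjunction {T E : K} (hT : Terminal T)
    (Q : PullbackFunctor (hT.toHom E)) : CounitAdjunction (Slice.forget E)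
      ((overTerminal (StrictPseudofunctor.id K) hT).comp Q.functor) :=
  let A := Q.adjunction.comp hT.forgetAdjunction
  { counit := A.counit
    nat := A.nat
    nat₂ := A.nat₂
    isCouniversal := fun Y => ⟨(A.isCouniversal Y).existsUnique, (A.isCouniversal Y).existsUnique₂⟩ }

/-- The 2-natural transformation on domains underlying one between 2-functors into a slice. -/
def TwoNatTrans.left {B : K} {M M' : StrictPseudofunctor K (Slice B)} (k : TwoNatTrans M M') :
    TwoNatTrans (M.comp (Slice.forget B)) (M'.comp (Slice.forget B)) :=
  .ofHEq (fun X => Slice.Hom.left (k.app X)) (fun f => congrArg Slice.Hom.left (k.naturality f))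
    (fun {_ _ f g} η => Slice.left_heq (k.naturality f) (k.naturality g) (k.naturality₂_heq η))

/-- Composition of 2-natural transformations. -/
def TwoNatTrans.vcomp {F G H : StrictPseudofunctor K K} (σ : TwoNatTrans F G)
    (τ : TwoNatTrans G H) : TwoNatTrans F H :=
  .ofHEq (fun X => σ.app X ≫ τ.app X)
    (fun f => by
      rw [← Strict.assoc, σ.naturality, Strict.assoc, τ.naturality, Strict.assoc])
    (fun {_ _ f g} η => by
      refine (whiskerRight_comp_heq _ _ _).trans ?_
      refine (whiskerRight_heq (σ.naturality f) (σ.naturality g) (σ.naturality₂_heq η) rfl).trans ?_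
      refine (whisker_assoc_heq _ _ _).trans ?_
      refine (whiskerLeft_heq rfl (τ.naturality f) (τ.naturality g) (τ.naturality₂_heq η)).trans ?_
      exact (comp_whiskerLeft_heq _ _ _).symm)

/-- The 2-natural isomorphism on domains underlying one between 2-functors into a slice. -/
def TwoNatIso.left {B : K} {M M' : StrictPseudofunctor K (Slice B)} (k : TwoNatIso M M') :
    TwoNatIso (M.comp (Slice.forget B)) (M'.comp (Slice.forget B)) where
  hom := k.hom.left
  inv := k.inv.left
  hom_inv_id X := congrArg Slice.Hom.left (k.hom_inv_id X)
  inv_hom_id X := congrArg Slice.Hom.left (k.inv_hom_id X)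

/-- Composition of 2-natural isomorphisms. -/
def TwoNatIso.trans {F G H : StrictPseudofunctor K K} (σ : TwoNatIso F G) (τ : TwoNatIso G H) :
    TwoNatIso F H where
  hom := σ.hom.vcomp τ.hom
  inv := τ.inv.vcomp σ.inv
  hom_inv_id X := by
    change (σ.hom.app X ≫ τ.hom.app X) ≫ τ.inv.app X ≫ σ.inv.app X = _
    rw [Strict.assoc, ← Strict.assoc (τ.hom.app X), τ.hom_inv_id, Strict.id_comp, σ.hom_inv_id]
  inv_hom_id X := by
    change (τ.inv.app X ≫ σ.inv.app X) ≫ σ.hom.app X ≫ τ.hom.app X = _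
    rw [Strict.assoc, ← Strict.assoc (σ.inv.app X), σ.inv_hom_id, Strict.id_comp, τ.inv_hom_id]

/-- A 2-functor over `B` that is right 2-adjoint to the domain of `p^*` has as its domain the
polynomial 2-functor of `p`. -/
theorem isPolynomialOf_of_adjunction {T E B : K} {hT : Terminal T} {p : E ⟶ B}
    {R : StrictPseudofunctor K K} {M : StrictPseudofunctor K (Slice B)} {Q : PullbackFunctor p}
    (A : CounitAdjunction (Q.functor.comp (Slice.forget E)) M)
    (i : TwoNatIso (M.comp (Slice.forget B)) R)
    (hs : Nonempty (PullbackFunctor (hT.toHom E)))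
    (hpull : ∀ q : Slice E, ∃ (P : K) (fst : P ⟶ (M.obj q.left).left) (snd : P ⟶ B),
      IsTwoPullback fst snd (Slice.Hom.left (M.map q.hom)) (Slice.Hom.left (nameOfProjection A))) :
    IsPolynomialOf R hT p := by
  constructor
  -- Pulling back along the name of the projection yields couniversal arrows from `p^*`, hence the
  -- dependent product.
  · choose P fst snd H using hpull
    choose ϵ hϵ using fun q => exists_isCouniversal_pullback A q (H q)
    exact ⟨⟨hs.some, Q, _, (counitAdjunctionOfCouniversal Q.functor _ ϵ hϵ).toTwoAdjunction⟩⟩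
  · intro D
    -- The data `D` may use other pullbacks than `Q`; both pullback 2-functors are right 2-adjoint
    -- to `∑ₚ`, hence isomorphic.
    let j : TwoNatIso Q.functor D.pStar.functor :=
      Q.adjunction.rightAdjointIso D.pStar.adjunction
    let A₁ : CounitAdjunction Q.functor D.pi := (CounitAdjunction.ofTwoAdjunction D.adj).ofLeftIso j
    -- The composite of `D.pi` with the product with `E` is right 2-adjoint to the domain of `p^*`,
    -- as is `M`; uniqueness of right 2-adjoints compares them over `B`.
    let k := (A₁.comp (D.sStar.forgetAdjunction hT)).rightAdjointIso A
    let l := k.left.trans i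
    -- Passing through the slice over the terminal object does not change domains, so the components
    -- of `l` serve as they are.
    exact ⟨⟨⟨l.hom.app, l.hom.naturality, l.hom.naturality₂⟩,
      ⟨l.inv.app, l.inv.naturality, l.inv.naturality₂⟩, l.hom_inv_id, l.inv_hom_id⟩⟩

end TwoCat

/-! ### `Mat` is polynomial and a parametric right 2-adjoint; `P_hc` is a discrete opfibration. -/

namespace VDC

/-- Forgetting the projection to `Set_hc` turns `MatOver` back into `Mat`, hence the identity
components. The pullbacks along the name exist because its domain `Set_hc` and its codomain, the
matrices over `(Set_*)_hc`, are chaotic. -/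
theorem isPolynomialOf_Mat : TwoCat.IsPolynomialOf Mat.{u} oneTerminal Phc.{u} :=
  TwoCat.isPolynomialOf_of_adjunction matAdjunction
    (R := Mat.{u})
    { hom := .ofHEq (fun A => 𝟙 (Mat.obj A))
        (fun f => (VDFunctor.comp_id (VDMat.map f)).trans (VDFunctor.id_comp _).symm)
        (fun η => (TwoCat.whiskerRight_id_heq (Mat.map₂ η)).trans
          (TwoCat.id_whiskerLeft_heq (Mat.map₂ η)).symm)
      inv := .ofHEq (fun A => 𝟙 (Mat.obj A))
        (fun f => (VDFunctor.comp_id (VDMat.map f)).trans (VDFunctor.id_comp _).symm)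
        (fun η => (TwoCat.whiskerRight_id_heq (Mat.map₂ η)).trans
          (TwoCat.id_whiskerLeft_heq (Mat.map₂ η)).symm)
      hom_inv_id := fun A => VDFunctor.id_comp (VDFunctor.id A.matrices)
      inv_hom_id := fun A => VDFunctor.id_comp (VDFunctor.id A.matrices) }
    ⟨pullbackOfChaotic isChaotic_PointedHc (isChaotic_hc _) _⟩
    (fun _ => exists_isTwoPullback isChaotic_SetHc isChaotic_PointedHc.matrices _ _)

theorem isChaotic_one : one.{w}.IsChaotic := isChaotic_hc _

theorem matrices_one_hom_heq {X X' Y Y' : VDMat.Obj one.{u + 1}} {f : X ⟶ Y} {f' : X' ⟶ Y'}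
    (hX : X = X') (hY : Y = Y')
    (h : HEq ((matrixIndex one.{u + 1}).vert.map f) ((matrixIndex one.{u + 1}).vert.map f')) :
    HEq f f' := by
  subst hX hY
  obtain ⟨p, m⟩ := f
  obtain ⟨p', m'⟩ := f'
  obtain rfl : p = p' := congrArg setFun (eq_of_heq h)
  exact heq_of_eq (congrArg (VDMat.VHom.mk p) (funext fun _ =>
    Subsingleton.elim (α := (_ : Discrete PUnit) ⟶ _) _ _))

/-- A family in the terminal virtual double category carries no information besides its index set,
and likewise for morphisms of families. So `matrixIndex one` can be cancelled, which moves the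
adjunction from `Set_hc` to `Mat 1`. -/
theorem matrixIndex_one_injective {Z : VDC.{u + 1}} {F G : VDFunctor Z one.matrices}
    (h : F.comp (matrixIndex one) = G.comp (matrixIndex one)) : F = G := by
  have hv : F.vert ⋙ (matrixIndex one).vert = G.vert ⋙ (matrixIndex one).vert :=
    congrArg (fun K : VDFunctor Z SetHc.{u} => K.vert) h
  have key : ∀ {X Y : VDMat.Obj one.{u + 1}}, X.I = Y.I → X = Y := by
    rintro ⟨I, a⟩ ⟨_, b⟩ rfl
    exact congrArg _ (funext fun i => Subsingleton.elim (α := Discrete PUnit) _ _)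
  have hobj : ∀ z, F.vert.obj z = G.vert.obj z := fun z => key (Functor.congr_obj hv z)
  exact isChaotic_one.matrices.hom_ext (CategoryTheory.Functor.hext hobj fun x y f =>
    matrices_one_hom_heq (hobj x) (hobj y) (Functor.hcongr_hom hv f))

theorem matrixIndex_one_injective₂ {Z : VDC.{u + 1}} {F G : VDFunctor Z one.matrices}
    {α β : VertTrans F G} (h : VertTrans.whiskerRight α (matrixIndex one) =
      VertTrans.whiskerRight β (matrixIndex one)) : α = β :=
  isChaotic_one.matrices.hom₂_ext fun x => eq_of_heq (matrices_one_hom_heq rfl rfl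
    (heq_of_eq (congrArg (fun t : VertTrans _ _ => t.vert.app x) h)))

theorem isParametricRightTwoAdjoint_Mat :
    TwoCat.IsParametricRightTwoAdjoint Mat.{u} oneTerminal :=
  ⟨_, ⟨(TwoCat.CounitAdjunction.cancelSigma (matrixIndex one)
    (fun _ _ h => matrixIndex_one_injective h) (fun _ _ h => matrixIndex_one_injective₂ h)
    matAdjunction).toTwoAdjunction⟩⟩

/-- A base point preserving function determines the base point of its codomain as the image of the
given one. -/
theorem bijective_forgetPointed (x : ULiftHom.{u + 1} Pointed.{u}) : Function.Bijective
    (fun f : (Σ x', x ⟶ x') => (⟨forgetPointed.obj f.1, forgetPointed.map f.2⟩ :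
      Σ y, forgetPointed.obj x ⟶ y)) := by
  constructor
  · rintro ⟨⟨X, p⟩, ⟨f, hf⟩⟩ ⟨⟨Y, q⟩, ⟨g, hg⟩⟩ h
    obtain ⟨h₁, h₂⟩ := Sigma.ext_iff.mp h
    obtain rfl : X = Y := h₁
    obtain rfl : f = g := congrArg setFun (eq_of_heq h₂)
    obtain rfl : p = q := hf.symm.trans hg
    rfl
  · rintro ⟨Y, m⟩
    exact ⟨⟨ULiftHom.objUp (⟨Y.objDown, setFun m (Pointed.point x.objDown)⟩ : Pointed.{u}),
      ⟨(⟨setFun m, rfl⟩ : Pointed.Hom _ _)⟩⟩, rfl⟩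

/-- `P_hc` is a discrete opfibration. -/
theorem isDiscreteOpfibration_Phc : VDFunctor.IsDiscreteOpfibration Phc.{u} where
  vert x := bijective_forgetPointed x
  cell {x₀ x₁} Φ := by
    constructor
    · rintro ⟨z, z', v, v', Ψ, c⟩ ⟨t, t', k, k', Ψ', c'⟩ h
      -- Equal images have equal sides, each side has only one lift, and a chaotic domain leaves
      -- nothing else to compare.
      have h₁ := (bijective_forgetPointed x₀).1 (a₁ := ⟨z, v⟩) (a₂ := ⟨t, k⟩)
        (congrArg (fun s => Sigma.mk s.1 s.2.2.1) h)
      have h₂ := (bijective_forgetPointed x₁).1 (a₁ := ⟨z', v'⟩) (a₂ := ⟨t', k'⟩)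
        (congrArg (fun s => Sigma.mk s.2.1 s.2.2.2.1) h)
      cases h₁
      cases h₂
      rfl
    · rintro ⟨y, y', m, m', Ψ, c⟩
      obtain ⟨⟨z, v⟩, h₁⟩ := (bijective_forgetPointed x₀).2 ⟨y, m⟩
      obtain ⟨⟨z', v'⟩, h₂⟩ := (bijective_forgetPointed x₁).2 ⟨y', m'⟩
      cases h₁
      cases h₂
      exact ⟨⟨z, z', v, v', PUnit.unit, PUnit.unit⟩, rfl⟩

end VDC

/-! ### Identity morphisms and cells up to equality of boundaries. -/

namespace VDC

section Identities

variable {A B : VDC.{w}}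

/-- Vertical morphisms that are identities, up to equality of boundaries. -/
inductive IsIdVert : ∀ {a b : A.Obj}, (a ⟶ b) → Prop
  | mk (a : A.Obj) : IsIdVert (𝟙 a)

/-- Multicells that are identities, up to equality of boundaries. -/
inductive IsIdCell : ∀ {a b c d : A.Obj} {Γ : A.HHom a b} {m : a ⟶ c} {m' : b ⟶ d} {Δ : A.HHom c d},
    A.Cell (HPath.single Γ) m m' Δ → Prop
  | mk {a b : A.Obj} (Γ : A.HHom a b) : IsIdCell (A.idc Γ)

theorem IsIdVert.obj_eq {a b : A.Obj} {m : a ⟶ b} (h : IsIdVert m) : a = b := by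
  cases h
  rfl

theorem IsIdVert.eq_id {a : A.Obj} {m : a ⟶ a} (h : IsIdVert m) : m = 𝟙 a := by
  cases h
  rfl

theorem IsIdVert.comp {a b c : A.Obj} {m : a ⟶ b} {n : b ⟶ c} (h : IsIdVert m) (h' : IsIdVert n) :
    IsIdVert (m ≫ n) := by
  cases h
  rwa [Category.id_comp]

theorem IsIdVert.of_comp {a b c : A.Obj} {m : a ⟶ b} {n : b ⟶ c} (h' : IsIdVert n)
    (h : IsIdVert (m ≫ n)) : IsIdVert m := by
  cases h'
  rwa [Category.comp_id] at h

theorem IsIdVert.map (F : VDFunctor A B) {a b : A.Obj} {m : a ⟶ b} (h : IsIdVert m) :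
    IsIdVert (F.vert.map m) := by
  cases h
  rw [CategoryTheory.Functor.map_id]
  exact .mk _

theorem IsIdVert.heq_of_comp_eq {a b c d : A.Obj} {f : a ⟶ b} {n : b ⟶ d} {m : a ⟶ c} {g : c ⟶ d}
    (hm : IsIdVert m) (hn : IsIdVert n) (h : f ≫ n = m ≫ g) : HEq f g := by
  cases hm
  cases hn
  rw [Category.comp_id, Category.id_comp] at h
  exact heq_of_eq h

theorem IsIdVert.bijective {a b c : A.Obj} {m : b ⟶ c} (h : IsIdVert m) :
    Function.Bijective (fun k : a ⟶ b => k ≫ m) := by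
  cases h
  simp only [Category.comp_id]
  exact Function.bijective_id

theorem IsIdCell.of_heq {a b c d c' d' : A.Obj} {Γ Γ' : A.HHom a b} {m : a ⟶ c} {m' : b ⟶ d}
    {n : a ⟶ c'} {n' : b ⟶ d'} {Δ : A.HHom c d} {Δ' : A.HHom c' d'}
    {x : A.Cell (HPath.single Γ) m m' Δ} {y : A.Cell (HPath.single Γ') n n' Δ'} (hc : c = c')
    (hd : d = d') (hΓ : Γ = Γ') (hm : HEq m n) (hm' : HEq m' n') (hΔ : HEq Δ Δ') (h : HEq x y)
    (hx : IsIdCell x) : IsIdCell y := by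
  subst hc hd hΓ
  cases hm
  cases hm'
  cases hΔ
  cases h
  exact hx

theorem IsIdCell.hhom_eq {a b : A.Obj} {Γ Δ : A.HHom a b} {m : a ⟶ a} {m' : b ⟶ b}
    {x : A.Cell (HPath.single Γ) m m' Δ} (h : IsIdCell x) : Γ = Δ := by
  cases h
  rfl

theorem IsIdCell.heq_idc {a b : A.Obj} {Γ Δ : A.HHom a b} {m : a ⟶ a} {m' : b ⟶ b}
    {x : A.Cell (HPath.single Γ) m m' Δ} (h : IsIdCell x) : HEq x (A.idc Γ) := by
  cases h
  rfl

theorem IsIdCell.bijective {a b c d : A.Obj} {Δ : A.HHom a b} {m : a ⟶ c} {m' : b ⟶ d}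
    {Δ' : A.HHom c d} {x : A.Cell (HPath.single Δ) m m' Δ'} (hx : IsIdCell x) {p q : A.Obj}
    {Γ : HPath A.HHom p q} {k : p ⟶ a} {k' : q ⟶ b} {n : p ⟶ c} {n' : q ⟶ d} (hn : k ≫ m = n)
    (hn' : k' ≫ m' = n') :
    Function.Bijective (fun θ : A.Cell Γ k k' Δ => A.comp x (.single θ) hn hn') := by
  cases hx
  obtain rfl : k = n := by rw [← hn, Category.comp_id]
  obtain rfl : k' = n' := by rw [← hn', Category.comp_id]
  simp only [A.id_comp]
  exact Function.bijective_id

theorem IsIdCell.comp {a b c d p q : A.Obj} {Γ : A.HHom p q} {Δ : A.HHom a b} {m : a ⟶ c} {m' : b ⟶ d}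
    {Δ' : A.HHom c d} {x : A.Cell (HPath.single Δ) m m' Δ'} (hx : IsIdCell x) {k : p ⟶ a} {k' : q ⟶ b}
    {n : p ⟶ c} {n' : q ⟶ d} (hn : k ≫ m = n) (hn' : k' ≫ m' = n')
    {θ : A.Cell (HPath.single Γ) k k' Δ} :
    IsIdCell (A.comp x (.single θ) hn hn') ↔ IsIdCell θ := by
  cases hx
  obtain rfl : k = n := by rw [← hn, Category.comp_id]
  obtain rfl : k' = n' := by rw [← hn', Category.comp_id]
  rw [A.id_comp]

theorem IsIdCell.map (F : VDFunctor A B) {a b c d : A.Obj} {Γ : A.HHom a b} {m : a ⟶ c} {m' : b ⟶ d}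
    {Δ : A.HHom c d} {x : A.Cell (HPath.single Γ) m m' Δ} (h : IsIdCell x) :
    IsIdCell (A := B) (Γ := F.mapH Γ) (F.mapCell x) := by
  cases h
  exact IsIdCell.of_heq rfl rfl rfl (heq_of_eq (F.vert.map_id _).symm)
    (heq_of_eq (F.vert.map_id _).symm) HEq.rfl (VertTrans.map_idc_heq F Γ).symm (.mk _)

/-- With identity components, naturality says that the two functors act in the same way on vertical
morphisms and on multicells. Uniqueness of the chosen lifts rests on this. -/
theorem eq_of_isId {F G : VDFunctor A B} (χ : VertTrans F G) (hv : ∀ x, IsIdVert (χ.vert.app x))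
    (hc : ∀ {x y : A.Obj} (Γ : A.HHom x y), IsIdCell (χ.cell Γ)) :
    F = G ∧ HEq χ (VertTrans.id F) := by
  obtain ⟨⟨v, mH, mC⟩, h₁, h₂⟩ := F
  obtain ⟨⟨v', mH', mC'⟩, h₁', h₂'⟩ := G
  obtain rfl : v = v' := CategoryTheory.Functor.hext (fun x => (hv x).obj_eq)
    (fun x y f => (hv x).heq_of_comp_eq (hv y) (χ.vert.naturality f))
  obtain rfl : @mH = @mH' := by
    funext x y Γ
    exact (hc Γ).hhom_eq
  have hrow : ∀ {x y : A.Obj} (Γ : HPath A.HHom x y), HEq (χ.row Γ)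
      (B.idRow (Γ.map v.obj (fun _ _ => mH))) := by
    intro x y Γ
    induction Γ with
    | nil => exact VDGraph.Row.nil_hcongr rfl (heq_of_eq (hv _).eq_id)
    | snoc Γ e ih =>
      exact VDGraph.Row.snoc_hcongr _ _ rfl rfl rfl rfl rfl (heq_of_eq (hv _).eq_id)
        (heq_of_eq (hv _).eq_id) (heq_of_eq (hv _).eq_id) HEq.rfl HEq.rfl ih (hc e).heq_idc
  -- This is naturality of `χ` at a multicell: the identity cell below and the identity row above
  -- both cancel.
  obtain rfl : @mC = @mC' := by
    funext x y z t Γ f f' Δ θ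
    apply eq_of_heq
    have e₁ := B.comp_hcongr rfl rfl rfl rfl rfl rfl rfl rfl rfl HEq.rfl HEq.rfl HEq.rfl
      (heq_of_eq (hv z).eq_id) (heq_of_eq (hv t).eq_id) HEq.rfl (hc Δ).heq_idc
      (HEq.refl (VDGraph.Row.single (mC θ)))
    have e₂ := B.comp_hcongr (χ.vert.naturality f).symm (χ.vert.naturality f').symm rfl rfl
      rfl rfl rfl rfl rfl (heq_of_eq (hv x).eq_id)
      (heq_of_eq (hv y).eq_id) HEq.rfl HEq.rfl HEq.rfl HEq.rfl (HEq.refl (mC' θ)) (hrow Γ)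
    refine (VertTrans.id_comp_heq (mC θ) rfl rfl).symm.trans (e₁.symm.trans
      ((heq_of_eq (χ.naturality θ)).trans (e₂.trans ?_)))
    rw [B.comp_id_of_eq]
    exact VDGraph.castSides_heq _ _ _
  exact ⟨rfl, heq_of_eq (VertTrans.ext_heq (fun x => (hv x).eq_id) fun Γ => (hc Γ).heq_idc)⟩

end Identities

/-! ### Transformations with cartesian components are cartesian. -/

section Cartesian

variable {X M B : VDC.{w}}

/-- Vertical morphisms cartesian with respect to a virtual double functor. -/
def IsCartesianVert (p : VDFunctor M B) {y z : M.Obj} (m : y ⟶ z) : Prop :=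
  ∀ {x : M.Obj} (k : x ⟶ z) (g : p.vert.obj x ⟶ p.vert.obj y), g ≫ p.vert.map m = p.vert.map k →
    ∃! l : x ⟶ y, l ≫ m = k ∧ p.vert.map l = g

/-- Multicells through which all multicells with the same bottom factorize uniquely. -/
def IsCartesianCell {a b c d : M.Obj} {Δ : M.HHom a b} {m : a ⟶ c} {m' : b ⟶ d} {Δ' : M.HHom c d}
    (x : M.Cell (HPath.single Δ) m m' Δ') : Prop :=
  ∀ {p q : M.Obj} {Γ : HPath M.HHom p q} {k : p ⟶ a} {k' : q ⟶ b} {n : p ⟶ c} {n' : q ⟶ d}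
    (hn : k ≫ m = n) (hn' : k' ≫ m' = n'),
    Function.Bijective (fun θ : M.Cell Γ k k' Δ => M.comp x (.single θ) hn hn')

/-- The row of (not yet natural) transformation data on top of that of another. -/
def transTower {F G H : VDMap X.toVDGraph M.toVDGraph} (ν : F.vert ⟶ G.vert)
    (c : ∀ x y : X.Obj, ∀ Γ : X.HHom x y,
      M.Cell (HPath.single (F.mapH Γ)) (ν.app x) (ν.app y) (G.mapH Γ)) (μ : G.vert ⟶ H.vert)
    (d : ∀ x y : X.Obj, ∀ Γ : X.HHom x y,
      M.Cell (HPath.single (G.mapH Γ)) (μ.app x) (μ.app y) (H.mapH Γ)) {x : X.Obj} :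
    {y : X.Obj} → (Γ : HPath X.HHom x y) →
      M.Tower (F.mapPath Γ) (ν.app x) (ν.app y) (G.mapPath Γ) (μ.app x) (μ.app y) (H.mapPath Γ)
  | _, .nil => .nil _ _
  | _, .snoc Γ e => .snoc (transTower ν c μ d Γ) (.single (c _ _ e)) (d _ _ e) rfl rfl

/-- Associativity for the tower formed by two stacked rows of components. It is stated for bare
families of cells because it is applied while their naturality on multicells is still to be proved.
-/
theorem comp_transRow {F G H : VDMap X.toVDGraph M.toVDGraph} (ν : F.vert ⟶ G.vert)
    (c : ∀ x y : X.Obj, ∀ Γ : X.HHom x y,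
      M.Cell (HPath.single (F.mapH Γ)) (ν.app x) (ν.app y) (G.mapH Γ)) (μ : G.vert ⟶ H.vert)
    (d : ∀ x y : X.Obj, ∀ Γ : X.HHom x y,
      M.Cell (HPath.single (G.mapH Γ)) (μ.app x) (μ.app y) (H.mapH Γ)) (π : F.vert ⟶ H.vert)
    (r : ∀ x y : X.Obj, ∀ Γ : X.HHom x y,
      M.Cell (HPath.single (F.mapH Γ)) (π.app x) (π.app y) (H.mapH Γ))
    (h : ∀ x, ν.app x ≫ μ.app x = π.app x)
    (hr : ∀ x y Γ, M.comp (d x y Γ) (.single (c x y Γ)) (h x) (h y) = r x y Γ)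
    {x y : X.Obj} {Γ : HPath X.HHom x y} {z t : M.Obj} {v : H.vert.obj x ⟶ z}
    {v' : H.vert.obj y ⟶ t} {Λ : M.HHom z t} (κ : M.Cell (H.mapPath Γ) v v' Λ) {k k' n n'}
    (hk : μ.app x ≫ v = k) (hk' : μ.app y ≫ v' = k') (hn : ν.app x ≫ k = n)
    (hn' : ν.app y ≫ k' = n') (hm : π.app x ≫ v = n) (hm' : π.app y ≫ v' = n') :
    M.comp (M.comp κ (VDMap.transRow μ d Γ) hk hk') (VDMap.transRow ν c Γ) hn hn' =
      M.comp κ (VDMap.transRow π r Γ) hm hm' := by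
  have hu : ∀ {y : X.Obj} (Γ : HPath X.HHom x y),
      (transTower ν c μ d Γ).upper = VDMap.transRow ν c Γ := by
    intro y Γ
    induction Γ with
    | nil => rfl
    | snoc Γ e ih =>
      change VDGraph.Row.snoc (transTower ν c μ d Γ).upper _ _ = _
      rw [ih]
      rfl
  have hl : ∀ {y : X.Obj} (Γ : HPath X.HHom x y),
      (transTower ν c μ d Γ).lower = VDMap.transRow μ d Γ := by
    intro y Γ
    induction Γ with
    | nil => rfl
    | snoc Γ e ih =>
      change VDGraph.Row.snoc (transTower ν c μ d Γ).lower _ _ = _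
      rw [ih]
      rfl
  have hrow : ∀ {y : X.Obj} (Γ : HPath X.HHom x y),
      HEq (M.compRow (transTower ν c μ d Γ)) (VDMap.transRow π r Γ) := by
    intro y Γ
    induction Γ with
    | nil => exact VDGraph.Row.nil_hcongr rfl (heq_of_eq (h _))
    | snoc Γ e ih =>
      refine VDGraph.Row.snoc_hcongr _ _ rfl rfl rfl rfl rfl (heq_of_eq (h _))
        (heq_of_eq (h _)) (heq_of_eq (h _)) HEq.rfl HEq.rfl ih ?_
      rw [← hr]
      exact M.comp_hcongr _ _ _ _ rfl rfl rfl rfl rfl HEq.rfl HEq.rfl HEq.rfl HEq.rfl HEq.rfl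
        HEq.rfl HEq.rfl HEq.rfl
  have e := M.assoc_of_eq κ (transTower ν c μ d Γ) hk hk' hn hn'
  rw [hu, hl] at e
  exact e.trans (eq_of_heq (M.comp_hcongr _ _ _ _ rfl rfl rfl rfl rfl (heq_of_eq (h _))
    (heq_of_eq (h _)) HEq.rfl HEq.rfl HEq.rfl HEq.rfl HEq.rfl (hrow Γ)))

/-- The factorization is found componentwise, for vertical morphisms over `p` and for cells
absolutely: the cells of `g` impose no condition because `B` is chaotic. Naturality and uniqueness
follow from uniqueness of these component factorizations. -/
theorem existsUnique_factorization (hB : B.IsChaotic) (p : VDFunctor M B)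
    {e₀ e' e : VDFunctor X M} {φ : VertTrans e' e} (hv : ∀ x, IsCartesianVert p (φ.vert.app x))
    (hc : ∀ {x y : X.Obj} (Γ : X.HHom x y), IsCartesianCell (φ.cell Γ)) (ψ : VertTrans e₀ e)
    (g : VertTrans (e₀.comp p) (e'.comp p))
    (h : g.comp (VertTrans.whiskerRight φ p) = VertTrans.whiskerRight ψ p) :
    ∃! χ : VertTrans e₀ e', χ.comp φ = ψ ∧ VertTrans.whiskerRight χ p = g := by
  -- `γ` is a copy of the components of `g` whose type is spelled out through `p`, so that rewriting
  -- applies.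
  obtain ⟨γ, hγ⟩ : ∃ γ : ∀ x, p.vert.obj (e₀.vert.obj x) ⟶ p.vert.obj (e'.vert.obj x),
      ∀ x, g.vert.app x = γ x := ⟨_, fun _ => rfl⟩
  have hγ' : ∀ {x y : X.Obj} (f : x ⟶ y), p.vert.map (e₀.vert.map f) ≫ γ y =
      γ x ≫ p.vert.map (e'.vert.map f) := fun {x y} f => by
    rw [← hγ, ← hγ]
    exact g.vert.naturality f
  have h' : ∀ x, γ x ≫ p.vert.map (φ.vert.app x) = p.vert.map (ψ.vert.app x) := fun x => by
    rw [← hγ]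
    exact congrArg (fun t : VertTrans _ _ => t.vert.app x) h
  choose l hl _ using fun x => hv x (ψ.vert.app x) (γ x) (h' x)
  have hl₁ : ∀ x, l x ≫ φ.vert.app x = ψ.vert.app x := fun x => (hl x).1
  have hl₂ : ∀ x, p.vert.map (l x) = γ x := fun x => (hl x).2
  let ν : e₀.vert ⟶ e'.vert :=
    { app := l
      naturality := fun x y f => by
        -- Both composites solve one and the same factorization problem through `φ.vert.app y`.
        refine (hv y (e₀.vert.map f ≫ ψ.vert.app y) (p.vert.map (e₀.vert.map f) ≫ γ y)
          ?_).unique ⟨?_, ?_⟩ ⟨?_, ?_⟩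
        · rw [Category.assoc, h', ← Functor.map_comp]
        · rw [Category.assoc, hl₁]
        · rw [Functor.map_comp, hl₂]
        · rw [Category.assoc, φ.vert.naturality, ← Category.assoc, hl₁, ψ.vert.naturality]
        · rw [Functor.map_comp, hl₂, hγ'] }
  choose c hc' using fun (x y : X.Obj) (Γ : X.HHom x y) =>
    (hc Γ (k := ν.app x) (k' := ν.app y) (hl₁ x) (hl₁ y)).2 (ψ.cell Γ)
  let χ : VertTrans e₀ e' :=
    { vert := ν
      cell := fun {x y} Γ => c x y Γ
      naturality := fun {x y z t Γ f f' Δ} θ => by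
        -- Naturality is tested after composing with the cartesian cell `φ.cell Δ`; naturality of
        -- `ψ` and of `φ` then brings both sides to `e.mapCell θ` composed with the row of `ψ`.
        apply (hc Δ rfl rfl).1
        dsimp only
        refine (M.assoc_single (φ.cell Δ) (c _ _ Δ) (.single (e₀.mapCell θ)) (hl₁ z) (hl₁ t)
          (by rw [← hl₁, Category.assoc]) (by rw [← hl₁, Category.assoc]) rfl rfl).symm.trans ?_
        have e₁ : M.comp (φ.cell Δ) (.single (c _ _ Δ)) (hl₁ z) (hl₁ t) = ψ.cell Δ := hc' _ _ Δ
        rw [e₁, ψ.naturality_of_eq]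
        refine Eq.trans ?_ (M.assoc_single (φ.cell Δ) (e'.mapCell θ)
          (VDMap.transRow ν (fun x y e => c x y e) Γ) rfl rfl
          (by rw [← Category.assoc, ← ν.naturality])
          (by rw [← Category.assoc, ← ν.naturality])
          (ν.naturality f).symm (ν.naturality f').symm)
        rw [φ.naturality]
        exact (comp_transRow ν c φ.vert (fun _ _ e => φ.cell e) ψ.vert (fun _ _ e => ψ.cell e) hl₁
          hc' _ _ _ _ _ _ _).symm }
  refine ⟨χ, ⟨VertTrans.ext_heq hl₁ fun {x y} Γ => ?_, hB.hom₂_ext fun x => (hl₂ x).trans (hγ x).symm⟩, ?_⟩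
  · rw [← hc' x y Γ]
    exact M.comp_hcongr _ _ _ _ rfl rfl rfl rfl rfl HEq.rfl HEq.rfl HEq.rfl HEq.rfl HEq.rfl
        HEq.rfl HEq.rfl HEq.rfl
  · rintro χ' ⟨k₁, k₂⟩
    have a : ∀ x, χ'.vert.app x = l x := fun x => (hv x (ψ.vert.app x) (γ x) (h' x)).unique
      ⟨congrArg (fun t : VertTrans _ _ => t.vert.app x) k₁,
        (congrArg (fun t : VertTrans _ _ => t.vert.app x) k₂).trans (hγ x)⟩ (hl x)
    obtain ⟨v, c', nat⟩ := χ'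
    obtain rfl : v = ν := NatTrans.ext (funext a)
    refine VertTrans.ext_heq (fun _ => rfl) fun {x y} Γ => heq_of_eq ?_
    apply (hc Γ (hl₁ x) (hl₁ y)).1
    refine Eq.trans (eq_of_heq ?_) (hc' x y Γ).symm
    refine HEq.trans ?_ (VertTrans.cell_heq rfl rfl (heq_of_eq k₁) Γ)
    exact M.comp_hcongr _ _ _ _ rfl rfl rfl rfl rfl HEq.rfl HEq.rfl HEq.rfl HEq.rfl HEq.rfl
        HEq.rfl HEq.rfl HEq.rfl

end Cartesian

end VDC

/-! ### Reindexings: chosen cartesian lifts for matrices. -/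

namespace VDMat

open VDC

variable {A B : VDC.{u + 1}}

/-- The index function of a factorization is prescribed by `g`, and its entries are forced because
composition with an identity is a bijection. -/
theorem isCartesianVert {Y Z : Obj A} {m : Y ⟶ Z} (h : ∀ i, IsIdVert (VHom.map m i)) :
    IsCartesianVert (map (oneTerminal.toHom A)) (y := Y) (z := Z) m := by
  intro X k g hg
  obtain ⟨q, n⟩ := k
  obtain ⟨r, o⟩ := g
  obtain rfl : (fun i => VHom.idx m (r i)) = q := congrArg VHom.idx hg
  choose l hl using fun i => (h (r i)).bijective.2 (n i)
  refine ⟨VHom.mk r l, ⟨congrArg (VHom.mk _) (funext hl), ?_⟩, ?_⟩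
  · exact congrArg (VHom.mk r) (funext fun _ => Subsingleton.elim (α := (_ : Discrete PUnit) ⟶ _) _ _)
  · rintro ⟨r', l'⟩ ⟨h₁, h₂⟩
    obtain rfl : r' = r := congrArg VHom.idx h₂
    refine congrArg (VHom.mk r') (funext fun i => (h (r' i)).bijective.1 ?_)
    exact (congrFun (eq_of_heq (VHom.mk.inj h₁).2) i).trans (hl i).symm

/-- Composition with a one-matrix cell is entrywise, and at each sequence of indices it is
composition with an identity cell, hence bijective. -/
theorem isCartesianCell {X Y Z W : (graph A).Obj} {Δ : (graph A).HHom X Y} {m : X ⟶ Z} {m' : Y ⟶ W}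
    {Δ' : (graph A).HHom Z W} {x : (graph A).Cell (HPath.single Δ) m m' Δ'}
    (h : ∀ i j, IsIdCell (x i j (.snoc (.nil i) j))) :
    IsCartesianCell (M := A.matrices) (a := X) (b := Y) (c := Z) (d := W) (Δ := Δ) (Δ' := Δ') (m := m)
      (m' := m') x := by
  intro P Q Γ k k' n n' hn hn'
  subst hn hn'
  have key : ∀ (θ : (graph A).Cell Γ k k' Δ) (i : Obj.I P) (j : Obj.I Q) (s : Ix Γ i j),
      A.matrices.comp (A := P) (B := Q) (C := X) (D := Y) (E := Z) (F := W) x (.single θ) rfl rfl i j s =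
      A.comp (x _ _ (.snoc (.nil _) _)) (VDGraph.Row.single (θ i j s)) rfl rfl :=
    fun θ i j s => comp_single_at x θ s
  constructor
  · intro θ θ' e
    funext i j s
    apply ((h (VHom.idx k i) (VHom.idx k' j)).bijective rfl rfl).1
    exact (key θ i j s).symm.trans ((congrFun (congrFun (congrFun e i) j) s).trans (key θ' i j s))
  · intro ξ
    choose θ hθ using fun (i : Obj.I P) (j : Obj.I Q) (s : Ix Γ i j) =>
      ((h (VHom.idx k i) (VHom.idx k' j)).bijective (k := VHom.map k i) (k' := VHom.map k' j)
        (Γ := s.eval) rfl rfl).2 (ξ i j s)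
    refine ⟨θ, ?_⟩
    funext i j s
    exact (key θ i j s).trans (hθ i j s)

theorem isIdVert {X Y : Obj A} {m : X ⟶ Y} (hI : X.I = Y.I)
    (hm : HEq (VHom.idx m) (fun i : X.I => i)) (h : ∀ i, IsIdVert (VHom.map m i)) :
    IsIdVert (A := A.matrices) (a := X) (b := Y) m := by
  obtain ⟨I, a⟩ := X
  obtain ⟨J, b⟩ := Y
  obtain rfl : I = J := hI
  obtain ⟨r, l⟩ := m
  obtain rfl : r = fun i => i := eq_of_heq hm
  obtain rfl : a = b := funext fun i => (h i).obj_eq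
  obtain rfl : l = fun i => 𝟙 (a i) := funext fun i => (h i).eq_id
  exact .mk (A := A.matrices) ⟨I, a⟩

theorem isIdCell {X Y Z W : A.matrices.Obj} {Δ : A.matrices.HHom X Y} {m : X ⟶ Z} {m' : Y ⟶ W}
    {Δ' : A.matrices.HHom Z W} {x : A.matrices.Cell (HPath.single Δ) m m' Δ'}
    (hm : IsIdVert m) (hm' : IsIdVert m')
    (h : ∀ (i : Obj.I X) (j : Obj.I Y), IsIdCell (x i j (.snoc (.nil i) j))) : IsIdCell x := by
  cases hm
  cases hm'
  obtain rfl : Δ = Δ' := funext fun i => funext fun j => (h i j).hhom_eq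
  obtain rfl : x = A.matrices.idc Δ := by
    funext i j s
    obtain rfl := Ix.single_eq s
    exact eq_of_heq (h i j).heq_idc
  exact .mk Δ

/-- Vertical transformations whose entries are identities, up to equality of boundaries. -/
structure IsReindexing {X : VDC.{u + 1}} {e' e : VDFunctor X A.matrices} (φ : VertTrans e' e) :
    Prop where
  vert : ∀ (x : X.Obj) (i : (e'.vert.obj x).I), IsIdVert (VHom.map (φ.vert.app x) i)
  cell : ∀ {x y : X.Obj} (Γ : X.HHom x y) (i : (e'.vert.obj x).I) (j : (e'.vert.obj y).I),
    IsIdCell (φ.cell Γ i j (.snoc (.nil i) j))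

namespace IsReindexing

variable {X : VDC.{u + 1}} {e'' e' e : VDFunctor X A.matrices}

theorem id (e : VDFunctor X A.matrices) : IsReindexing (VertTrans.id e) where
  vert _ _ := .mk _
  cell _ _ _ := .mk _

theorem comp_cell_at (ψ : VertTrans e'' e') (φ : VertTrans e' e) {x y : X.Obj} (Γ : X.HHom x y)
    (i : (e''.vert.obj x).I) (j : (e''.vert.obj y).I) :
    (ψ.comp φ).cell Γ i j (.snoc (.nil i) j) =
      A.comp (φ.cell Γ _ _ (.snoc (.nil _) _))
        (VDGraph.Row.single (ψ.cell Γ i j (.snoc (.nil i) j))) rfl rfl :=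
  comp_single_at _ _ _

theorem comp {ψ : VertTrans e'' e'} {φ : VertTrans e' e} (hψ : IsReindexing ψ)
    (hφ : IsReindexing φ) : IsReindexing (ψ.comp φ) where
  vert x i := (hψ.vert x i).comp (hφ.vert x _)
  cell Γ i j := by
    rw [comp_cell_at]
    exact ((hφ.cell Γ _ _).comp rfl rfl).2 (hψ.cell Γ i j)

theorem of_comp {ψ : VertTrans e'' e'} {φ : VertTrans e' e} (hφ : IsReindexing φ)
    (h : IsReindexing (ψ.comp φ)) : IsReindexing ψ where
  vert x i := (hφ.vert x _).of_comp (h.vert x i)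
  cell Γ i j := by
    have := h.cell Γ i j
    rw [comp_cell_at] at this
    exact ((hφ.cell Γ _ _).comp rfl rfl).1 this

theorem whiskerLeft {Y : VDC.{u + 1}} (f : VDFunctor Y X) {φ : VertTrans e' e}
    (hφ : IsReindexing φ) : IsReindexing (VertTrans.whiskerLeft f φ) where
  vert x i := hφ.vert (f.vert.obj x) i
  cell Γ i j := hφ.cell (f.mapH Γ) i j

theorem whiskerRight {φ : VertTrans e' e} (hφ : IsReindexing φ) (h : VDFunctor A B) :
    IsReindexing (VertTrans.whiskerRight φ (VDMat.map h)) where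
  vert x i := (hφ.vert x i).map h
  cell Γ i j := (hφ.cell Γ i j).map h

theorem existsUnique_factorization {e₀ : VDFunctor X A.matrices} {φ : VertTrans e' e}
    (hφ : IsReindexing φ) (ψ : VertTrans e₀ e)
    (g : VertTrans (e₀.comp (map (oneTerminal.toHom A))) (e'.comp (map (oneTerminal.toHom A))))
    (h : g.comp (VertTrans.whiskerRight φ (map (oneTerminal.toHom A))) =
      VertTrans.whiskerRight ψ (map (oneTerminal.toHom A))) :
    ∃! χ : VertTrans e₀ e', χ.comp φ = ψ ∧
      VertTrans.whiskerRight χ (map (oneTerminal.toHom A)) = g :=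
  VDC.existsUnique_factorization isChaotic_one.matrices _
    (fun x => isCartesianVert (hφ.vert x)) (fun Γ => isCartesianCell (hφ.cell Γ)) ψ g h

/-- Lying over an identity makes the index functions identities, and being a reindexing makes the
entries identities; together this leaves only the identity transformation. -/
theorem eq_of_heq_id {χ : VertTrans e' e} (hχ : IsReindexing χ)
    (h : e'.comp (map (oneTerminal.toHom A)) = e.comp (map (oneTerminal.toHom A)))
    (h' : HEq (VertTrans.whiskerRight χ (map (oneTerminal.toHom A)))
      (VertTrans.id (e'.comp (map (oneTerminal.toHom A))))) :
    e' = e ∧ HEq χ (VertTrans.id e') := by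
  have hI : ∀ x, (e'.vert.obj x).I = (e.vert.obj x).I := fun x =>
    congrArg (fun F : VDFunctor X one.matrices => (F.vert.obj x).I) h
  have key : ∀ {Y Z Z' : Obj one.{u + 1}} (f : Y ⟶ Z) (g : Y ⟶ Z'), Z = Z' → HEq f g →
      HEq (VHom.idx f) (VHom.idx g) := by
    rintro Y Z _ f _ rfl ⟨⟩
    rfl
  have hv : ∀ x, IsIdVert (χ.vert.app x) := fun x => isIdVert (hI x)
    (key _ _ (congrArg (fun F : VDFunctor X one.matrices => F.vert.obj x) h).symm
      (VertTrans.app_heq rfl h.symm h' x)) (hχ.vert x)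
  exact eq_of_isId χ hv fun {x y} Γ => isIdCell (hv x) (hv y) (hχ.cell Γ)

/-- The first lift factors through the second over an identity. By `of_comp` the comparison is again
a reindexing, so `eq_of_heq_id` makes it an identity. -/
theorem unique {φ : VertTrans e' e} {φ' : VertTrans e'' e} (hφ : IsReindexing φ)
    (hφ' : IsReindexing φ')
    (h : e'.comp (map (oneTerminal.toHom A)) = e''.comp (map (oneTerminal.toHom A)))
    (h' : HEq (VertTrans.whiskerRight φ (map (oneTerminal.toHom A)))
      (VertTrans.whiskerRight φ' (map (oneTerminal.toHom A)))) :
    e' = e'' ∧ HEq φ φ' := by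
  -- The identity of the common image, regarded as a 2-cell into the image of `e''`.
  obtain ⟨g, hg⟩ : ∃ g : VertTrans (e'.comp (map (oneTerminal.toHom A)))
      (e''.comp (map (oneTerminal.toHom A))), HEq g (VertTrans.id
        (e'.comp (map (oneTerminal.toHom A)))) := by
    rw [← h]
    exact ⟨_, HEq.rfl⟩
  have key : ∀ {F G H : VDFunctor X one.matrices} {g : VertTrans F G} {α : VertTrans F H}
      {β : VertTrans G H} (_ : F = G) (_ : HEq g (VertTrans.id F)) (_ : HEq α β), g.comp β = α := by
    rintro F _ H g α β rfl ⟨⟩ ⟨⟩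
    exact Category.id_comp (obj := VDFunctor X one.matrices) _
  obtain ⟨χ, ⟨e₁, e₂⟩, -⟩ := hφ'.existsUnique_factorization φ g (key h hg h')
  have hχ : IsReindexing χ := hφ'.of_comp (e₁.symm ▸ hφ)
  obtain ⟨rfl, k⟩ := hχ.eq_of_heq_id h ((heq_of_eq e₂).trans hg)
  cases k
  exact ⟨rfl, heq_of_eq (e₁.symm.trans (Category.id_comp (obj := VDFunctor X A.matrices) φ'))⟩

end IsReindexing

end VDMat

/-! ### Existence of reindexings. -/

namespace VDC

theorem IsChaotic.hom₂_hext {Z B : VDC.{w}} (hB : B.IsChaotic) {F F' G G' : VDFunctor Z B}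
    {α : VertTrans F G} {β : VertTrans F' G'} (hF : F = F') (hG : G = G')
    (h : ∀ x, HEq (α.vert.app x) (β.vert.app x)) : HEq α β := by
  subst hF hG
  exact heq_of_eq (hB.hom₂_ext fun x => eq_of_heq (h x))

section Lift

variable {X : VDC.{u + 1}} {b b' : VDFunctor X SetHc.{u}}

/-- The virtual double functor between virtual double categories of elements induced by a natural
transformation to `Set`. -/
abbrev elementsReindex (ν : setFunctor b ⟶ setFunctor b') : VDFunctor (elements b) (elements b') :=
  elementsMapOf (VDFunctor.id X) (show _ ⟶ (VDFunctor.id X).vert ⋙ setFunctor b' from ν)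

/-- The family of elements of `b`, as a family of elements of `b'`. -/
abbrev fibreReindex (ν : setFunctor b ⟶ setFunctor b') : VDFunctor X (elements b').matrices :=
  (fibre b).comp (VDMat.map (elementsReindex ν))

/-- The natural transformation given by `ν` on indices, with identity entries. -/
abbrev fibreTransVert (ν : setFunctor b ⟶ setFunctor b') :
    (fibreReindex ν).vert ⟶ (fibre b').vert where
  app x := VDMat.VHom.mk (X := (fibreReindex ν).vert.obj x) (Y := (fibre b').vert.obj x)
    (fun i => setFun (ν.app x) i) (fun i => 𝟙 (Elt.mk x (setFun (ν.app x) i)))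
  naturality x y f := by
    have e : ∀ i, setFun (ν.app y) (setFun ((setFunctor b).map f) i) =
        setFun ((setFunctor b').map f) (setFun (ν.app x) i) := fun i =>
      congrArg (fun m => setFun m i) (ν.naturality f)
    refine VDMat.VHom.ext (funext e) (Function.hfunext rfl fun i i' h => ?_)
    cases h
    exact Elt.hom_heq _ rfl (Elt.obj_ext _ rfl (heq_of_eq (e i)))
      (heq_of_eq ((Category.comp_id _).trans (Category.id_comp _).symm))

/-- The matrix of identity cells over `ν`. -/
abbrev fibreTransCell (ν : setFunctor b ⟶ setFunctor b') (x y : X.Obj) (Γ : X.HHom x y) :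
    (VDMat.graph (elements b')).Cell (HPath.single ((fibreReindex ν).mapH Γ))
      ((fibreTransVert ν).app x) ((fibreTransVert ν).app y) ((fibre b').mapH Γ) :=
  VDMat.ofEntries fun i j => (elements b').idc (A := Elt.mk x (setFun (ν.app x) i))
    (B := Elt.mk y (setFun (ν.app y) j)) Γ

theorem eval_fibreReindex (ν : setFunctor b ⟶ setFunctor b') {x : X.Obj} : ∀ {y : X.Obj}
    (Γ : HPath X.HHom x y) {i : ((fibreFunctor b).obj x).I} {j : ((fibreFunctor b).obj y).I}
    (s : VDMat.Ix (X := (fibreReindex ν).vert.obj x) (Y := (fibreReindex ν).vert.obj y)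
      ((fibreReindex ν).mapPath Γ) i j), (elementsProj b').mapPath s.eval = Γ
  | _, .nil, i, j, s => by
    obtain rfl : i = j := VDMat.Ix.eq_of_nil (X := (fibreReindex ν).vert.obj _) s
    obtain rfl := VDMat.Ix.nil_eq (X := (fibreReindex ν).vert.obj _) s
    rfl
  | _, .snoc (c := z) Γ e, _, _, s => by
    have h := VDMat.Ix.snoc_unsnoc (Z := (fibreReindex ν).vert.obj z) s
    rw [← h]
    exact congrArg (fun p => HPath.snoc p e) (eval_fibreReindex ν Γ _)

theorem rowAt_fibreTrans (ν : setFunctor b ⟶ setFunctor b') {x : X.Obj} : ∀ {y : X.Obj}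
    (Γ : HPath X.HHom x y) {i : ((fibreFunctor b).obj x).I} {j : ((fibreFunctor b).obj y).I}
    (s : VDMat.Ix (X := (fibreReindex ν).vert.obj x) (Y := (fibreReindex ν).vert.obj y)
      ((fibreReindex ν).mapPath Γ) i j),
    HEq ((elementsProj b').mapRow (VDMat.rowAt (VDMap.transRow (F := (fibreReindex ν).toVDMap)
      (G := (fibre b').toVDMap) (fibreTransVert ν) (fibreTransCell ν) Γ) s).2) (X.idRow Γ)
  | _, .nil, i, j, s => by
    obtain rfl : i = j := VDMat.Ix.eq_of_nil (X := (fibreReindex ν).vert.obj _) s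
    obtain rfl := VDMat.Ix.nil_eq (X := (fibreReindex ν).vert.obj _) s
    rfl
  | _, .snoc (c := z) Γ e, i, k, s => by
    obtain ⟨j, s', rfl⟩ : ∃ (j : _) (s' : VDMat.Ix ((fibreReindex ν).mapPath Γ) i j),
        VDMat.Ix.snoc (Z := (fibreReindex ν).vert.obj z) s' k = s :=
      ⟨_, _, VDMat.Ix.snoc_unsnoc (Z := (fibreReindex ν).vert.obj z) s⟩
    have h := VDMat.rowAt_snoc (VDMap.transRow (F := (fibreReindex ν).toVDMap)
      (G := (fibre b').toVDMap) (fibreTransVert ν) (fibreTransCell ν) Γ) (fibreTransCell ν _ _ e) rfl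
      s' (.snoc (Z := (fibreReindex ν).vert.obj z) (.nil j) k) _ HEq.rfl
    have h' : VDMat.rowAt (VDMap.transRow (F := (fibreReindex ν).toVDMap)
      (G := (fibre b').toVDMap) (fibreTransVert ν) (fibreTransCell ν) (Γ.snoc e))
      (VDMat.Ix.snoc (Z := (fibreReindex ν).vert.obj z) s' k) = _ := h
    rw [h']
    exact VDGraph.Row.snoc_heq _ _ (eval_fibreReindex ν Γ s') rfl (eval_fibre b' Γ _)
      (rowAt_fibreTrans ν Γ s') (VertTrans.map_idc_heq (elementsProj b')
        (X := Elt.mk _ (setFun (ν.app _) j)) (Y := Elt.mk z (setFun (ν.app z) k)) e)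

theorem fibreReindex_mapCell_heq (ν : setFunctor b ⟶ setFunctor b') {x y z t : X.Obj}
    {Γ : HPath X.HHom x y} {f : x ⟶ z} {f' : y ⟶ t} {Δ : X.HHom z t} (θ : X.Cell Γ f f' Δ)
    {i : ((fibreFunctor b).obj x).I} {j : ((fibreFunctor b).obj y).I}
    (s : VDMat.Ix (X := (fibreReindex ν).vert.obj x) (Y := (fibreReindex ν).vert.obj y)
      ((fibreReindex ν).mapPath Γ) i j) : HEq ((fibreReindex ν).mapCell θ i j s) θ := by
  obtain ⟨s', -, h⟩ := VDMat.comp_map_at (fibre b) (elementsReindex ν) θ s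
  exact h.trans ((elementsMapOf_mapCell_heq _ _ _).trans ((VDMap.id_mapCell_heq _).trans
    (fibre_mapCell_heq b θ s')))

/-- The reindexing of the families of elements along a natural transformation. -/
def fibreTrans (ν : setFunctor b ⟶ setFunctor b') : VertTrans (fibreReindex ν) (fibre b') where
  vert := fibreTransVert ν
  cell {x y} Γ := fibreTransCell ν x y Γ
  naturality {x y z t Γ f f' Δ} θ := by
    funext i j s
    -- Independently of the indices, both sides are `θ` composed with identities of `X`: an identity
    -- cell below on the left, a row of identity cells above on the right.
    apply eq_of_heq
    refine (heq_of_eq (VDMat.comp_single_at (fibreTransCell ν z t Δ) ((fibreReindex ν).mapCell θ)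
      s)).trans ?_
    refine (VertTrans.id_comp_heq (B := elements b') ((fibreReindex ν).mapCell θ i j s) rfl rfl).trans ?_
    refine (fibreReindex_mapCell_heq ν θ s).trans ?_
    refine HEq.trans ?_ (VDMat.comp_at_heq ((fibre b').mapCell θ) _
      ((fibreTransVert ν).naturality f).symm ((fibreTransVert ν).naturality f').symm s).symm
    refine (heq_of_eq (X.comp_id θ)).symm.trans ?_
    exact X.comp_hcongr _ _ _ _ rfl rfl rfl rfl (eval_fibreReindex ν Γ s).symm HEq.rfl HEq.rfl
      (heq_of_eq (eval_fibre b' Γ _).symm) HEq.rfl HEq.rfl HEq.rfl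
      (fibre_mapCell_heq b' θ _).symm (rowAt_fibreTrans ν Γ s).symm

theorem isReindexing_fibreTrans (ν : setFunctor b ⟶ setFunctor b') :
    VDMat.IsReindexing (fibreTrans ν) where
  vert _ _ := .mk (A := elements b') _
  cell {x y} Γ i j := .mk (A := elements b') (a := Elt.mk x (setFun (ν.app x) i))
    (b := Elt.mk y (setFun (ν.app y) j)) Γ

end Lift

section Existence

variable {X A : VDC.{u + 1}}

/-- A virtual double functor to matrices is the unit followed by `Mat` of its transpose; this
combines naturality of the unit with `fibre_comp_eval`. -/
theorem exists_eq_fibre_comp (e : VDFunctor X A.matrices) :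
    ∃ (b : VDFunctor X SetHc.{u}) (h : VDFunctor (elements b) A),
      (fibre b).comp (VDMat.map h) = e := by
  refine ⟨e.comp (familyIndex A), (elementsMap e rfl).comp (eval A), ?_⟩
  rw [VDMat.map_comp, ← VDFunctor.comp_assoc, ← comp_fibre e rfl, VDFunctor.comp_assoc,
    fibre_comp_eval, VDFunctor.comp_id]

/-- By `exists_eq_fibre_comp` the functor `e` is the image of some `fibre c` under `Mat h`. For
`fibre c` the lift is `fibreTrans`, and `Mat h` preserves identity entries. -/
theorem exists_isReindexing (e : VDFunctor X A.matrices) {b : VDFunctor X one.matrices}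
    (β : VertTrans b (e.comp (VDMat.map (oneTerminal.toHom A)))) :
    ∃ (e' : VDFunctor X A.matrices) (φ : VertTrans e' e), VDMat.IsReindexing φ ∧
      e'.comp (VDMat.map (oneTerminal.toHom A)) = b ∧
      HEq (VertTrans.whiskerRight φ (VDMat.map (oneTerminal.toHom A))) β := by
  obtain ⟨c, h, rfl⟩ := exists_eq_fibre_comp e
  -- Entries in the terminal virtual double category carry no information, so `β` amounts to a
  -- natural family of functions between index sets.
  let ν : setFunctor (b.comp (matrixIndex one)) ⟶ setFunctor c :=
    { app := fun x => setHom (VDMat.VHom.idx (β.vert.app x))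
      naturality := fun x y f => congrArg setHom (congrArg VDMat.VHom.idx (β.vert.naturality f)) }
  -- Functors to `Mat 1` may be compared in `Set_hc`, where only the index sets and functions
  -- remain.
  have hb : ((fibreReindex ν).comp (VDMat.map h)).comp (VDMat.map (oneTerminal.toHom A)) = b :=
    matrixIndex_one_injective (isChaotic_SetHc.hom_ext rfl)
  refine ⟨_, VertTrans.whiskerRight (fibreTrans ν) (VDMat.map h),
    (isReindexing_fibreTrans ν).whiskerRight h, hb, ?_⟩
  exact isChaotic_one.matrices.hom₂_hext hb rfl fun x => matrices_one_hom_heq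
    (congrArg (fun F : VDFunctor X one.matrices => F.vert.obj x) hb) rfl HEq.rfl

end Existence

end VDC

/-! ### Factorization through the 2-category of split fibrations. -/

namespace TwoCat

open Bicategory

universe w₁ v₁ u₁ w₂ v₂ u₂

variable {K : Type u₁} [Bicategory.{w₁, v₁} K] {L : Type u₂} [Bicategory.{w₂, v₂} L]

/-- Strictness fixes the unit and composition isomorphisms as `eqToHom`s, so the remaining data
determine the 2-functor. -/
theorem strictPseudofunctor_ext {F G : StrictPseudofunctor K L}
    (h : F.toPrelaxFunctor = G.toPrelaxFunctor) : F = G := by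
  obtain ⟨⟨⟨P, i, c, _, _, _, _, _⟩, h₁, h₂⟩, h₃, h₄⟩ := F
  obtain ⟨⟨⟨P', i', c', _, _, _, _, _⟩, h₁', h₂'⟩, h₃', h₄'⟩ := G
  obtain rfl : P = P' := h
  obtain rfl : i = i' := funext fun x => (h₂ x).trans (h₂' x).symm
  obtain rfl : @c = @c' := by
    funext x y z f g
    exact (h₄ f g).trans (h₄' f g).symm
  rfl

/-- A bridge from `IsHomLift` to the heterogeneous equalities in which lifts of matrices are
constructed and compared. -/
theorem isHomLift_iff_heq {𝒳 : Type u₁} [Category.{v₁} 𝒳] {𝒮 : Type u₂} [Category.{v₂} 𝒮]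
    {p : 𝒳 ⥤ 𝒮} {a c : 𝒳} {R : 𝒮} (f : R ⟶ p.obj c) (φ : a ⟶ c) :
    p.IsHomLift f φ ↔ p.obj a = R ∧ HEq (p.map φ) f := by
  constructor
  · intro h
    have e := IsHomLift.domain_eq p f φ
    subst e
    exact ⟨rfl, heq_of_eq (IsHomLift.eq_of_isHomLift p f φ).symm⟩
  · rintro ⟨rfl, h⟩
    cases h
    exact .map φ

variable [Strict K] [Strict L]

theorem Spl.eqToHom_comp_comp_hom {B : L} {a b : Spl B} {f f' g g' : a ⟶ b} (h : f = f')
    (α : f' ⟶ g) (h' : g = g') : Hom₂.hom (eqToHom h ≫ α ≫ eqToHom h') =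
      eqToHom (congrArg Hom.hom h) ≫ Hom₂.hom α ≫ eqToHom (congrArg Hom.hom h') := by
  subst h h'
  simp

/-- A 2-functor into a slice whose values are split fibrations, and which sends 1-cells to 1-cells
preserving chosen lifts, factorizes through the 2-category of split fibrations. -/
theorem exists_comp_forget_eq {B : L} (G : StrictPseudofunctor K (Slice B))
    (split : ∀ A : K, SplitFib (G.obj A).hom)
    (preserves : ∀ {A A' : K} (f : A ⟶ A') {X : L} {e' e : X ⟶ (G.obj A).left} (φ : e' ⟶ e),
      ((split A).fib X).chosen φ → ((split A').fib X).chosen (φ ▷ Slice.Hom.left (G.map f))) :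
    ∃ R : StrictPseudofunctor K (Spl B), R.comp (Spl.forget B) = G := by
  refine ⟨.mk''
    { obj := fun A => ⟨G.obj A, split A⟩
      map := fun f => ⟨G.map f, fun φ hφ => preserves f φ hφ⟩
      map₂ := fun η => ⟨G.map₂ η⟩
      map_id := fun A => Spl.Hom.ext (G.map_id A)
      map_comp := fun f g => Spl.Hom.ext (G.map_comp f g)
      map₂_id := fun f => Spl.Hom₂.ext (G.map₂_id f)
      map₂_comp := fun η θ => Spl.Hom₂.ext (G.map₂_comp η θ)
      map₂_whisker_left := fun f g h η => Spl.Hom₂.ext ?_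
      map₂_whisker_right := fun η f => Spl.Hom₂.ext ?_ }, strictPseudofunctor_ext rfl⟩
  · have := G.map₂_whisker_left f η
    rw [G.mapComp_eq_eqToIso, G.mapComp_eq_eqToIso] at this
    rw [Spl.eqToHom_comp_comp_hom]
    exact this
  · have := G.map₂_whisker_right η f
    rw [G.mapComp_eq_eqToIso, G.mapComp_eq_eqToIso] at this
    rw [Spl.eqToHom_comp_comp_hom]
    exact this

end TwoCat

/-! ### The split fibrations of matrices, and the main theorem. -/

namespace VDC

open VDMat

/-- The split fibration structure on postcomposition with `Mat A ⟶ Mat 1`: the chosen lifts are the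
vertical transformations with identity entries. -/
def splitFibrationMat (A X : VDC.{u + 1}) : TwoCat.SplitFibration
    (Bicategory.postcomp X (Mat.map (oneTerminal.toHom A))) where
  chosen _ _ φ := IsReindexing (A := A) (X := X) φ
  cartesian {e' e} φ hφ :=
    { universal_property' := fun {e₀} g ψ _ => by
        -- Being a lift here is the equation between `g` followed by the image of `φ` and the image
        -- of `ψ`, which is the hypothesis of the factorization theorem.
        have h := IsHomLift.eq_of_isHomLift
          (Bicategory.postcomp X (Mat.map (oneTerminal.toHom A)))
          (g ≫ (Bicategory.postcomp X (Mat.map (oneTerminal.toHom A))).map φ) ψ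
        obtain ⟨χ, ⟨h₁, h₂⟩, h₃⟩ := IsReindexing.existsUnique_factorization hφ ψ g h
        refine ⟨χ, ⟨(TwoCat.isHomLift_iff_heq _ _).2 ⟨rfl, heq_of_eq h₂⟩, h₁⟩, ?_⟩
        rintro χ' ⟨k₁, k₂⟩
        exact h₃ χ' ⟨k₂, eq_of_heq ((TwoCat.isHomLift_iff_heq _ _).1 k₁).2⟩ }
  existsUnique_lift e b β := by
    obtain ⟨e', φ, h, h₁, h₂⟩ := exists_isReindexing (A := A) (X := X) e β
    refine ⟨⟨e', φ⟩, ⟨h, (TwoCat.isHomLift_iff_heq _ _).2 ⟨h₁, h₂⟩⟩, ?_⟩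
    rintro ⟨e'', φ'⟩ ⟨k, k'⟩
    obtain ⟨k₁, k₂⟩ := (TwoCat.isHomLift_iff_heq _ _).1 k'
    obtain ⟨rfl, j⟩ := IsReindexing.unique k h (k₁.trans h₁.symm) (k₂.trans h₂.symm)
    cases j
    rfl
  id_chosen e := IsReindexing.id (A := A) (X := X) e
  comp_chosen _ _ hψ hφ := IsReindexing.comp hψ hφ

/-- `Mat` is familial. -/
theorem isFamilial_Mat : TwoCat.IsFamilial Mat.{u} oneTerminal :=
  ⟨isParametricRightTwoAdjoint_Mat, TwoCat.exists_comp_forget_eq _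
    (fun A => ⟨fun X => splitFibrationMat A X, fun f _ _ _ hφ => IsReindexing.whiskerLeft f hφ⟩)
    (fun f _ _ _ _ hφ => IsReindexing.whiskerRight hφ f)⟩

end VDC

theorem mainTheorem4 :
    VDFunctor.IsDiscreteOpfibration VDC.Phc.{u} ∧
    (∀ A : VDC.{u + 1}, VDC.Mat.{u}.obj A = A.matrices) ∧
    TwoCat.IsPolynomialOf VDC.Mat.{u} VDC.oneTerminal VDC.Phc.{u} ∧
    TwoCat.IsFamilial VDC.Mat.{u} VDC.oneTerminal :=
  ⟨VDC.isDiscreteOpfibration_Phc, fun _ => rfl, VDC.isPolynomialOf_Mat, VDC.isFamilial_Mat⟩
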